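/- For a primitive vector $\vec v\in\mathbb Z^N$ write $v=\langle\vec v\rangle$ for the line $\{\pm\vec v\}$ (equivalently, the rank-one summand) it spans. A finite nonempty set $\sigma$ of $k+1$ lines $v_0,\dots,v_k$ in $\mathbb Z^N$ is called \emph{standard} if $\langle\vec v_0,\dots,\vec v_k\rangle$ is a direct summand of $\mathbb Z^N$ of rank $k+1$; and, possibly after re-indexing and for some choice of signs, - \emph{2-additive} if $\vec v_0=\pm\vec v_1\pm\vec v_2$ and $\sigma\setminus\{v_0\}$ is standard; - \emph{3-additive} if $\vec v_0=\pm\vec v_1\pm\vec v_2\pm\vec v_3$ and $\sigma\setminus\{v_0\}$ is standard; - \emph{double-triple} if $\vec v_0=\pm\vec v_2\pm\vec v_3$, $\vec v_1=\pm\vec v_2\pm\vec v_4$ and $\sigma\setminus\{v_0,v_1\}$ is standard; - \emph{double-double} if $\vec v_0=\pm\vec v_2\pm\vec v_3$, $\vec v_1=\pm\vec v_4\pm\vec v_5$ and $\sigma\setminus\{v_0,v_1\}$ is standard. Let $B_N$ be the simplicial complex of standard simplices and $\operatorname{BAA}_N$ the simplicial complex of all simplices of these five types. For $m,n\ge0$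 and $X\in\{B,\operatorname{BAA}\}$ let $X_n^m$ be the full subcomplex of $\operatorname{Link}_{X_{m+n}}(\{e_1,\dots,e_m\})$ on the lines not contained in $\langle\vec e_1,\dots,\vec e_m\rangle$, where $\vec e_1,\dots,\vec e_{m+n}$ is the standard basis of $\mathbb Z^{m+n}$ (so $X^0_n=X_n$). For a vertex $w$ of $\operatorname{BAA}_n^m$ whose last coordinate has absolute value $R\ge1$, let $\widehat{\operatorname{Link}}{}^{<}_{\operatorname{BAA}_n^m}(w)$ be the full subcomplex of $\operatorname{Link}_{\operatorname{BAA}_n^m}(w)$ on the lines that are not contained in $\langle\vec e_1,\dots,\vec e_m,\vec w\rangle$ and are spanned by a vector whose last coordinate has absolute value less than $R$. **Theorem.** Let $m\ge0$, $n\ge4$, and let $\vec v_1,\vec v_2,\vec v_3,\vec w\in\mathbb Z^{m+n}$ be a partial basis such that $\{v_1,v_2,v_3,w\}$ is a simplex of $B_n^m$. Assume that the last coordinate $R$ of $\vec w$ is positive and that the last coordinates of $\vec v_1,\vec v_2,\vec v_3$ have absolute value smaller than $R$. Let $Q_n^m(\vec v_1,\vec v_2,\vec v_3;\vec w)$ be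 the full subcomplex of $\widehat{\operatorname{Link}}{}^{<}_{\operatorname{BAA}_n^m}(w)$ on the lines spanned by vectors of the form $$\vec v_1+a\vec w,\quad \vec v_2+a\vec w,\quad \vec v_3+a\vec w,\quad \vec v_1+\vec v_2+a\vec w,\quad \vec v_1+\vec v_2+\vec v_3+a\vec w,\quad \vec v_1+\vec v_3+a\vec w\qquad(a\in\mathbb Z).$$ Then $Q_n^m(\vec v_1,\vec v_2,\vec v_3;\vec w)$ is a finite simplicial complex and its geometric realization is $3$-connected. -/

import Mathlib

namespace BAAComplex

/-! ### Generalities on simplicial complexes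

Simplicial complexes are Mathlib's `PreAbstractSimplicialComplex V`: sets of nonempty finite subsets
of `V`, closed under passing to nonempty subsets. Not every element of `V` has to be a vertex. -/

section Complexes

variable {V : Type*}

/-- The full subcomplex of `K` on the vertices that lie in `S`. -/
def fullSubcomplex (K : PreAbstractSimplicialComplex V) (S : Set V) :
    PreAbstractSimplicialComplex V where
  faces := {τ | τ ∈ K.faces ∧ ∀ v ∈ τ, v ∈ S}
  isRelLowerSet_faces := fun {_} h =>
    ⟨(K.isRelLowerSet_faces h.1).1, fun _ hts ht =>
      ⟨(K.isRelLowerSet_faces h.1).2 hts ht, fun v hv => h.2 v (hts hv)⟩⟩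

/-- The link of `σ` in `K`: the simplices that are disjoint from `σ` and whose union with `σ` is a
simplex of `K`. For the empty set `σ` this is `K`. -/
def link [DecidableEq V] (K : PreAbstractSimplicialComplex V) (σ : Finset V) :
    PreAbstractSimplicialComplex V where
  faces := {τ | τ.Nonempty ∧ Disjoint τ σ ∧ τ ∪ σ ∈ K.faces}
  isRelLowerSet_faces := fun {_} h =>
    ⟨h.1, fun _ hts ht => ⟨ht, h.2.1.mono_left hts,
      (K.isRelLowerSet_faces h.2.2).2 (Finset.union_subset_union_left hts)
        (ht.mono Finset.subset_union_left)⟩⟩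

/-- The points of the geometric realization of `K`, in barycentric coordinates: nonnegative
functions on `V` whose support is a simplex of `K` and whose values sum to `1`. -/
def Realization (K : PreAbstractSimplicialComplex V) : Type _ :=
  {f : V → ℝ // (∀ v, 0 ≤ f v) ∧
    ∃ σ ∈ K.faces, Function.support f = (σ : Set V) ∧ ∑ v ∈ σ, f v = 1}

/-- The closed simplex of the realization that is spanned by `σ`. -/
def closedSimplex (K : PreAbstractSimplicialComplex V) (σ : Finset V) : Type _ :=
  {p : Realization K // ∀ v, v ∉ σ → p.1 v = 0}

/-- A closed simplex carries the Euclidean topology, given by its (finitely many nonzero)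
barycentric coordinates. -/
instance (K : PreAbstractSimplicialComplex V) (σ : Finset V) :
    TopologicalSpace (closedSimplex K σ) :=
  TopologicalSpace.induced (fun p => p.1.1) Pi.topologicalSpace

/-- The weak topology on the geometric realization: a set is open if and only if its intersection
with every closed simplex is open in that simplex. -/
instance (K : PreAbstractSimplicialComplex V) : TopologicalSpace (Realization K) :=
  ⨆ σ : K.faces, TopologicalSpace.coinduced
    (fun p : closedSimplex K (σ : Finset V) => p.1) inferInstance

end Complexes

/-- A space is `k`-connected if every continuous map from a sphere `S^(d-1)` with `d - 1 ≤ k` to it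
extends over the ball `D^d`. The sphere is empty for `d = 0`, so that the space is nonempty. -/
def IsNConnected (k : ℕ) (X : Type*) [TopologicalSpace X] : Prop :=
  ∀ d : ℕ, d ≤ k + 1 → ∀ f : C(Metric.sphere (0 : EuclideanSpace ℝ (Fin d)) 1, X),
    ∃ g : C(Metric.closedBall (0 : EuclideanSpace ℝ (Fin d)) 1, X),
      ∀ (x : EuclideanSpace ℝ (Fin d)) (hx : x ∈ Metric.sphere (0 : EuclideanSpace ℝ (Fin d)) 1),
        g ⟨x, Metric.sphere_subset_closedBall hx⟩ = f ⟨x, hx⟩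

/-! ### Lines in `ℤ^N`

The class `±x` of a primitive vector `x` is encoded by the line `ℤ ∙ x`, a rank-one summand.
The vectors that represent a line `L` are the `x` with `L = ℤ ∙ x`; there are two, `x` and `-x`. -/

noncomputable instance (N : ℕ) : DecidableEq (Submodule ℤ (Fin N → ℤ)) := Classical.decEq _

/-- A nonzero vector is primitive if it spans a direct summand. -/
def IsPrimitive {N : ℕ} (x : Fin N → ℤ) : Prop :=
  x ≠ 0 ∧ IsComplemented (Submodule.span ℤ {x})

/-- The set of lines, i.e. of `±`-classes of primitive vectors, in `ℤ^N`. -/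
def lines (N : ℕ) : Set (Submodule ℤ (Fin N → ℤ)) :=
  {L | ∃ x, IsPrimitive x ∧ L = Submodule.span ℤ {x}}

/-- A family of vectors is a partial basis if it is linearly independent and spans a direct summand
(equivalently, if it can be extended to a basis). -/
def IsPartialBasis {N k : ℕ} (x : Fin k → Fin N → ℤ) : Prop :=
  LinearIndependent ℤ x ∧ IsComplemented (Submodule.span ℤ (Set.range x))

/-- The last coordinate of a vector in `ℤ^N` (for `N = 0` the junk value `0`). -/
def lastCoord {N : ℕ} (x : Fin N → ℤ) : ℤ :=
  if h : 0 < N then x ⟨N - 1, Nat.sub_lt h Nat.one_pos⟩ else 0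

/-- `L = ⟨± x₁ ± x₂⟩` for representatives `x₁`, `x₂` of `L₁`, `L₂`; the signs are absorbed in the
choice of the representatives. -/
def IsSumTwo {N : ℕ} (L L₁ L₂ : Submodule ℤ (Fin N → ℤ)) : Prop :=
  ∃ x₁ x₂ : Fin N → ℤ, L₁ = Submodule.span ℤ {x₁} ∧ L₂ = Submodule.span ℤ {x₂} ∧
    L = Submodule.span ℤ {x₁ + x₂}

/-- `L = ⟨± x₁ ± x₂ ± x₃⟩` for representatives `x₁`, `x₂`, `x₃` of `L₁`, `L₂`, `L₃`. -/
def IsSumThree {N : ℕ} (L L₁ L₂ L₃ : Submodule ℤ (Fin N → ℤ)) : Prop :=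
  ∃ x₁ x₂ x₃ : Fin N → ℤ, L₁ = Submodule.span ℤ {x₁} ∧ L₂ = Submodule.span ℤ {x₂} ∧
    L₃ = Submodule.span ℤ {x₃} ∧ L = Submodule.span ℤ {x₁ + x₂ + x₃}

/-! ### The types of simplices -/

section Types

variable {N : ℕ}

/-- The lines in `σ` span a direct summand whose rank is the number of these lines. -/
def IsStandard (σ : Finset (Submodule ℤ (Fin N → ℤ))) : Prop :=
  (σ : Set (Submodule ℤ (Fin N → ℤ))) ⊆ lines N ∧
    Module.finrank ℤ (σ.sup id : Submodule ℤ (Fin N → ℤ)) = σ.card ∧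
    IsComplemented (σ.sup id)

def IsTwoAdditive (σ : Finset (Submodule ℤ (Fin N → ℤ))) : Prop :=
  (σ : Set (Submodule ℤ (Fin N → ℤ))) ⊆ lines N ∧
    ∃ v₀ v₁ v₂, [v₀, v₁, v₂].Nodup ∧ {v₀, v₁, v₂} ⊆ σ ∧
      IsSumTwo v₀ v₁ v₂ ∧ IsStandard (σ \ {v₀})

def IsThreeAdditive (σ : Finset (Submodule ℤ (Fin N → ℤ))) : Prop :=
  (σ : Set (Submodule ℤ (Fin N → ℤ))) ⊆ lines N ∧
    ∃ v₀ v₁ v₂ v₃, [v₀, v₁, v₂, v₃].Nodup ∧ {v₀, v₁, v₂, v₃} ⊆ σ ∧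
      IsSumThree v₀ v₁ v₂ v₃ ∧ IsStandard (σ \ {v₀})

def IsDoubleTriple (σ : Finset (Submodule ℤ (Fin N → ℤ))) : Prop :=
  (σ : Set (Submodule ℤ (Fin N → ℤ))) ⊆ lines N ∧
    ∃ v₀ v₁ v₂ v₃ v₄, [v₀, v₁, v₂, v₃, v₄].Nodup ∧ {v₀, v₁, v₂, v₃, v₄} ⊆ σ ∧
      IsSumTwo v₀ v₂ v₃ ∧ IsSumTwo v₁ v₂ v₄ ∧ IsStandard (σ \ {v₀, v₁})

def IsDoubleDouble (σ : Finset (Submodule ℤ (Fin N → ℤ))) : Prop :=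
  (σ : Set (Submodule ℤ (Fin N → ℤ))) ⊆ lines N ∧
    ∃ v₀ v₁ v₂ v₃ v₄ v₅, [v₀, v₁, v₂, v₃, v₄, v₅].Nodup ∧ {v₀, v₁, v₂, v₃, v₄, v₅} ⊆ σ ∧
      IsSumTwo v₀ v₂ v₃ ∧ IsSumTwo v₁ v₄ v₅ ∧ IsStandard (σ \ {v₀, v₁})

/-- `σ` is of one of the five types. -/
def IsBAASimplex (σ : Finset (Submodule ℤ (Fin N → ℤ))) : Prop :=
  IsStandard σ ∨ IsTwoAdditive σ ∨ IsThreeAdditive σ ∨ IsDoubleTriple σ ∨ IsDoubleDouble σ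

/-! The next lemmas show that these simplices form a simplicial complex. -/

lemma finrank_sup_add_finrank_inf (p q : Submodule ℤ (Fin N → ℤ)) :
    Module.finrank ℤ (p ⊔ q : Submodule ℤ (Fin N → ℤ)) +
      Module.finrank ℤ (p ⊓ q : Submodule ℤ (Fin N → ℤ)) =
        Module.finrank ℤ p + Module.finrank ℤ q := by
  have h := Submodule.rank_sup_add_rank_inf_eq p q
  simp only [← Module.finrank_eq_rank] at h
  exact_mod_cast h

lemma finrank_sup_le (σ : Finset (Submodule ℤ (Fin N → ℤ)))
    (h : (σ : Set (Submodule ℤ (Fin N → ℤ))) ⊆ lines N) :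
    Module.finrank ℤ (σ.sup id : Submodule ℤ (Fin N → ℤ)) ≤ σ.card := by
  induction σ using Finset.induction_on with
  | empty => simp
  | insert a s ha ih =>
    rw [Finset.sup_insert, Finset.card_insert_of_notMem ha, id]
    have h1 : Module.finrank ℤ a ≤ 1 := by
      obtain ⟨x, -, rfl⟩ := h (Finset.mem_coe.2 (Finset.mem_insert_self a s))
      exact (finrank_span_le_card ({x} : Set (Fin N → ℤ))).trans (by simp)
    have h2 := ih (fun y hy => h (Finset.mem_coe.2 (Finset.mem_insert_of_mem hy)))
    have h3 := finrank_sup_add_finrank_inf a (s.sup id)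
    omega

lemma IsStandard.mono {σ τ : Finset (Submodule ℤ (Fin N → ℤ))} (h : IsStandard σ) (hτ : τ ⊆ σ) :
    IsStandard τ := by
  obtain ⟨hl, hr, q, hq⟩ := h
  have hlτ : (τ : Set (Submodule ℤ (Fin N → ℤ))) ⊆ lines N := fun y hy => hl (hτ hy)
  have hlρ : ((σ \ τ : Finset _) : Set (Submodule ℤ (Fin N → ℤ))) ⊆ lines N :=
    fun y hy => hl (Finset.sdiff_subset hy)
  have hs : τ.sup id ⊔ (σ \ τ).sup id = σ.sup id := by
    rw [← Finset.sup_union, Finset.union_sdiff_of_subset hτ]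
  have h1 := finrank_sup_le τ hlτ
  have h2 := finrank_sup_le (σ \ τ) hlρ
  have hc := Finset.card_sdiff_add_card_eq_card hτ
  have h3 := finrank_sup_add_finrank_inf (τ.sup id) ((σ \ τ).sup id)
  rw [hs] at h3
  have h4 : Module.finrank ℤ (τ.sup id ⊓ (σ \ τ).sup id : Submodule ℤ (Fin N → ℤ)) = 0 := by omega
  have h5 : Disjoint (τ.sup id) ((σ \ τ).sup id) := by
    rw [disjoint_iff]
    exact Submodule.finrank_eq_zero.1 h4
  refine ⟨hlτ, by omega, (σ \ τ).sup id ⊔ q, ?_, ?_⟩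
  · exact h5.disjoint_sup_right_of_disjoint_sup_left (by rw [hs]; exact hq.disjoint)
  · rw [codisjoint_iff, ← sup_assoc, hs]
    exact hq.sup_eq_top

lemma IsStandard.exchange {σ τ : Finset (Submodule ℤ (Fin N → ℤ))} (h : IsStandard σ)
    (hl : (τ : Set (Submodule ℤ (Fin N → ℤ))) ⊆ lines N) (hc : τ.card = σ.card)
    (h₁ : ∀ v ∈ τ, v ≤ σ.sup id) (h₂ : ∀ v ∈ σ, v ≤ τ.sup id) : IsStandard τ := by
  have hs : τ.sup id = σ.sup id :=
    le_antisymm (Finset.sup_le fun v hv => h₁ v hv) (Finset.sup_le fun v hv => h₂ v hv)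
  exact ⟨hl, by rw [hs, hc, h.2.1], by rw [hs]; exact h.2.2⟩

lemma IsStandard.swap {σ : Finset (Submodule ℤ (Fin N → ℤ))} {a b : Submodule ℤ (Fin N → ℤ)}
    (h : IsStandard (σ \ {a})) (hl : (σ : Set (Submodule ℤ (Fin N → ℤ))) ⊆ lines N)
    (ha : a ∈ σ) (hb : b ∈ σ) (h₁ : a ≤ (σ \ {a}).sup id) (h₂ : b ≤ (σ \ {b}).sup id) :
    IsStandard (σ \ {b}) := by
  refine h.exchange (fun y hy => hl (Finset.sdiff_subset hy)) ?_ ?_ ?_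
  · rw [Finset.card_sdiff_of_subset (by simpa using hb),
      Finset.card_sdiff_of_subset (by simpa using ha), Finset.card_singleton, Finset.card_singleton]
  · intro v hv
    by_cases hva : v = a
    · exact hva ▸ h₁
    · exact Finset.le_sup (f := id) (by simp_all)
  · intro v hv
    by_cases hvb : v = b
    · exact hvb ▸ h₂
    · exact Finset.le_sup (f := id) (by simp_all)

lemma IsSumTwo.symm {L L₁ L₂ : Submodule ℤ (Fin N → ℤ)} (h : IsSumTwo L L₁ L₂) :
    IsSumTwo L L₂ L₁ := by
  obtain ⟨x, y, hx, hy, hxy⟩ := h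
  exact ⟨y, x, hy, hx, by rw [hxy, add_comm]⟩

lemma IsSumTwo.rotate {L L₁ L₂ : Submodule ℤ (Fin N → ℤ)} (h : IsSumTwo L L₁ L₂) :
    IsSumTwo L₁ L L₂ := by
  obtain ⟨x, y, hx, hy, hxy⟩ := h
  refine ⟨x + y, -y, hxy, ?_, by simpa using hx⟩
  rw [hy, ← Set.neg_singleton, Submodule.span_neg]

lemma IsSumThree.perm {L L₁ L₂ L₃ : Submodule ℤ (Fin N → ℤ)} (h : IsSumThree L L₁ L₂ L₃) :
    IsSumThree L L₂ L₃ L₁ := by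
  obtain ⟨x, y, z, hx, hy, hz, hs⟩ := h
  exact ⟨y, z, x, hy, hz, hx, by rw [hs]; congr 2; abel⟩

lemma IsSumThree.rotate {L L₁ L₂ L₃ : Submodule ℤ (Fin N → ℤ)} (h : IsSumThree L L₁ L₂ L₃) :
    IsSumThree L₁ L L₂ L₃ := by
  obtain ⟨x, y, z, hx, hy, hz, hs⟩ := h
  refine ⟨x + y + z, -y, -z, hs, ?_, ?_, ?_⟩
  · rw [hy, ← Set.neg_singleton, Submodule.span_neg]
  · rw [hz, ← Set.neg_singleton, Submodule.span_neg]
  · rw [hx]; congr 2; abel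

lemma IsSumTwo.le_sup {L L₁ L₂ : Submodule ℤ (Fin N → ℤ)} (h : IsSumTwo L L₁ L₂)
    {σ : Finset (Submodule ℤ (Fin N → ℤ))} (h₁ : L₁ ∈ σ) (h₂ : L₂ ∈ σ) : L ≤ σ.sup id := by
  obtain ⟨x, y, rfl, rfl, rfl⟩ := h
  have e₁ := Finset.le_sup (f := id) h₁
  have e₂ := Finset.le_sup (f := id) h₂
  simp only [id, Submodule.span_singleton_le_iff_mem] at e₁ e₂ ⊢
  exact add_mem e₁ e₂

lemma IsSumThree.le_sup {L L₁ L₂ L₃ : Submodule ℤ (Fin N → ℤ)} (h : IsSumThree L L₁ L₂ L₃)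
    {σ : Finset (Submodule ℤ (Fin N → ℤ))} (h₁ : L₁ ∈ σ) (h₂ : L₂ ∈ σ) (h₃ : L₃ ∈ σ) :
    L ≤ σ.sup id := by
  obtain ⟨x, y, z, rfl, rfl, rfl, rfl⟩ := h
  have e₁ := Finset.le_sup (f := id) h₁
  have e₂ := Finset.le_sup (f := id) h₂
  have e₃ := Finset.le_sup (f := id) h₃
  simp only [id, Submodule.span_singleton_le_iff_mem] at e₁ e₂ e₃ ⊢
  exact add_mem (add_mem e₁ e₂) e₃

lemma IsSumTwo.trans {L₀ L₁ L₂ L₃ L₄ : Submodule ℤ (Fin N → ℤ)} (h₀ : IsSumTwo L₀ L₂ L₃)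
    (h₁ : IsSumTwo L₁ L₂ L₄) : IsSumThree L₁ L₀ L₃ L₄ := by
  obtain ⟨x₂, x₃, hx₂, hx₃, hx⟩ := h₀
  obtain ⟨y₂, y₄, hy₂, hy₄, hy⟩ := h₁
  rw [hx₂, Submodule.span_singleton_eq_span_singleton] at hy₂
  obtain ⟨u, rfl⟩ := hy₂
  have h₃ : L₃ = Submodule.span ℤ {-x₃} := by rw [hx₃, ← Set.neg_singleton, Submodule.span_neg]
  rcases Int.units_eq_one_or u with rfl | rfl
  · exact ⟨x₂ + x₃, -x₃, y₄, hx, h₃, hy₄, by rw [hy]; congr 2; simp⟩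
  · refine ⟨x₂ + x₃, -x₃, -y₄, hx, h₃, ?_, ?_⟩
    · rw [hy₄, ← Set.neg_singleton, Submodule.span_neg]
    · rw [hy, ← Submodule.span_neg, Set.neg_singleton]; congr 2; simp [add_comm]

lemma isTwoAdditive_sdiff {σ : Finset (Submodule ℤ (Fin N → ℤ))}
    (hl : (σ : Set (Submodule ℤ (Fin N → ℤ))) ⊆ lines N)
    {a b c d e : Submodule ℤ (Fin N → ℤ)} (hd : [a, d, e].Nodup)
    (hm : {a, d, e} ⊆ σ \ {b}) (hade : IsSumTwo a d e)
    (hstd : IsStandard (σ \ {c, a})) (hcσ : c ∈ σ) (hb : b ∈ σ) (hca : c ≠ a) (hba : b ≠ a)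
    (h₁ : c ≤ (σ \ {c, a}).sup id) (h₂ : b ≤ (σ \ {b, a}).sup id) :
    IsTwoAdditive (σ \ {b}) := by
  refine ⟨fun y hy => hl (Finset.sdiff_subset hy), a, d, e, hd, hm, hade, ?_⟩
  have e₁ : ∀ x, (σ \ {a}) \ {x} = σ \ {x, a} := fun x => by ext; simp; tauto
  have e₂ : (σ \ {b}) \ {a} = (σ \ {a}) \ {b} := by ext; simp; tauto
  rw [e₂]
  refine IsStandard.swap (a := c) (by rwa [e₁]) (fun y hy => hl (Finset.sdiff_subset hy))
    (by simp_all) (by simp_all) (by rwa [e₁]) (by rwa [e₁])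

lemma IsTwoAdditive.sdiff {σ : Finset (Submodule ℤ (Fin N → ℤ))} (h : IsTwoAdditive σ)
    (a : Submodule ℤ (Fin N → ℤ)) : IsStandard (σ \ {a}) ∨ IsTwoAdditive (σ \ {a}) := by
  obtain ⟨hl, v₀, v₁, v₂, hd, hm, hs, hst⟩ := h
  simp only [Finset.insert_subset_iff, Finset.singleton_subset_iff] at hm
  simp only [List.nodup_cons, List.mem_cons, List.not_mem_nil, not_or] at hd
  have h₀ : v₀ ≤ (σ \ {v₀}).sup id := hs.le_sup (by grind) (by grind)
  by_cases e₀ : a = v₀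
  · subst e₀; exact Or.inl hst
  by_cases e₁ : a = v₁
  · subst e₁
    exact Or.inl (hst.swap hl hm.1 hm.2.1 h₀ (hs.rotate.le_sup (by grind) (by grind)))
  by_cases e₂ : a = v₂
  · subst e₂
    exact Or.inl (hst.swap hl hm.1 hm.2.2 h₀ (hs.symm.rotate.le_sup (by grind) (by grind)))
  exact Or.inr ⟨fun y hy => hl (Finset.sdiff_subset hy), v₀, v₁, v₂, by grind, by grind, hs,
    hst.mono (by grind)⟩

lemma IsThreeAdditive.sdiff {σ : Finset (Submodule ℤ (Fin N → ℤ))} (h : IsThreeAdditive σ)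
    (a : Submodule ℤ (Fin N → ℤ)) : IsStandard (σ \ {a}) ∨ IsThreeAdditive (σ \ {a}) := by
  obtain ⟨hl, v₀, v₁, v₂, v₃, hd, hm, hs, hst⟩ := h
  simp only [Finset.insert_subset_iff, Finset.singleton_subset_iff] at hm
  simp only [List.nodup_cons, List.mem_cons, List.not_mem_nil, not_or] at hd
  have h₀ : v₀ ≤ (σ \ {v₀}).sup id := hs.le_sup (by grind) (by grind) (by grind)
  by_cases e₀ : a = v₀
  · subst e₀; exact Or.inl hst
  by_cases e₁ : a = v₁
  · subst e₁
    exact Or.inl (hst.swap hl hm.1 hm.2.1 h₀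
      (hs.rotate.le_sup (by grind) (by grind) (by grind)))
  by_cases e₂ : a = v₂
  · subst e₂
    exact Or.inl (hst.swap hl hm.1 hm.2.2.1 h₀
      (hs.perm.rotate.le_sup (by grind) (by grind) (by grind)))
  by_cases e₃ : a = v₃
  · subst e₃
    exact Or.inl (hst.swap hl hm.1 hm.2.2.2 h₀
      (hs.perm.perm.rotate.le_sup (by grind) (by grind) (by grind)))
  exact Or.inr ⟨fun y hy => hl (Finset.sdiff_subset hy), v₀, v₁, v₂, v₃, by grind, by grind, hs,
    hst.mono (by grind)⟩

lemma IsDoubleTriple.sdiff {σ : Finset (Submodule ℤ (Fin N → ℤ))} (h : IsDoubleTriple σ)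
    (a : Submodule ℤ (Fin N → ℤ)) :
    IsTwoAdditive (σ \ {a}) ∨ IsThreeAdditive (σ \ {a}) ∨ IsDoubleTriple (σ \ {a}) := by
  obtain ⟨hl, v₀, v₁, v₂, v₃, v₄, hd, hm, hs, hs', hst⟩ := h
  simp only [Finset.insert_subset_iff, Finset.singleton_subset_iff] at hm
  simp only [List.nodup_cons, List.mem_cons, List.not_mem_nil, not_or] at hd
  have hl' : ((σ \ {a} : Finset _) : Set (Submodule ℤ (Fin N → ℤ))) ⊆ lines N :=
    fun y hy => hl (Finset.sdiff_subset hy)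
  have hst' : IsStandard (σ \ {v₁, v₀}) := by rwa [Finset.pair_comm]
  by_cases e₀ : a = v₀
  · subst e₀
    exact Or.inl ⟨hl', v₁, v₂, v₄, by grind, by grind, hs', hst.mono (by grind)⟩
  by_cases e₁ : a = v₁
  · subst e₁
    exact Or.inl ⟨hl', v₀, v₂, v₃, by grind, by grind, hs, hst.mono (by grind)⟩
  by_cases e₂ : a = v₂
  · subst e₂
    refine Or.inr (Or.inl ⟨hl', v₁, v₀, v₃, v₄, by grind, by grind, hs.trans hs', ?_⟩)
    have e₃ : ∀ x, (σ \ {v₁}) \ {x} = σ \ {x, v₁} := fun x => by ext; simp; tauto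
    have e₄ : (σ \ {a}) \ {v₁} = (σ \ {v₁}) \ {a} := by ext; simp; tauto
    rw [e₄]
    exact IsStandard.swap (a := v₀) (by rwa [e₃]) (fun y hy => hl (Finset.sdiff_subset hy))
      (by grind) (by grind) (hs.le_sup (by grind) (by grind))
      (hs.rotate.le_sup (by grind) (by grind))
  by_cases e₃ : a = v₃
  · subst e₃
    exact Or.inl (isTwoAdditive_sdiff (c := v₀) hl (by grind) (by grind) hs' hst hm.1 (by grind)
      (by grind) (by grind) (hs.le_sup (by grind) (by grind))
      (hs.symm.rotate.le_sup (by grind) (by grind)))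
  by_cases e₄ : a = v₄
  · subst e₄
    exact Or.inl (isTwoAdditive_sdiff (c := v₁) hl (by grind) (by grind) hs hst' hm.2.1 (by grind)
      (by grind) (by grind) (hs'.le_sup (by grind) (by grind))
      (hs'.symm.rotate.le_sup (by grind) (by grind)))
  exact Or.inr (Or.inr ⟨hl', v₀, v₁, v₂, v₃, v₄, by grind, by grind, hs, hs', hst.mono (by grind)⟩)

lemma IsDoubleDouble.sdiff {σ : Finset (Submodule ℤ (Fin N → ℤ))} (h : IsDoubleDouble σ)
    (a : Submodule ℤ (Fin N → ℤ)) : IsTwoAdditive (σ \ {a}) ∨ IsDoubleDouble (σ \ {a}) := by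
  obtain ⟨hl, v₀, v₁, v₂, v₃, v₄, v₅, hd, hm, hs, hs', hst⟩ := h
  simp only [Finset.insert_subset_iff, Finset.singleton_subset_iff] at hm
  simp only [List.nodup_cons, List.mem_cons, List.not_mem_nil, not_or] at hd
  have hl' : ((σ \ {a} : Finset _) : Set (Submodule ℤ (Fin N → ℤ))) ⊆ lines N :=
    fun y hy => hl (Finset.sdiff_subset hy)
  have hst' : IsStandard (σ \ {v₁, v₀}) := by rwa [Finset.pair_comm]
  by_cases e₀ : a = v₀
  · subst e₀
    exact Or.inl ⟨hl', v₁, v₄, v₅, by grind, by grind, hs', hst.mono (by grind)⟩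
  by_cases e₁ : a = v₁
  · subst e₁
    exact Or.inl ⟨hl', v₀, v₂, v₃, by grind, by grind, hs, hst.mono (by grind)⟩
  by_cases e₂ : a = v₂
  · subst e₂
    exact Or.inl (isTwoAdditive_sdiff (c := v₀) hl (by grind) (by grind) hs' hst hm.1 (by grind)
      (by grind) (by grind) (hs.le_sup (by grind) (by grind))
      (hs.rotate.le_sup (by grind) (by grind)))
  by_cases e₃ : a = v₃
  · subst e₃
    exact Or.inl (isTwoAdditive_sdiff (c := v₀) hl (by grind) (by grind) hs' hst hm.1 (by grind)
      (by grind) (by grind) (hs.le_sup (by grind) (by grind))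
      (hs.symm.rotate.le_sup (by grind) (by grind)))
  by_cases e₄ : a = v₄
  · subst e₄
    exact Or.inl (isTwoAdditive_sdiff (c := v₁) hl (by grind) (by grind) hs hst' hm.2.1 (by grind)
      (by grind) (by grind) (hs'.le_sup (by grind) (by grind))
      (hs'.rotate.le_sup (by grind) (by grind)))
  by_cases e₅ : a = v₅
  · subst e₅
    exact Or.inl (isTwoAdditive_sdiff (c := v₁) hl (by grind) (by grind) hs hst' hm.2.1 (by grind)
      (by grind) (by grind) (hs'.le_sup (by grind) (by grind))
      (hs'.symm.rotate.le_sup (by grind) (by grind)))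
  exact Or.inr ⟨hl', v₀, v₁, v₂, v₃, v₄, v₅, by grind, by grind, hs, hs', hst.mono (by grind)⟩

lemma IsBAASimplex.sdiff {σ : Finset (Submodule ℤ (Fin N → ℤ))} (h : IsBAASimplex σ)
    (a : Submodule ℤ (Fin N → ℤ)) : IsBAASimplex (σ \ {a}) := by
  unfold IsBAASimplex
  rcases h with h | h | h | h | h
  · exact Or.inl (h.mono Finset.sdiff_subset)
  · have := h.sdiff a; tauto
  · have := h.sdiff a; tauto
  · have := h.sdiff a; tauto
  · have := h.sdiff a; tauto

lemma IsBAASimplex.mono {σ τ : Finset (Submodule ℤ (Fin N → ℤ))} (h : IsBAASimplex σ)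
    (hτ : τ ⊆ σ) : IsBAASimplex τ := by
  have key : ∀ ρ : Finset (Submodule ℤ (Fin N → ℤ)), IsBAASimplex (σ \ ρ) := by
    intro ρ
    induction ρ using Finset.induction_on with
    | empty => simpa using h
    | insert a s _ ih =>
      have := ih.sdiff a
      rwa [sdiff_sdiff_left, Finset.sup_eq_union, Finset.union_comm, ← Finset.insert_eq] at this
  have := key (σ \ τ)
  rwa [sdiff_sdiff_eq_self hτ] at this

end Types

/-! ### The complexes -/

/-- The complex `B_N` of partial bases. -/
def B (N : ℕ) : PreAbstractSimplicialComplex (Submodule ℤ (Fin N → ℤ)) where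
  faces := {σ | σ.Nonempty ∧ IsStandard σ}
  isRelLowerSet_faces := fun {_} h => ⟨h.1, fun _ hts ht => ⟨ht, h.2.mono hts⟩⟩

/-- The complex `BAA_N`. -/
def BAA (N : ℕ) : PreAbstractSimplicialComplex (Submodule ℤ (Fin N → ℤ)) where
  faces := {σ | σ.Nonempty ∧ IsBAASimplex σ}
  isRelLowerSet_faces := fun {_} h => ⟨h.1, fun _ hts ht => ⟨ht, h.2.mono hts⟩⟩

/-- The simplex `{e_1, ..., e_m}` of lines in `ℤ^(m+n)`; empty for `m = 0`. -/
noncomputable def stdSimplexLines (m n : ℕ) : Finset (Submodule ℤ (Fin (m + n) → ℤ)) :=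
  Finset.univ.image fun i : Fin m => Submodule.span ℤ {Pi.single (Fin.castAdd n i) (1 : ℤ)}

/-- `Linkhat_X(σ)`, for a complex `X` of lines in `ℤ^N`: the full subcomplex of the link on the
lines that are not contained in the span of `σ`. -/
noncomputable def linkHat {N : ℕ} (X : PreAbstractSimplicialComplex (Submodule ℤ (Fin N → ℤ)))
    (σ : Finset (Submodule ℤ (Fin N → ℤ))) :
    PreAbstractSimplicialComplex (Submodule ℤ (Fin N → ℤ)) :=
  fullSubcomplex (link X σ) {L | ¬ L ≤ σ.sup id}

/-- `B_n^m`, the complex `Linkhat` of `{e_1, ..., e_m}` in `B_(m+n)`. -/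
noncomputable def Brel (m n : ℕ) : PreAbstractSimplicialComplex (Submodule ℤ (Fin (m + n) → ℤ)) :=
  linkHat (B (m + n)) (stdSimplexLines m n)

/-- `BAA_n^m`, the complex `Linkhat` of `{e_1, ..., e_m}` in `BAA_(m+n)`. -/
noncomputable def BAArel (m n : ℕ) :
    PreAbstractSimplicialComplex (Submodule ℤ (Fin (m + n) → ℤ)) :=
  linkHat (BAA (m + n)) (stdSimplexLines m n)

/-- `Linkhat` of `σ` in `BAA_n^m`: the full subcomplex of the link on the lines that are not
contained in the span of `e_1, ..., e_m` and `σ`. -/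
noncomputable def linkHatBAArel (m n : ℕ) (σ : Finset (Submodule ℤ (Fin (m + n) → ℤ))) :
    PreAbstractSimplicialComplex (Submodule ℤ (Fin (m + n) → ℤ)) :=
  fullSubcomplex (link (BAArel m n) σ) {L | ¬ L ≤ (stdSimplexLines m n ∪ σ).sup id}

/-- `Linkhat^{<R}` of `σ` in `BAA_n^m`: the full subcomplex of `Linkhat` on the lines spanned by
vectors whose last coordinate has absolute value less than `R`. -/
noncomputable def linkHatLT (m n : ℕ) (R : ℤ) (σ : Finset (Submodule ℤ (Fin (m + n) → ℤ))) :
    PreAbstractSimplicialComplex (Submodule ℤ (Fin (m + n) → ℤ)) :=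
  fullSubcomplex (linkHatBAArel m n σ)
    {L | ∃ x : Fin (m + n) → ℤ, L = Submodule.span ℤ {x} ∧ |lastCoord x| < R}

/-- `Q_n^m(v₁, v₂, v₃; w)`: the full subcomplex of `Linkhat^<` of the line of `w` in `BAA_n^m` on
six families of lines. The bound in `Linkhat^<` is the absolute value of the last coordinate
of `w`. -/
noncomputable def Q (m n : ℕ) (v₁ v₂ v₃ w : Fin (m + n) → ℤ) :
    PreAbstractSimplicialComplex (Submodule ℤ (Fin (m + n) → ℤ)) :=
  fullSubcomplex (linkHatLT m n |lastCoord w| {Submodule.span ℤ {w}})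
    {L | ∃ a : ℤ,
      L = Submodule.span ℤ {v₁ + a • w} ∨
      L = Submodule.span ℤ {v₂ + a • w} ∨
      L = Submodule.span ℤ {v₃ + a • w} ∨
      L = Submodule.span ℤ {v₁ + v₂ + a • w} ∨
      L = Submodule.span ℤ {v₁ + v₂ + v₃ + a • w} ∨
      L = Submodule.span ℤ {v₁ + v₃ + a • w}}

end BAAComplex

/-! Let `R` be the last coordinate of `w`. The six families consist of the lines spanned by `y i - y
j + a • w`, where the `y i` are the four points `v₁ + v₂ + v₃`, `v₁ + v₃`, `v₃` and `0`. Moving the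
points by multiples of `w` and reordering them does not change this set of lines, so their last
coordinates may be taken in `[0, R)` and weakly increasing. The points then cut a circle of length
`R` into four arcs: the three successive differences, and `w` minus their sum. The arcs are
independent, span a summand together with the `e_i`, add up to `w`, and have nonnegative last
coordinates, the last one positive. For each pair of points the bound `< R` leaves only the two
complementary intervals between them, so the vertices of `Q` are those of the twelve proper
intervals that are shorter than `R`. This set `S` is closed under subintervals and contains the
union of the first three arcs (`exists_frame`, `Frame.exists_line_iff`, `Frame.faces_Q`).

Which sets of intervals are simplices does not depend on the lengths. Modulo `w` an interval is an
edge between two of the four points, so a set `τ` of intervals spans, together with `w` and the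
`e_i`, a summand of rank `1 + m` plus the rank of a graph on four points. Thus `τ` is a simplex
exactly if its cardinality exceeds the graph rank by `0`, by `1` in the presence of an additive
relation, or by `2` in the presence of two different relations `a = b + c`
(`Frame.isBAASimplex_iff`).

The resulting finite complex has dimension at most `4`, and an explicit list of pairs `(τ, u)`
reduces it to a point: the open star of `τ` is pushed away from `u`, because the link of `τ` is a
cone with apex `u` up to some `4`-simplices. Those are discarded beforehand, since spheres of
dimension at most `3` can be pushed off an open `4`-simplex (`IsNConnected.of_deleteStar_maximal`,
`IsNConnected.of_deleteStar`, `IsNConnected.of_steps`). One list serves every `S`, because each apex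
`u` is a subinterval of a member of `τ` or of the union of the first three arcs (`collapses_spec`,
`isNConnected_of_isFaceMask`). -/

namespace BAAComplex

/-! ### Realizations of finite complexes, and connectivity via null-homotopies. -/

section Topology

open Topology

variable {V : Type*}

/-- With finitely many simplices the weak topology is the topology of coordinatewise convergence, so
continuity into and out of the realization can be checked on barycentric coordinates. -/
lemma Realization.isInducing {K : PreAbstractSimplicialComplex V} (hK : K.faces.Finite) :
    IsInducing (fun p : Realization K => p.1) := by
  constructor
  refine le_antisymm ?_ ?_
  · refine iSup_le fun σ => ?_
    rw [coinduced_le_iff_le_induced, induced_compose]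
    exact le_rfl
  · intro U hU
    have hU' := (isOpen_iSup_iff.1 hU)
    have h1 : ∀ σ : K.faces, ∃ O : Set (V → ℝ), IsOpen O ∧
        ∀ p : Realization K, (∀ v, v ∉ (σ : Finset V) → p.1 v = 0) → (p ∈ U ↔ p.1 ∈ O) := by
      intro σ
      have h2 := isOpen_coinduced.1 (hU' σ)
      obtain ⟨O, hO, hO'⟩ := isOpen_induced_iff.1 h2
      refine ⟨O, hO, fun p hp => ?_⟩
      have := Set.ext_iff.1 hO' ⟨p, hp⟩
      exact this.symm
    choose O hO hO' using h1
    -- The complement of `U` is glued from its traces on the closed simplices. Finiteness of the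
    -- complex is what makes this union closed.
    have hcl : IsClosed (⋃ σ : K.faces, {x : V → ℝ | ∀ v, v ∉ (σ : Finset V) → x v = 0} ∩ (O σ)ᶜ) := by
      have : Finite K.faces := hK
      refine isClosed_iUnion_of_finite fun σ => IsClosed.inter ?_ (hO σ).isClosed_compl
      simp only [Set.ofPred_forall]
      exact isClosed_iInter fun v => isClosed_iInter fun _ =>
        isClosed_eq (continuous_apply v) continuous_const
    refine isOpen_induced_iff.2 ⟨_, hcl.isOpen_compl, ?_⟩
    ext p
    simp only [Set.preimage_compl, Set.mem_compl_iff, Set.mem_preimage, Set.mem_iUnion,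
      Set.mem_inter_iff, Set.mem_ofPred_eq, not_exists, not_and, not_not]
    constructor
    · intro h
      obtain ⟨σ, hσ, hs, -⟩ := p.2.2
      have hz : ∀ v, v ∉ σ → p.1 v = 0 := fun v hv => by
        have := Set.ext_iff.1 hs v
        simp only [Function.mem_support, Finset.mem_coe] at this
        tauto
      exact (hO' ⟨σ, hσ⟩ p hz).2 (h ⟨σ, hσ⟩ hz)
    · intro h σ hz
      exact (hO' σ p hz).1 h

lemma Realization.continuous_coord {K : PreAbstractSimplicialComplex V} (hK : K.faces.Finite)
    (v : V) : Continuous fun p : Realization K => p.1 v :=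
  (continuous_apply v).comp (Realization.isInducing hK).continuous

lemma Realization.continuous_of_coord {K : PreAbstractSimplicialComplex V} (hK : K.faces.Finite)
    {X : Type*} [TopologicalSpace X] {f : X → Realization K}
    (hf : ∀ v, Continuous fun x => (f x).1 v) : Continuous f :=
  (Realization.isInducing hK).continuous_iff.2 (continuous_pi hf)

/-- The barycentric coordinates of a point of a simplex that is possibly in its boundary. -/
lemma isPoint_of_face {K : PreAbstractSimplicialComplex V} {f : V → ℝ} (h0 : ∀ v, 0 ≤ f v)
    {σ : Finset V} (hσ : σ ∈ K.faces) (hz : ∀ v, v ∉ σ → f v = 0) (hsum : ∑ v ∈ σ, f v = 1) :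
    (∀ v, 0 ≤ f v) ∧ ∃ σ ∈ K.faces, Function.support f = (σ : Set V) ∧ ∑ v ∈ σ, f v = 1 := by
  classical
  refine ⟨h0, σ.filter (fun v => f v ≠ 0), ?_, ?_, ?_⟩
  · refine (K.isRelLowerSet_faces hσ).2 (Finset.filter_subset _ _) ?_
    obtain ⟨v, hv, hv'⟩ := Finset.exists_ne_zero_of_sum_ne_zero (hsum.trans_ne one_ne_zero)
    exact ⟨v, Finset.mem_filter.2 ⟨hv, hv'⟩⟩
  · ext v
    simp only [Function.mem_support, Finset.coe_filter, Set.mem_ofPred_eq]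
    exact ⟨fun h => ⟨by_contra fun h' => h (hz v h'), h⟩, fun h => h.2⟩
  · rw [← hsum]
    exact Finset.sum_filter_ne_zero σ

lemma Realization.exists_face {K : PreAbstractSimplicialComplex V} (p : Realization K) :
    ∃ σ ∈ K.faces, (∀ v, v ∈ σ ↔ 0 < p.1 v) ∧ ∑ v ∈ σ, p.1 v = 1 := by
  obtain ⟨σ, hσ, hs, h1⟩ := p.2.2
  refine ⟨σ, hσ, fun v => ?_, h1⟩
  rw [← Finset.mem_coe, ← hs, Function.mem_support]
  exact ⟨fun h => lt_of_le_of_ne (p.2.1 v) (Ne.symm h), fun h => h.ne'⟩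

lemma Realization.sum_eq_one {K : PreAbstractSimplicialComplex V} (p : Realization K)
    {τ : Finset V} (hz : ∀ v, v ∉ τ → p.1 v = 0) : ∑ v ∈ τ, p.1 v = 1 := by
  obtain ⟨σ, -, hs, h1⟩ := p.exists_face
  refine (Finset.sum_subset (fun v hv => by_contra fun h => ?_) fun v _ hv => ?_).symm.trans h1
  · exact absurd (hz v h) ((hs v).1 hv).ne'
  · exact le_antisymm (not_lt.1 fun h => hv ((hs v).2 h)) (p.2.1 v)

/-- Maps that are pointwise contained in a common simplex are homotopic. -/
lemma homotopic_of_common_face {K : PreAbstractSimplicialComplex V} (hK : K.faces.Finite)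
    {X : Type*} [TopologicalSpace X] (f g : C(X, Realization K))
    (h : ∀ x, ∃ σ ∈ K.faces, ∀ v, v ∉ σ → (f x).1 v = 0 ∧ (g x).1 v = 0) : f.Homotopic g := by
  have hpt : ∀ (t : unitInterval) (x : X), _ := fun t x =>
    isPoint_of_face (K := K) (f := fun v => (1 - (t : ℝ)) * (f x).1 v + t * (g x).1 v)
      (fun v => add_nonneg (mul_nonneg (sub_nonneg.2 t.2.2) ((f x).2.1 v))
        (mul_nonneg t.2.1 ((g x).2.1 v)))
      (h x).choose_spec.1
      (fun v hv => by
        have := (h x).choose_spec.2 v hv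
        rw [this.1, this.2]; simp)
      (by
        rw [Finset.sum_add_distrib, ← Finset.mul_sum, ← Finset.mul_sum,
          (f x).sum_eq_one fun v hv => ((h x).choose_spec.2 v hv).1,
          (g x).sum_eq_one fun v hv => ((h x).choose_spec.2 v hv).2]
        ring)
  refine ⟨⟨⟨fun q => ⟨fun v => (1 - (q.1 : ℝ)) * (f q.2).1 v + q.1 * (g q.2).1 v, hpt q.1 q.2⟩, ?_⟩,
    fun x => ?_, fun x => ?_⟩⟩
  · refine Realization.continuous_of_coord hK fun v => ?_
    have h1 := (Realization.continuous_coord hK v).comp (f.continuous.comp continuous_snd)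
      (X := unitInterval × X)
    have h2 := (Realization.continuous_coord hK v).comp (g.continuous.comp continuous_snd)
      (X := unitInterval × X)
    have h3 : Continuous fun q : unitInterval × X => (q.1 : ℝ) :=
      continuous_subtype_val.comp continuous_fst
    exact ((continuous_const.sub h3).mul h1).add (h3.mul h2)
  · apply Subtype.ext
    funext v
    simp
  · apply Subtype.ext
    funext v
    simp

/-- The inclusion of a subcomplex of a finite complex. -/
def Realization.incl {K L : PreAbstractSimplicialComplex V} (hL : L.faces.Finite)
    (h : K.faces ⊆ L.faces) : C(Realization K, Realization L) where
  toFun p := ⟨p.1, p.2.1, p.2.2.imp fun _ hσ => ⟨h hσ.1, hσ.2⟩⟩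
  continuous_toFun := Realization.continuous_of_coord hL fun v =>
    Realization.continuous_coord (hL.subset h) v

lemma norm_one_sub_smul_sphere {E : Type*} [NormedAddCommGroup E] [NormedSpace ℝ E]
    (q : unitInterval × Metric.sphere (0 : E) 1) :
    ‖(1 - (q.1 : ℝ)) • (q.2 : E)‖ = 1 - (q.1 : ℝ) := by
  have h0 : 0 ≤ 1 - (q.1 : ℝ) := sub_nonneg.2 q.1.2.2
  rw [norm_smul, norm_eq_of_mem_sphere, mul_one, Real.norm_eq_abs, abs_of_nonneg h0]

/-- The map from the cylinder on the unit sphere to the unit ball that contracts the end. -/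
def cylinderToBall (E : Type*) [NormedAddCommGroup E] [NormedSpace ℝ E] :
    C(unitInterval × Metric.sphere (0 : E) 1, Metric.closedBall (0 : E) 1) where
  toFun q := ⟨(1 - (q.1 : ℝ)) • (q.2 : E), by
    rw [mem_closedBall_zero_iff, norm_one_sub_smul_sphere]
    linarith [q.1.2.1]⟩
  continuous_toFun := Continuous.subtype_mk (by fun_prop) _

lemma cylinderToBall_surjective (E : Type*) [NormedAddCommGroup E] [NormedSpace ℝ E]
    [Nontrivial E] : Function.Surjective (cylinderToBall E) := by
  rintro ⟨z, hz⟩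
  rw [mem_closedBall_zero_iff] at hz
  by_cases hz0 : z = 0
  · obtain ⟨x, hx⟩ := exists_norm_eq E zero_le_one
    refine ⟨(1, ⟨x, by simpa using hx⟩), Subtype.ext ?_⟩
    change (1 - ((1 : unitInterval) : ℝ)) • x = z
    simp [hz0]
  · have hn : ‖z‖ ≠ 0 := norm_ne_zero_iff.2 hz0
    refine ⟨(⟨1 - ‖z‖, by linarith, by linarith [norm_nonneg z]⟩,
      ⟨‖z‖⁻¹ • z, by simp [norm_smul, hn]⟩), Subtype.ext ?_⟩
    change (1 - (1 - ‖z‖)) • ‖z‖⁻¹ • z = z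
    rw [smul_smul]
    simp [hn]

/-- Only the end at time `1` is identified to a point. A null-homotopy is constant there, so it
descends to the ball. -/
lemma cylinderToBall_eq {E : Type*} [NormedAddCommGroup E] [NormedSpace ℝ E]
    {q r : unitInterval × Metric.sphere (0 : E) 1} (h : cylinderToBall E q = cylinderToBall E r) :
    q.1 = r.1 ∧ (q.1 = 1 ∨ q = r) := by
  have h0 : (1 - (q.1 : ℝ)) • (q.2 : E) = (1 - (r.1 : ℝ)) • (r.2 : E) := congrArg Subtype.val h
  have h1 : q.1 = r.1 := by
    have := congrArg norm h0
    rw [norm_one_sub_smul_sphere, norm_one_sub_smul_sphere] at this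
    exact Subtype.ext (by linarith)
  refine ⟨h1, or_iff_not_imp_left.2 fun h2 => Prod.ext h1 (Subtype.ext ?_)⟩
  rw [h1] at h0 h2
  have h3 : 1 - (r.1 : ℝ) ≠ 0 := fun h4 => h2 (Subtype.ext (by simpa using (sub_eq_zero.1 h4).symm))
  exact smul_right_injective E h3 h0

/-- A sphere is the boundary of a null-homotopy if and only if it bounds a ball. -/
lemma isNConnected_iff (k : ℕ) (X : Type*) [TopologicalSpace X] :
    IsNConnected k X ↔ Nonempty X ∧ ∀ d : ℕ, 1 ≤ d → d ≤ k + 1 →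
      ∀ f : C(Metric.sphere (0 : EuclideanSpace ℝ (Fin d)) 1, X), f.Nullhomotopic := by
  constructor
  · intro h
    have hne : Nonempty X := by
      have : IsEmpty (Metric.sphere (0 : EuclideanSpace ℝ (Fin 0)) 1) := by
        constructor
        rintro ⟨x, hx⟩
        rw [Subsingleton.elim x 0] at hx
        simp at hx
      obtain ⟨g, -⟩ := h 0 (Nat.zero_le _) ⟨fun x => isEmptyElim x, continuous_of_const fun x => isEmptyElim x⟩
      exact ⟨g ⟨0, by simp⟩⟩
    refine ⟨hne, fun d _ hd f => ?_⟩
    obtain ⟨g, hg⟩ := h d hd f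
    refine ⟨g ⟨0, by simp⟩, ⟨⟨g.comp (cylinderToBall _), fun x => ?_, fun x => ?_⟩⟩⟩
    · refine (congrArg g (Subtype.ext ?_)).trans (hg x.1 x.2)
      change (1 - ((0 : unitInterval) : ℝ)) • (x : EuclideanSpace ℝ (Fin d)) = x
      simp
    · refine congrArg g (Subtype.ext ?_)
      change (1 - ((1 : unitInterval) : ℝ)) • (x : EuclideanSpace ℝ (Fin d)) = 0
      simp
  · rintro ⟨⟨x0⟩, h⟩ d hd f
    rcases Nat.eq_zero_or_pos d with rfl | hpos
    · refine ⟨ContinuousMap.const _ x0, fun x hx => ?_⟩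
      rw [Subsingleton.elim x 0] at hx
      simp at hx
    obtain ⟨y, ⟨H⟩⟩ := h d hpos hd f
    have : Nonempty (Fin d) := ⟨⟨0, hpos⟩⟩
    -- The cylinder is compact and the ball is Hausdorff, so the map is closed.
    have hq : IsQuotientMap (cylinderToBall (EuclideanSpace ℝ (Fin d))) :=
      (cylinderToBall _).continuous.isClosedMap.isQuotientMap (cylinderToBall _).continuous
        (cylinderToBall_surjective _)
    have hfac : Function.FactorsThrough H.toContinuousMap
        (cylinderToBall (EuclideanSpace ℝ (Fin d))) := by
      intro q r hqr
      obtain ⟨h1, h2 | h2⟩ := cylinderToBall_eq hqr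
      · have e1 : q = (1, q.2) := Prod.ext h2 rfl
        have e2 : r = (1, r.2) := Prod.ext (h1 ▸ h2) rfl
        rw [e1, e2]
        exact (H.apply_one q.2).trans (H.apply_one r.2).symm
      · rw [h2]
    refine ⟨hq.lift H.toContinuousMap hfac, fun x hx => ?_⟩
    have h1 := DFunLike.congr_fun (hq.lift_comp H.toContinuousMap hfac) (0, ⟨x, hx⟩)
    refine Eq.trans (congrArg _ (Subtype.ext ?_)) (h1.trans (H.apply_zero _))
    change x = (1 - ((0 : unitInterval) : ℝ)) • x
    simp

/-- If all spheres in `X` can be deformed into the image of `Y`, then connectivity of `Y` passes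
to `X`. -/
lemma IsNConnected.of_homotopic_comp {k : ℕ} {X Y : Type*} [TopologicalSpace X]
    [TopologicalSpace Y] (hY : IsNConnected k Y) (ι : C(Y, X))
    (h : ∀ d : ℕ, d ≤ k + 1 → ∀ f : C(Metric.sphere (0 : EuclideanSpace ℝ (Fin d)) 1, X),
      ∃ f' : C(Metric.sphere (0 : EuclideanSpace ℝ (Fin d)) 1, Y), f.Homotopic (ι.comp f')) :
    IsNConnected k X := by
  rw [isNConnected_iff] at hY ⊢
  refine ⟨hY.1.map ι, fun d hd hdk f => ?_⟩
  obtain ⟨f', hf'⟩ := h d hdk f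
  obtain ⟨y, hy⟩ := (hY.2 d hd hdk f').comp_right ι
  exact ⟨y, hf'.trans hy⟩

end Topology

end BAAComplex

/-! ### Removing open stars and facets without losing connectivity. -/

namespace BAAComplex

section Moves

open Topology

variable {V : Type*}

/-- The subcomplex of the faces that do not contain `τ`. -/
def deleteStar (K : PreAbstractSimplicialComplex V) (τ : Finset V) :
    PreAbstractSimplicialComplex V where
  faces := {f | f ∈ K.faces ∧ ¬ τ ⊆ f}
  isRelLowerSet_faces := fun {_} h =>
    ⟨(K.isRelLowerSet_faces h.1).1, fun _ hts ht =>
      ⟨(K.isRelLowerSet_faces h.1).2 hts ht, fun h' => h.2 (h'.trans hts)⟩⟩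

lemma deleteStar_subset (K : PreAbstractSimplicialComplex V) (τ : Finset V) :
    (deleteStar K τ).faces ⊆ K.faces := fun _ h => h.1

/-- If the link of `τ` is a cone with apex `u`, then the open star of `τ` can be collapsed. -/
lemma IsNConnected.of_deleteStar_cone [DecidableEq V] {k : ℕ} {K : PreAbstractSimplicialComplex V}
    (hK : K.faces.Finite) {τ : Finset V} {u : V} (hτ : τ.Nonempty) (hu : u ∉ τ)
    (h : ∀ f ∈ K.faces, τ ⊆ f → insert u f ∈ K.faces)
    (hc : IsNConnected k (Realization (deleteStar K τ))) : IsNConnected k (Realization K) := by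
  have hK' := hK.subset (deleteStar_subset K τ)
  -- The retraction takes the smallest coordinate on `τ` away from every vertex of `τ` and hands the
  -- total to `u`. A vertex attaining the minimum gets weight `0`, so the image misses the open star
  -- of `τ`. Outside that star `t` vanishes and nothing moves.
  let t : Realization K → ℝ := fun p => τ.inf' hτ p.1
  have ht : Continuous t := by
    refine Continuous.finset_inf'_apply hτ fun v _ => Realization.continuous_coord hK v
  let r : Realization K → V → ℝ := fun p v =>
    p.1 v - (if v ∈ τ then t p else 0) + (if v = u then (τ.card : ℝ) * t p else 0)
  have htle : ∀ p, ∀ v ∈ τ, t p ≤ p.1 v := fun p v hv => Finset.inf'_le _ hv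
  have ht0 : ∀ p, 0 ≤ t p := fun p => Finset.le_inf' _ _ fun v _ => p.2.1 v
  have hr0 : ∀ p v, 0 ≤ r p v := by
    intro p v
    have h1 : 0 ≤ (if v = u then (τ.card : ℝ) * t p else 0) := by
      split_ifs
      · exact mul_nonneg (Nat.cast_nonneg _) (ht0 p)
      · exact le_rfl
    have h2 : (if v ∈ τ then t p else 0) ≤ p.1 v := by
      split_ifs with hv
      · exact htle p v hv
      · exact p.2.1 v
    exact add_nonneg (sub_nonneg.2 h2) h1
  have hface : ∀ p, ∃ σ ∈ (deleteStar K τ).faces, ∃ ρ ∈ K.faces, (∀ v, v ∉ σ → r p v = 0) ∧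
      ∑ v ∈ σ, r p v = 1 ∧ ∀ v, v ∉ ρ → p.1 v = 0 ∧ r p v = 0 := by
    intro p
    obtain ⟨σ, hσ, hs, hsum⟩ := p.exists_face
    have hz : ∀ v, v ∉ σ → p.1 v = 0 := fun v hv =>
      le_antisymm (not_lt.1 fun h => hv ((hs v).2 h)) (p.2.1 v)
    by_cases hτσ : τ ⊆ σ
    · obtain ⟨v₀, hv₀, hv₀'⟩ := Finset.exists_mem_eq_inf' hτ p.1
      have hins := h σ hσ hτσ
      have hne : u ≠ v₀ := fun h => hu (h ▸ hv₀)
      have hr1 : ∀ v, v ∉ insert u σ → r p v = 0 := by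
        intro v hv
        rw [Finset.mem_insert, not_or] at hv
        have : v ∉ τ := fun h => hv.2 (hτσ h)
        simp [r, this, hv.1, hz v hv.2]
      have hr2 : r p v₀ = 0 := by
        simp [r, hv₀, hne.symm, t, hv₀']
      have hr3 : ∑ v ∈ insert u σ, r p v = 1 := by
        simp only [r]
        rw [Finset.sum_add_distrib, Finset.sum_sub_distrib,
          p.sum_eq_one fun v hv => hz v fun h => hv (Finset.mem_insert_of_mem h),
          Finset.sum_ite_eq' (insert u σ) u, if_pos (Finset.mem_insert_self u σ),
          Finset.sum_ite_mem, Finset.inter_eq_right.2 (hτσ.trans (Finset.subset_insert u σ)),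
          Finset.sum_const, nsmul_eq_mul]
        ring
      refine ⟨(insert u σ).erase v₀, ⟨(K.isRelLowerSet_faces hins).2 (Finset.erase_subset _ _)
        ⟨u, Finset.mem_erase.2 ⟨hne, Finset.mem_insert_self _ _⟩⟩,
        fun h => Finset.notMem_erase v₀ _ (h hv₀)⟩, insert u σ, hins, ?_, ?_, ?_⟩
      · intro v hv
        by_cases hvv : v = v₀
        · rw [hvv, hr2]
        · exact hr1 v fun h => hv (Finset.mem_erase.2 ⟨hvv, h⟩)
      · rw [← hr3]
        exact Finset.sum_erase _ hr2
      · exact fun v hv => ⟨hz v fun h => hv (Finset.mem_insert_of_mem h), hr1 v hv⟩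
    · have ht1 : t p = 0 := by
        obtain ⟨v, hv, hv'⟩ := Finset.not_subset.1 hτσ
        exact le_antisymm ((htle p v hv).trans (hz v hv').le) (ht0 p)
      have hrp : ∀ v, r p v = p.1 v := fun v => by simp [r, ht1]
      refine ⟨σ, ⟨hσ, hτσ⟩, σ, hσ, fun v hv => (hrp v).trans (hz v hv), ?_, fun v hv =>
        ⟨hz v hv, (hrp v).trans (hz v hv)⟩⟩
      exact (Finset.sum_congr rfl fun v _ => hrp v).trans hsum
  let ret : C(Realization K, Realization (deleteStar K τ)) :=
    ⟨fun p => ⟨r p, isPoint_of_face (hr0 p) (hface p).choose_spec.1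
      (hface p).choose_spec.2.choose_spec.2.1 (hface p).choose_spec.2.choose_spec.2.2.1⟩, by
      refine Realization.continuous_of_coord hK' fun v => ?_
      change Continuous fun p => r p v
      refine Continuous.add (Continuous.sub (Realization.continuous_coord hK v) ?_) ?_
      · split_ifs
        exacts [ht, continuous_const]
      · split_ifs
        exacts [continuous_const.mul ht, continuous_const]⟩
  refine hc.of_homotopic_comp (Realization.incl hK (deleteStar_subset K τ)) fun d _ f =>
    ⟨ret.comp f, homotopic_of_common_face hK _ _ fun x => ?_⟩
  obtain ⟨σ, -, ρ, hρ, -, -, h3⟩ := hface (f x)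
  exact ⟨ρ, hρ, h3⟩

/-- The image of the unit sphere under a smooth map to a space whose dimension is at least that of
the ambient space has dense complement. -/
lemma dense_compl_image_sphere {d : ℕ} {F : Type*} [NormedAddCommGroup F] [NormedSpace ℝ F]
    [FiniteDimensional ℝ F] (hd : d ≤ Module.finrank ℝ F) {g : EuclideanSpace ℝ (Fin d) → F}
    (hg : ContDiff ℝ 1 g) : Dense (g '' Metric.sphere 0 1)ᶜ := by
  -- Below the dimension of `F` already the whole range has dense complement. In equal dimension the
  -- sphere is a null set, and a differentiable map preserves null sets.
  rcases hd.lt_or_eq with hd | hd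
  · refine (hg.dense_compl_range_of_finrank_lt_finrank (by simpa using hd)).mono ?_
    exact Set.compl_subset_compl.2 (Set.image_subset_range _ _)
  · let e : F ≃L[ℝ] EuclideanSpace ℝ (Fin d) := ContinuousLinearEquiv.ofFinrankEq (by simp [hd])
    have h1 : MeasureTheory.volume ((fun x => e (g x)) '' Metric.sphere 0 1) = 0 := by
      refine MeasureTheory.addHaar_image_eq_zero_of_differentiableOn_of_addHaar_eq_zero _ ?_
        (MeasureTheory.Measure.addHaar_sphere_of_ne_zero _ 0 one_ne_zero)
      exact (e.contDiff.comp hg).differentiable one_ne_zero |>.differentiableOn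
    have h2 : Dense ((fun x => e (g x)) '' Metric.sphere 0 1)ᶜ := by
      rw [← interior_eq_empty_iff_dense_compl]
      exact MeasureTheory.Measure.interior_eq_empty_of_null h1
    have h3 : (g '' Metric.sphere 0 1)ᶜ = e ⁻¹' ((fun x => e (g x)) '' Metric.sphere 0 1)ᶜ := by
      ext y
      simp
    rw [h3]
    exact h2.preimage e.toHomeomorph.isOpenMap

end Moves

end BAAComplex

namespace BAAComplex

section Moves

open Topology

variable {V : Type*}

/-- A map from a sphere to a finite complex can be deformed such that it misses an interior point
of a given maximal simplex of larger dimension. -/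
lemma exists_homotopic_avoiding [DecidableEq V] {d : ℕ} {K : PreAbstractSimplicialComplex V}
    (hK : K.faces.Finite) {σ : Finset V} (hσ : σ ∈ K.faces)
    (hmax : ∀ f ∈ K.faces, σ ⊆ f → f = σ) (hd : d < σ.card)
    (f : C(Metric.sphere (0 : EuclideanSpace ℝ (Fin d)) 1, Realization K)) :
    ∃ (c : V → ℝ) (f' : C(Metric.sphere (0 : EuclideanSpace ℝ (Fin d)) 1, Realization K)),
      (∀ v ∈ σ, 0 < c v) ∧ (∀ v, v ∉ σ → c v = 0) ∧ ∑ v ∈ σ, c v = 1 ∧ f.Homotopic f' ∧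
      ∀ x, (f' x).1 ≠ c := by
  obtain ⟨v₀, hv₀⟩ := (K.isRelLowerSet_faces hσ).1
  obtain ⟨N, hN⟩ : ∃ N : ℝ, N = (σ.card : ℝ) := ⟨_, rfl⟩
  have hNpos : 0 < N := hN ▸ Nat.cast_pos.2 (Finset.card_pos.2 ⟨v₀, hv₀⟩)
  have hN1 : 1 ≤ N := by rw [hN]; exact_mod_cast Finset.card_pos.2 ⟨v₀, hv₀⟩
  obtain ⟨b, hb⟩ : ∃ b : ℝ, b = 1 / N := ⟨_, rfl⟩
  have hbpos : 0 < b := by rw [hb]; positivity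
  -- Here `b` is the barycentric weight `1 / N`. An error `ε` in each of the fewer than `N` free
  -- coordinates adds up to at most `N * ε = b / 8` in the remaining one.
  obtain ⟨ε, hε⟩ : ∃ ε : ℝ, ε = b / (8 * N) := ⟨_, rfl⟩
  have hεpos : 0 < ε := by rw [hε]; positivity
  have hNε : N * ε = b / 8 := by rw [hε]; field_simp
  have hεN : ε ≤ N * ε := le_mul_of_one_le_left hεpos.le hN1
  -- The coordinates other than `v₀` parametrize the simplex. There are `σ.card - 1 ≥ d` of them, as
  -- `dense_compl_image_sphere` requires.
  set σ' := σ.erase v₀ with hσ'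
  have hcard' : (σ'.card : ℝ) ≤ N := by
    rw [hN]; exact_mod_cast Finset.card_le_card (Finset.erase_subset _ _)
  have hcont : ∀ v, Continuous fun x => (f x).1 v := fun v =>
    (Realization.continuous_coord hK v).comp f.continuous
  -- The coordinate map is extended from the sphere to the Euclidean space by Tietze and then
  -- approximated by a smooth map `g`. The image of the sphere under `g` misses some `c'` close to
  -- the barycentre.
  obtain ⟨F, hF⟩ := ContinuousMap.exists_restrict_eq (Y := σ' → ℝ) Metric.isClosed_sphere
    (⟨fun x v => (f x).1 v, continuous_pi fun v => hcont v⟩ :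
      C(Metric.sphere (0 : EuclideanSpace ℝ (Fin d)) 1, σ' → ℝ))
  obtain ⟨g, hg, hgF, -⟩ := F.continuous.exists_contDiff_approx 1 (ε := fun _ => ε)
    continuous_const fun _ => hεpos
  have hgf : ∀ (x : Metric.sphere (0 : EuclideanSpace ℝ (Fin d)) 1) (v : σ'),
      |g x v - (f x).1 v| < ε := by
    intro x v
    have h1 := DFunLike.congr_fun hF x
    have h2 : F x v = (f x).1 v := congrFun h1 v
    have h3 := (dist_pi_lt_iff hεpos).1 (hgF x) v
    rwa [Real.dist_eq, h2] at h3
  have hdim : d ≤ Module.finrank ℝ (σ' → ℝ) := by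
    simp only [Module.finrank_fintype_fun_eq_card, Fintype.card_coe, hσ',
      Finset.card_erase_of_mem hv₀]
    omega
  obtain ⟨c', hc', hcb⟩ := (dense_compl_image_sphere hdim hg).exists_dist_lt
    (fun _ : σ' => b) hεpos
  have hcb' : ∀ v : σ', |c' v - b| < ε := fun v => by
    have := (dist_pi_lt_iff hεpos).1 hcb v
    rwa [dist_comm, Real.dist_eq] at this
  -- extend a vector by one coordinate so that it has a prescribed total sum
  let ext : ℝ → (σ' → ℝ) → V → ℝ := fun s y v =>
    if h : v ∈ σ' then y ⟨v, h⟩ else if v = v₀ then s - ∑ w, y w else 0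
  have hext0 : ∀ s y v, v ∉ σ → ext s y v = 0 := by
    intro s y v hv
    have h1 : v ∉ σ' := fun h => hv (Finset.mem_of_mem_erase h)
    have h2 : v ≠ v₀ := fun h => hv (h ▸ hv₀)
    simp [ext, h1, h2]
  have hextv₀ : ∀ s y, ext s y v₀ = s - ∑ w, y w := by
    intro s y
    simp [ext, hσ']
  have hext' : ∀ s y (v : σ'), ext s y v = y v := by
    intro s y v
    simp [ext]
  have hextsum : ∀ s y, ∑ v ∈ σ, ext s y v = s := by
    intro s y
    have h1 : ∑ v ∈ σ', ext s y v = ∑ v, y v := by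
      rw [← Finset.sum_coe_sort]
      exact Finset.sum_congr rfl fun v _ => hext' s y v
    rw [← Finset.add_sum_erase _ _ hv₀, hextv₀, ← hσ', h1]
    ring
  let D : Metric.sphere (0 : EuclideanSpace ℝ (Fin d)) 1 → V → ℝ := fun x =>
    ext 0 fun v => g x v - (f x).1 v
  have hDle : ∀ x v, |D x v| ≤ N * ε := by
    intro x v
    by_cases h1 : v ∈ σ'
    · have := hext' 0 (fun v => g x v - (f x).1 v) ⟨v, h1⟩
      simp only [D, this]
      exact (hgf x ⟨v, h1⟩).le.trans hεN
    by_cases h2 : v = v₀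
    · simp only [D, h2, hextv₀, zero_sub, abs_neg]
      refine (Finset.abs_sum_le_sum_abs _ _).trans
        ((Finset.sum_le_sum fun w _ => (hgf x w).le).trans ?_)
      rw [Finset.sum_const, nsmul_eq_mul, Finset.card_univ, Fintype.card_coe]
      exact mul_le_mul_of_nonneg_right hcard' hεpos.le
    · have : v ∉ σ := fun h => h1 (Finset.mem_erase.2 ⟨h2, h⟩)
      simp only [D, hext0 _ _ v this, abs_zero]
      positivity
  have hDcont : ∀ v, Continuous fun x => D x v := by
    intro v
    have hgc : ∀ w : σ', Continuous fun x : Metric.sphere (0 : EuclideanSpace ℝ (Fin d)) 1 =>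
        g x w - (f x).1 w := fun w =>
      (((continuous_apply w).comp hg.continuous).comp continuous_subtype_val).sub (hcont w)
    simp only [D, ext]
    split_ifs
    · exact hgc _
    · exact continuous_const.sub (continuous_finsetSum _ fun w _ => hgc w)
    · exact continuous_const
  let μ : Metric.sphere (0 : EuclideanSpace ℝ (Fin d)) 1 → ℝ := fun x => σ.inf' ⟨v₀, hv₀⟩ (f x).1
  have hμ : Continuous μ := Continuous.finset_inf'_apply _ fun v _ => hcont v
  -- A cutoff that is `0` where the smallest coordinate on `σ` is at most `b / 4` and `1` where it
  -- is at least `b / 2`. The perturbation `D` thus acts only inside the open simplex `σ`; there it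
  -- moves coordinates by at most `b / 8`, so they stay positive.
  let lam : Metric.sphere (0 : EuclideanSpace ℝ (Fin d)) 1 → ℝ := fun x =>
    max 0 (min 1 (4 * N * μ x - 1))
  have hlam0 : ∀ x, 0 ≤ lam x := fun x => le_max_left _ _
  have hlam1 : ∀ x, lam x ≤ 1 := fun x => max_le zero_le_one (min_le_left _ _)
  have hNb : N * b = 1 := by rw [hb]; field_simp
  have hpos : ∀ x, lam x ≠ 0 → ∀ v ∈ σ, b / 4 ≤ (f x).1 v := by
    intro x hx v hv
    have h1 : μ x ≤ (f x).1 v := Finset.inf'_le _ hv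
    by_contra! h2
    apply hx
    refine max_eq_left ((min_le_right _ _).trans ?_)
    nlinarith
  have hsupp : ∀ x, lam x ≠ 0 → ∀ v, v ∉ σ → (f x).1 v = 0 := by
    intro x hx v hv
    obtain ⟨ρ, hρ, hs, -⟩ := (f x).exists_face
    have : ρ = σ := hmax ρ hρ fun w hw => (hs w).2 (lt_of_lt_of_le (by positivity) (hpos x hx w hw))
    rw [← this] at hv
    exact le_antisymm (not_lt.1 fun h => hv ((hs v).2 h)) ((f x).2.1 v)
  have hlamD : ∀ x v, |lam x * D x v| ≤ b / 8 := by
    intro x v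
    rw [abs_mul, abs_of_nonneg (hlam0 x), ← hNε]
    exact (mul_le_of_le_one_left (abs_nonneg _) (hlam1 x)).trans (hDle x v)
  have hface : ∀ x, ∃ ρ ∈ K.faces, (∀ v, 0 ≤ (f x).1 v + lam x * D x v) ∧
      (∀ v, v ∉ ρ → (f x).1 v = 0 ∧ (f x).1 v + lam x * D x v = 0) ∧
      ∑ v ∈ ρ, ((f x).1 v + lam x * D x v) = 1 := by
    intro x
    by_cases hx : lam x = 0
    · obtain ⟨ρ, hρ, hs, hsum⟩ := (f x).exists_face
      have hz : ∀ v, v ∉ ρ → (f x).1 v = 0 := fun v hv =>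
        le_antisymm (not_lt.1 fun h => hv ((hs v).2 h)) ((f x).2.1 v)
      refine ⟨ρ, hρ, fun v => ?_, fun v hv => ?_, ?_⟩
      · simpa [hx] using (f x).2.1 v
      · simpa [hx] using hz v hv
      · simpa [hx] using hsum
    · have hD0 : ∀ v, v ∉ σ → D x v = 0 := fun v hv => hext0 _ _ v hv
      refine ⟨σ, hσ, fun v => ?_, fun v hv => ?_, ?_⟩
      · by_cases hv : v ∈ σ
        · have h1 := hpos x hx v hv
          have h2 := (abs_le.1 (hlamD x v)).1
          linarith
        · simp [hsupp x hx v hv, hD0 v hv]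
      · simp [hsupp x hx v hv, hD0 v hv]
      · rw [Finset.sum_add_distrib, ← Finset.mul_sum, (f x).sum_eq_one (hsupp x hx)]
        simp only [D, hextsum]
        ring
  let f' : C(Metric.sphere (0 : EuclideanSpace ℝ (Fin d)) 1, Realization K) :=
    ⟨fun x => ⟨fun v => (f x).1 v + lam x * D x v, isPoint_of_face (hface x).choose_spec.2.1
      (hface x).choose_spec.1 (fun v hv => ((hface x).choose_spec.2.2.1 v hv).2)
      (hface x).choose_spec.2.2.2⟩, by
      refine Realization.continuous_of_coord hK fun v => ?_
      have hl : Continuous lam := continuous_const.max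
        (continuous_const.min ((continuous_const.mul hμ).sub continuous_const))
      exact (hcont v).add (hl.mul (hDcont v))⟩
  have hcσ : ∀ v ∈ σ, b - b / 8 ≤ ext 1 c' v := by
    intro v hv
    by_cases h2 : v = v₀
    · rw [h2, hextv₀]
      have h3 : ∑ w, c' w ≤ σ'.card * (b + ε) := by
        calc ∑ w, c' w ≤ ∑ _w : σ', (b + ε) :=
              Finset.sum_le_sum fun w _ => by linarith [(abs_lt.1 (hcb' w)).2]
          _ = σ'.card * (b + ε) := by
              rw [Finset.sum_const, nsmul_eq_mul, Finset.card_univ, Fintype.card_coe]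
      have h4 : (σ'.card : ℝ) = N - 1 := by
        rw [hN, hσ', Finset.card_erase_of_mem hv₀, Nat.cast_sub (Finset.card_pos.2 ⟨v₀, hv₀⟩)]
        simp
      rw [h4] at h3
      nlinarith
    · have h1 : v ∈ σ' := Finset.mem_erase.2 ⟨h2, hv⟩
      have := hext' 1 c' ⟨v, h1⟩
      simp only at this
      rw [this]
      linarith [(abs_lt.1 (hcb' ⟨v, h1⟩)).1]
  refine ⟨ext 1 c', f', fun v hv => ?_, hext0 1 c', hextsum 1 c', ?_, fun x hx => ?_⟩
  · linarith [hcσ v hv]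
  · refine homotopic_of_common_face hK _ _ fun x => ?_
    obtain ⟨ρ, hρ, -, h2, -⟩ := hface x
    exact ⟨ρ, hρ, h2⟩
  -- If `f'` hits the point, all coordinates of `f x` on `σ` are at least `7b/8 - b/8`, so the
  -- cutoff is `1` and `f' x` agrees with `g x` on `σ'`. Hence `g x = c'`, which was excluded.
  · have hx' : ∀ v, (f x).1 v + lam x * D x v = ext 1 c' v := fun v => congrFun hx v
    have h1 : ∀ v ∈ σ, b / 2 ≤ (f x).1 v := by
      intro v hv
      have h2 := hcσ v hv
      have h3 := (abs_le.1 (hlamD x v)).2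
      linarith [hx' v]
    have h2 : b / 2 ≤ μ x := Finset.le_inf' _ _ h1
    have h3 : lam x = 1 := by
      have : 1 ≤ 4 * N * μ x - 1 := by nlinarith
      simp only [lam, min_eq_left this]
      exact max_eq_right zero_le_one
    refine hc' ⟨x, x.2, funext fun v => ?_⟩
    have h4 := hx' v
    have h5 := hext' 0 (fun v => g x v - (f x).1 v) v
    simp only [D] at h4
    rw [h3, h5, hext'] at h4
    linarith

end Moves

end BAAComplex

namespace BAAComplex

section Moves

open Topology

variable {V : Type*} [DecidableEq V]

/-- A maximal simplex of dimension greater than `k` can be removed. -/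
lemma IsNConnected.of_deleteStar_maximal {k : ℕ} {K : PreAbstractSimplicialComplex V}
    (hK : K.faces.Finite) {σ : Finset V} (hσ : σ ∈ K.faces)
    (hmax : ∀ f ∈ K.faces, σ ⊆ f → f = σ) (hk : k + 1 < σ.card)
    (hc : IsNConnected k (Realization (deleteStar K σ))) : IsNConnected k (Realization K) := by
  have hK' := hK.subset (deleteStar_subset K σ)
  refine hc.of_homotopic_comp (Realization.incl hK (deleteStar_subset K σ)) fun d hd f => ?_
  obtain ⟨c, f', hc0, hcz, hcsum, hff', hne⟩ :=
    exists_homotopic_avoiding hK hσ hmax (hd.trans_lt hk) f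
  have hσne : σ.Nonempty := (K.isRelLowerSet_faces hσ).1
  -- The largest multiple of `c` that fits below `p` on `σ`. Both points have total weight `1` on
  -- `σ` when `p` lies there, so `m p = 1` only for `p = c`.
  let m : Realization K → ℝ := fun p => σ.inf' hσne fun v => p.1 v / c v
  have hmle : ∀ p, ∀ v ∈ σ, m p ≤ p.1 v / c v := fun p v hv => Finset.inf'_le _ hv
  have hm0 : ∀ p, 0 ≤ m p := fun p => Finset.le_inf' _ _ fun v hv =>
    div_nonneg (p.2.1 v) (hc0 v hv).le
  have hz : ∀ p : Realization K, σ ⊆ p.exists_face.choose → ∀ v, v ∉ σ → p.1 v = 0 := by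
    intro p hp v hv
    have h1 := p.exists_face.choose_spec
    rw [hmax _ h1.1 hp] at h1
    exact le_antisymm (not_lt.1 fun h => hv ((h1.2.1 v).2 h)) (p.2.1 v)
  have hm1 : ∀ p : Realization K, p.1 ≠ c → m p < 1 := by
    intro p hp
    by_contra! h
    have h1 : ∀ v ∈ σ, c v ≤ p.1 v := fun v hv =>
      (one_le_div (hc0 v hv)).1 (h.trans (hmle p v hv))
    have h2 : ∀ v, v ∉ σ → p.1 v = 0 := hz p fun v hv =>
      (p.exists_face.choose_spec.2.1 v).2 ((hc0 v hv).trans_le (h1 v hv))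
    refine hp (funext fun v => ?_)
    by_cases hv : v ∈ σ
    · exact ((Finset.sum_eq_sum_iff_of_le h1).1 (hcsum.trans (p.sum_eq_one h2).symm) v hv).symm
    · rw [h2 v hv, hcz v hv]
  -- Radial projection of `σ` from `c` onto its boundary. Off the open simplex `m p = 0` and `r` is
  -- the identity.
  let r : Realization K → V → ℝ := fun p v => c v + (p.1 v - c v) / (1 - m p)
  have hface : ∀ p : Realization K, p.1 ≠ c → ∃ ρ ∈ (deleteStar K σ).faces, ∃ ρ' ∈ K.faces,
      (∀ v, 0 ≤ r p v) ∧ (∀ v, v ∉ ρ → r p v = 0) ∧ ∑ v ∈ ρ, r p v = 1 ∧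
      ∀ v, v ∉ ρ' → p.1 v = 0 ∧ r p v = 0 := by
    intro p hp
    obtain ⟨hτ, hs, hsum⟩ := p.exists_face.choose_spec
    have hM : 0 < 1 - m p := sub_pos.2 (hm1 p hp)
    by_cases hsub : σ ⊆ p.exists_face.choose
    · have hzp := hz p hsub
      obtain ⟨v₁, hv₁, hv₁'⟩ := Finset.exists_mem_eq_inf' hσne fun v => p.1 v / c v
      have hr : ∀ v ∈ σ, r p v = (p.1 v - m p * c v) / (1 - m p) := by
        intro v _
        simp only [r]
        field_simp
        ring
      have hr1 : r p v₁ = 0 := by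
        have h1 : m p = p.1 v₁ / c v₁ := hv₁'
        rw [hr v₁ hv₁, h1, div_mul_cancel₀ _ (hc0 v₁ hv₁).ne', sub_self, zero_div]
      have hr0 : ∀ v, v ∉ σ → r p v = 0 := fun v hv => by
        simp [r, hcz v hv, hzp v hv]
      have hrsum : ∑ v ∈ σ, r p v = 1 := by
        simp only [r]
        rw [Finset.sum_add_distrib, ← Finset.sum_div, Finset.sum_sub_distrib, p.sum_eq_one hzp,
          hcsum]
        simp
      refine ⟨σ.erase v₁, ⟨(K.isRelLowerSet_faces hσ).2 (Finset.erase_subset _ _)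
        (Finset.card_pos.1 ?_), fun h => Finset.notMem_erase v₁ _ (h hv₁)⟩, σ, hσ,
        fun v => ?_, fun v hv => ?_, ?_, fun v hv => ⟨hzp v hv, hr0 v hv⟩⟩
      · rw [Finset.card_erase_of_mem hv₁]
        omega
      · by_cases hv : v ∈ σ
        · rw [hr v hv]
          refine div_nonneg (sub_nonneg.2 ?_) hM.le
          exact (le_div_iff₀ (hc0 v hv)).1 (hmle p v hv)
        · exact (hr0 v hv).ge
      · by_cases hvv : v = v₁
        · rw [hvv, hr1]
        · exact hr0 v fun h => hv (Finset.mem_erase.2 ⟨hvv, h⟩)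
      · rw [Finset.sum_erase _ hr1, hrsum]
    · have hzp : ∀ v, v ∉ p.exists_face.choose → p.1 v = 0 := fun v hv =>
        le_antisymm (not_lt.1 fun h => hv ((hs v).2 h)) (p.2.1 v)
      have hm : m p = 0 := by
        obtain ⟨v, hv, hv'⟩ := Finset.not_subset.1 hsub
        refine le_antisymm ((hmle p v hv).trans ?_) (hm0 p)
        rw [hzp v hv', zero_div]
      have hrp : ∀ v, r p v = p.1 v := fun v => by simp [r, hm]
      refine ⟨_, ⟨hτ, hsub⟩, _, hτ, fun v => (p.2.1 v).trans (hrp v).ge,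
        fun v hv => (hrp v).trans (hzp v hv), ?_, fun v hv =>
        ⟨hzp v hv, (hrp v).trans (hzp v hv)⟩⟩
      exact (Finset.sum_congr rfl fun v _ => hrp v).trans hsum
  have hcont : ∀ v, Continuous fun x => (f' x).1 v := fun v =>
    (Realization.continuous_coord hK v).comp f'.continuous
  have hmcont : Continuous fun x => m (f' x) :=
    Continuous.finset_inf'_apply _ fun v _ => (hcont v).div_const _
  let f'' : C(Metric.sphere (0 : EuclideanSpace ℝ (Fin d)) 1, Realization (deleteStar K σ)) :=
    ⟨fun x => ⟨r (f' x), by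
      obtain ⟨ρ, hρ, -, -, h1, h2, h3, -⟩ := hface (f' x) (hne x)
      exact isPoint_of_face h1 hρ h2 h3⟩, by
      refine Realization.continuous_of_coord hK' fun v => ?_
      exact continuous_const.add (((hcont v).sub continuous_const).div
        (continuous_const.sub hmcont) fun x => (sub_pos.2 (hm1 _ (hne x))).ne')⟩
  refine ⟨f'', hff'.trans (homotopic_of_common_face hK _ _ fun x => ?_)⟩
  obtain ⟨-, -, ρ', hρ', -, -, -, h4⟩ := hface (f' x) (hne x)
  exact ⟨ρ', hρ', h4⟩

/-- The subcomplex obtained by removing a set of maximal faces. -/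
def deleteFacets (K : PreAbstractSimplicialComplex V) (S : Finset (Finset V)) :
    PreAbstractSimplicialComplex V where
  faces := {f | f ∈ K.faces ∧ ∀ σ ∈ S, ¬ σ ⊆ f}
  isRelLowerSet_faces := fun {_} h =>
    ⟨(K.isRelLowerSet_faces h.1).1, fun _ hts ht =>
      ⟨(K.isRelLowerSet_faces h.1).2 hts ht, fun σ hσ h' => h.2 σ hσ (h'.trans hts)⟩⟩

/-- Facets do not contain one another, so deleting one of them leaves the others as facets and they
can be removed one at a time. -/
lemma IsNConnected.of_deleteFacets {k : ℕ} {K : PreAbstractSimplicialComplex V}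
    (hK : K.faces.Finite) (S : Finset (Finset V)) (hS : ∀ σ ∈ S, σ ∈ K.faces ∧ k + 1 < σ.card ∧
      ∀ f ∈ K.faces, σ ⊆ f → f = σ)
    (hc : IsNConnected k (Realization (deleteFacets K S))) : IsNConnected k (Realization K) := by
  induction S using Finset.induction_on with
  | empty =>
    have : deleteFacets K ∅ = K := by
      ext f
      simp [deleteFacets]
    rwa [this] at hc
  | insert σ S hσS ih =>
    refine ih (fun σ hσ => hS σ (Finset.mem_insert_of_mem hσ)) ?_
    obtain ⟨h1, h2, h3⟩ := hS σ (Finset.mem_insert_self _ _)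
    refine IsNConnected.of_deleteStar_maximal (σ := σ) (hK.subset fun f hf => hf.1) ⟨h1, ?_⟩
      (fun f hf => h3 f hf.1) h2 ?_
    · intro ρ hρ hρσ
      exact hσS ((hS ρ (Finset.mem_insert_of_mem hρ)).2.2 σ h1 hρσ ▸ hρ)
    · have e : deleteStar (deleteFacets K S) σ = deleteFacets K (insert σ S) := by
        ext f
        simp only [deleteStar, deleteFacets, Finset.mem_insert, forall_eq_or_imp]
        exact ⟨fun h => ⟨h.1.1, h.2, h.1.2⟩, fun h => ⟨⟨h.1, h.2.2⟩, h.2.1⟩⟩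
      rwa [e]

/-- Collapse of the open star of `τ` in a complex of dimension at most `k + 1`, if the `k`-skeleton
of the link is contained in a cone with apex `u`. -/
lemma IsNConnected.of_deleteStar {k : ℕ} {K : PreAbstractSimplicialComplex V}
    (hK : K.faces.Finite) (hdim : ∀ f ∈ K.faces, f.card ≤ k + 2) {τ : Finset V} {u : V}
    (hτ : τ.Nonempty) (hu : u ∉ τ)
    (h : ∀ f ∈ K.faces, f.card ≤ k + 1 → τ ⊆ f → insert u f ∈ K.faces)
    (hc : IsNConnected k (Realization (deleteStar K τ))) : IsNConnected k (Realization K) := by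
  classical
  -- The top-dimensional faces that keep the link of `τ` from being a cone. They are facets of
  -- dimension `k + 1`, and after their removal `IsNConnected.of_deleteStar_cone` applies.
  let S : Finset (Finset V) := hK.toFinset.filter fun f =>
    f.card = k + 2 ∧ τ ⊆ f ∧ insert u f ∉ K.faces
  have hS : ∀ f, f ∈ S ↔ f ∈ K.faces ∧ f.card = k + 2 ∧ τ ⊆ f ∧ insert u f ∉ K.faces := by
    intro f
    simp [S]
  have hmax : ∀ σ ∈ S, ∀ f ∈ K.faces, σ ⊆ f → f = σ := by
    intro σ hσ f hf hσf
    refine (Finset.eq_of_subset_of_card_le hσf ?_).symm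
    rw [((hS σ).1 hσ).2.1]
    exact hdim f hf
  refine IsNConnected.of_deleteFacets hK S (fun σ hσ => ⟨((hS σ).1 hσ).1,
    by rw [((hS σ).1 hσ).2.1]; omega, hmax σ hσ⟩) ?_
  refine IsNConnected.of_deleteStar_cone (hK.subset fun f hf => hf.1) hτ hu ?_ ?_
  · rintro f ⟨hf, hfS⟩ hτf
    have h1 : insert u f ∈ K.faces := by
      rcases (hdim f hf).lt_or_eq with h2 | h2
      · exact h f hf (by omega) hτf
      · by_contra h3
        exact hfS f ((hS f).2 ⟨hf, h2, hτf, h3⟩) subset_rfl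
    refine ⟨h1, fun σ hσ hσf => ?_⟩
    -- A discarded `σ` inside `insert u f` would equal it. It would then already contain `u`, so
    -- that `insert u σ` is a face, contrary to the choice of `S`.
    have h2 := hmax σ hσ _ h1 hσf
    have h3 := ((hS σ).1 hσ).2.2.2
    rw [← h2, Finset.insert_idem] at h3
    exact h3 h1
  · have e : deleteStar (deleteFacets K S) τ = deleteStar K τ := by
      ext f
      simp only [deleteStar, deleteFacets]
      exact ⟨fun h => ⟨h.1.1, h.2⟩, fun h => ⟨⟨h.1, fun σ hσ hσf =>
        h.2 ((((hS σ).1 hσ).2.2.1).trans hσf)⟩, h.2⟩⟩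
    rwa [e]

lemma isNConnected_of_unique_face (k : ℕ) {K : PreAbstractSimplicialComplex V} (v : V)
    (hK : K.faces = {{v}}) : IsNConnected k (Realization K) := by
  have hfin : K.faces.Finite := hK ▸ Set.finite_singleton _
  have hsub : Subsingleton (Realization K) := by
    refine ⟨fun p q => Subtype.ext (funext fun w => ?_)⟩
    have key : ∀ p : Realization K, p.1 w = if w = v then 1 else 0 := by
      intro p
      obtain ⟨σ, hσ, hs, hsum⟩ := p.exists_face
      rw [hK, Set.mem_singleton_iff] at hσ
      subst hσ
      split_ifs with hw
      · rw [hw]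
        exact (Finset.sum_singleton _ _).symm.trans hsum
      · exact le_antisymm (not_lt.1 fun h => hw (Finset.mem_singleton.1 ((hs w).2 h))) (p.2.1 w)
    rw [key p, key q]
  rw [isNConnected_iff]
  have hv : {v} ∈ K.faces := hK ▸ Set.mem_singleton _
  let p : Realization K := ⟨fun w => if w = v then 1 else 0, isPoint_of_face
    (fun w => by split_ifs <;> simp) hv (fun w hw => if_neg fun h => hw (Finset.mem_singleton.2 h))
    (by simp)⟩
  refine ⟨⟨p⟩, fun d _ _ f => ⟨p, ?_⟩⟩
  have : f = ContinuousMap.const _ p := ContinuousMap.ext fun x => Subsingleton.elim _ _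
  rw [this]

/-- A sequence of collapses, given by the pairs of a simplex and an apex. The first pair whose
simplex is contained in a face `f` is the same for the face `insert u f`. -/
lemma IsNConnected.of_steps {k : ℕ} (v : V) (steps : List (Finset V × V)) (hnd : steps.Nodup)
    (hst : ∀ s ∈ steps, s.1.Nonempty ∧ s.2 ∉ s.1)
    {K : PreAbstractSimplicialComplex V} (hK : K.faces.Finite)
    (hdim : ∀ f ∈ K.faces, f.card ≤ k + 2)
    (h : ∀ f ∈ K.faces, f.card ≤ k + 1 → ∀ s, steps.find? (fun s => s.1 ⊆ f) = some s →
      insert s.2 f ∈ K.faces ∧ steps.find? (fun s' => s'.1 ⊆ insert s.2 f) = some s)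
    (hv : ∀ f ∈ K.faces, steps.find? (fun s => s.1 ⊆ f) = none ↔ f = {v})
    (hvK : {v} ∈ K.faces) : IsNConnected k (Realization K) := by
  induction steps generalizing K with
  | nil =>
    refine isNConnected_of_unique_face k v ?_
    ext f
    simp only [List.find?_nil, true_iff] at hv
    exact ⟨fun hf => hv f hf, fun hf => hf ▸ hvK⟩
  | cons s steps ih =>
    rw [List.nodup_cons] at hnd
    have hs := hst s List.mem_cons_self
    have hsub : ∀ f ∈ (deleteStar K s.1).faces, List.find? (fun s => decide (s.1 ⊆ f)) (s :: steps) =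
        steps.find? (fun s => s.1 ⊆ f) := by
      intro f hf
      rw [List.find?_cons_of_neg]
      simpa using hf.2
    refine IsNConnected.of_deleteStar hK hdim hs.1 hs.2 (fun f hf hcard hsf => ?_) ?_
    · exact (h f hf hcard s (List.find?_cons_of_pos (by simpa using hsf))).1
    · refine ih hnd.2 (fun s' hs' => hst s' (List.mem_cons_of_mem _ hs'))
        (hK.subset (deleteStar_subset K s.1)) (fun f hf => hdim f hf.1) ?_ ?_ ?_
      · intro f hf hcard s' hs'
        obtain ⟨h1, h2⟩ := h f hf.1 hcard s' (by rw [hsub f hf, hs'])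
        -- Adding the apex cannot reach into the star removed first: otherwise the first applicable
        -- pair would change from `s'` to `s`.
        have h3 : ¬ s.1 ⊆ insert s'.2 f := by
          intro h4
          rw [List.find?_cons_of_pos (by simpa using h4), Option.some_inj] at h2
          exact hnd.1 (h2 ▸ List.mem_of_find?_eq_some hs')
        exact ⟨⟨h1, h3⟩, by rw [← hsub _ ⟨h1, h3⟩, h2]⟩
      · intro f hf
        rw [← hsub f hf, hv f hf.1]
      · refine ⟨hvK, fun h4 => ?_⟩
        have h5 := (hv {v} hvK).2 rfl
        rw [List.find?_cons_of_pos (by simpa using h4)] at h5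
        cases h5

end Moves

/-- Transport of connectivity along an injective relabelling of the vertices. -/
lemma IsNConnected.of_map {k : ℕ} {V W : Type*} [DecidableEq W] (φ : V → W)
    (hφ : Function.Injective φ) {K : PreAbstractSimplicialComplex V}
    {L : PreAbstractSimplicialComplex W} (hK : K.faces.Finite)
    (hL : L.faces = (fun f : Finset V => f.image φ) '' K.faces)
    (hc : IsNConnected k (Realization K)) : IsNConnected k (Realization L) := by
  have hLfin : L.faces.Finite := hL ▸ hK.image _
  let ι : C(Realization K, Realization L) :=
    ⟨fun p => ⟨Function.extend φ p.1 0, by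
      obtain ⟨σ, hσ, hs, hsum⟩ := p.exists_face
      refine isPoint_of_face (σ := σ.image φ) ?_ (hL ▸ ⟨σ, hσ, rfl⟩) ?_ ?_
      · intro w
        by_cases hw : ∃ v, φ v = w
        · obtain ⟨v, rfl⟩ := hw
          rw [hφ.extend_apply]
          exact p.2.1 v
        · rw [Function.extend_apply' _ _ _ hw]
          exact le_rfl
      · intro w hw
        by_cases hw' : ∃ v, φ v = w
        · obtain ⟨v, rfl⟩ := hw'
          rw [hφ.extend_apply]
          exact le_antisymm (not_lt.1 fun h => hw (Finset.mem_image_of_mem _ ((hs v).2 h)))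
            (p.2.1 v)
        · rw [Function.extend_apply' _ _ _ hw']
          rfl
      · rw [Finset.sum_image hφ.injOn]
        simp only [hφ.extend_apply]
        exact hsum⟩, by
      refine Realization.continuous_of_coord hLfin fun w => ?_
      by_cases hw : ∃ v, φ v = w
      · obtain ⟨v, rfl⟩ := hw
        simp only [hφ.extend_apply]
        exact Realization.continuous_coord hK v
      · simp only [Function.extend_apply' _ _ _ hw]
        exact continuous_const⟩
  let π : C(Realization L, Realization K) :=
    ⟨fun p => ⟨fun v => p.1 (φ v), by
      obtain ⟨ρ, hρ, hs, hsum⟩ := p.exists_face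
      rw [hL] at hρ
      obtain ⟨σ, hσ, rfl⟩ := hρ
      refine isPoint_of_face (fun v => p.2.1 _) hσ (fun v hv => ?_) ?_
      · exact le_antisymm (not_lt.1 fun h => hv ((hφ.mem_finset_image).1 ((hs _).2 h))) (p.2.1 _)
      · exact (Finset.sum_image hφ.injOn).symm.trans hsum⟩,
      Realization.continuous_of_coord hK fun v => Realization.continuous_coord hLfin (φ v)⟩
  refine hc.of_homotopic_comp ι fun d _ f => ⟨π.comp f, ?_⟩
  have : f = ι.comp (π.comp f) := by
    refine ContinuousMap.ext fun x => Subtype.ext (funext fun w => ?_)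
    by_cases hw : ∃ v, φ v = w
    · obtain ⟨v, rfl⟩ := hw
      exact (hφ.extend_apply (fun v => (f x).1 (φ v)) 0 v).symm
    · refine Eq.trans ?_ (Function.extend_apply' _ _ _ hw).symm
      obtain ⟨ρ, hρ, hs, -⟩ := (f x).exists_face
      rw [hL] at hρ
      obtain ⟨σ, hσ, rfl⟩ := hρ
      refine le_antisymm (not_lt.1 fun h => hw ?_) ((f x).2.1 _)
      obtain ⟨v, -, hv⟩ := Finset.mem_image.1 ((hs w).2 h)
      exact ⟨v, hv⟩
  rw [← this]

end BAAComplex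

namespace BAAComplex

section Combinatorics

/-! ### The combinatorial model

Four points on a circle cut it into four arcs. The vertices are the twelve proper intervals of arcs,
encoded by `Fin 12`: the intervals that avoid the last arc, followed by their complements. The index
`12` stands for the whole circle. Sets of vertices are encoded by the binary digits of a natural
number. -/

/-- The multiplicity of an arc in an interval. -/
def arcCoeff : Fin 13 → Fin 4 → ℤ :=
  ![![1, 0, 0, 0], ![0, 1, 0, 0], ![0, 0, 1, 0], ![1, 1, 0, 0], ![0, 1, 1, 0], ![1, 1, 1, 0],
    ![0, 1, 1, 1], ![1, 0, 1, 1], ![1, 1, 0, 1], ![0, 0, 1, 1], ![1, 0, 0, 1], ![0, 0, 0, 1],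
    ![1, 1, 1, 1]]

/-- The triples `(a, b, c)` of intervals such that `a` is the disjoint union of `b` and `c`. -/
def relsTwo : List (Fin 13 × Fin 13 × Fin 13) :=
  [(3, 0, 1), (5, 0, 4), (12, 0, 6), (7, 0, 9), (10, 0, 11), (4, 1, 2), (6, 1, 9), (12, 1, 7),
   (8, 1, 10), (5, 2, 3), (7, 2, 10), (12, 2, 8), (9, 2, 11), (8, 3, 11), (12, 3, 9), (6, 4, 11),
   (12, 4, 10), (12, 5, 11)]

/-- The quadruples `(a, b, c, d)` of intervals with `a = b + c + d` or `a + b = c + d`. -/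
def relsThree : List (Fin 13 × Fin 13 × Fin 13 × Fin 13) :=
  [(5, 0, 1, 2), (8, 0, 1, 11), (12, 0, 1, 9), (7, 0, 2, 11), (12, 0, 4, 11), (6, 1, 2, 11),
   (12, 1, 2, 10), (12, 2, 3, 11),
   (0, 6, 1, 7), (0, 4, 2, 3), (0, 6, 2, 8), (0, 9, 2, 10), (0, 6, 3, 9), (0, 12, 3, 7),
   (0, 8, 3, 10), (0, 6, 4, 10), (0, 6, 5, 11), (0, 12, 5, 10), (1, 7, 2, 8), (1, 5, 3, 4),
   (1, 12, 3, 6), (1, 7, 3, 9), (1, 10, 3, 11), (1, 7, 4, 10), (1, 12, 4, 8), (1, 9, 4, 11),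
   (1, 7, 5, 11), (2, 8, 3, 9), (2, 6, 4, 9), (2, 12, 4, 7), (2, 8, 4, 10), (2, 8, 5, 11),
   (2, 12, 5, 9), (3, 6, 4, 8), (3, 9, 4, 10), (3, 7, 5, 10), (3, 12, 5, 8), (3, 9, 5, 11),
   (4, 12, 5, 6), (4, 7, 5, 9), (4, 10, 5, 11), (6, 7, 9, 12), (6, 10, 8, 9), (6, 10, 11, 12),
   (7, 8, 10, 12), (7, 11, 9, 10), (8, 9, 11, 12)]

/-- The mask predicates use primitive operations on naturals, which the kernel evaluates by binary
arithmetic; the exhaustive checks depend on this. -/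
def subMask (s t : ℕ) : Bool := Nat.beq (Nat.land s t) s

def cardMask (f : ℕ) : ℕ :=
  f % 2 + f / 2 % 2 + f / 4 % 2 + f / 8 % 2 + f / 16 % 2 + f / 32 % 2 + f / 64 % 2 + f / 128 % 2 +
    f / 256 % 2 + f / 512 % 2 + f / 1024 % 2 + f / 2048 % 2

/-- The endpoints of the intervals. -/
def edgeMask (f : ℕ) : ℕ := Nat.land (Nat.lor f (Nat.shiftRight f 6)) 63

/-- The rank of a subgraph of the complete graph on four points, tabulated in base `4`. -/
def rankMask (f : ℕ) : ℕ := Nat.land (Nat.shiftRight 340282366524486951828216807013707540884 (2 * f)) 3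

def triMask (r : Fin 13 × Fin 13 × Fin 13) : ℕ :=
  Nat.lor (2 ^ r.1.1) (Nat.lor (2 ^ r.2.1.1) (2 ^ r.2.2.1))

def quadMask (r : Fin 13 × Fin 13 × Fin 13 × Fin 13) : ℕ :=
  Nat.lor (2 ^ r.1.1) (Nat.lor (2 ^ r.2.1.1) (Nat.lor (2 ^ r.2.2.1.1) (2 ^ r.2.2.2.1)))

/-- Tabulated so that the exhaustive check does not recompute the powers of two for each of the 4096
masks. -/
def triMasks : List ℕ :=
  [11, 49, 4161, 641, 3073, 22, 578, 4226, 1282, 44, 1156, 4356, 2564, 2312, 4616, 2128, 5136,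
   6176]

def quadMasks : List ℕ :=
  [39, 2307, 4611, 2181, 6161, 2118, 5126, 6156, 195, 29, 325, 1541, 585, 4233, 1289, 1105, 2145,
   5153, 390, 58, 4170, 650, 3082, 1170, 4370, 2578, 2210, 780, 596, 4244, 1300, 2340, 4644, 344,
   1560, 1192, 4392, 2600, 4208, 688, 3120, 4800, 1856, 7232, 5504, 3712, 6912]

lemma triMasks_eq : triMasks = relsTwo.map triMask := by decide

lemma quadMasks_eq : quadMasks = relsThree.map quadMask := by decide

/-- Intended for masks `f + 4096`, in which the digit of the whole circle is set. -/
def containsRel (f : ℕ) : Bool :=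
  triMasks.any (fun r => subMask r f) || quadMasks.any (fun r => subMask r f)

def containsTwoRels (f : ℕ) : Bool :=
  triMasks.any fun r => subMask r f && triMasks.any fun r' => subMask r' f && !(Nat.beq r r')

/-- Whether the intervals in `f`, together with the whole circle, form a simplex. -/
def isFaceMask (f : ℕ) : Bool :=
  let c := cardMask f
  let r := rankMask (edgeMask f)
  -- The whole circle and the base add equally to the number of lines and to the rank, so only
  -- intervals and graph rank are compared. The excess is `0` for standard, `1` for 2- and
  -- 3-additive, and `2` for the two double types.
  Nat.beq c r || (Nat.beq c (r + 1) && containsRel (f + 4096)) ||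
    (Nat.beq c (r + 2) && containsTwoRels (f + 4096))

/-- A sequence of collapses that reduces the complex to the vertex `0`. -/
def collapses : List (ℕ × ℕ) :=
  [(1412, 11), (3712, 2), (649, 11), (2240, 0), (676, 11), (1172, 3), (1185, 4), (424, 2),
   (705, 4), (2193, 5), (2944, 3), (1192, 2), (2188, 5), (2181, 10), (688, 0), (240, 0), (128, 1),
   (580, 11), (2160, 2), (338, 2), (3152, 2), (586, 5), (2118, 4), (2880, 3), (360, 11),
   (1856, 1), (1094, 4), (2124, 5), (344, 11), (64, 0), (2820, 4), (2596, 1), (1569, 11),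
   (786, 10), (2578, 2), (2577, 5), (1541, 11), (1542, 4), (512, 3), (273, 10), (262, 3),
   (274, 10), (300, 10), (256, 11), (3082, 0), (3078, 4), (3089, 2), (2048, 5), (1024, 4),
   (32, 0), (16, 0), (8, 0), (4, 0), (2, 0)]

/-- The hypotheses of `IsNConnected.of_steps` for `k = 3`: faces have at most `5` vertices, and a
face with fewer than `5` can absorb the apex of its first applicable pair without changing that
pair. Only the masks `0` (no vertex) and `1` (the vertex `0`) may escape all pairs. -/
def checkCollapse (f : ℕ) : Bool :=
  !isFaceMask f || (Nat.ble (cardMask f) 5 &&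
    match collapses.find? (fun s => subMask s.1 f) with
    | none => Nat.ble f 1
    | some s => !(Nat.beq f 1) && (Nat.ble 5 (cardMask f) ||
        (isFaceMask (Nat.lor f (2 ^ s.2)) &&
          (collapses.find? (fun s' => subMask s'.1 (Nat.lor f (2 ^ s.2)))).any fun s' => Nat.beq s.1 s'.1)))

/-- All 4096 masks, split in base 64 so that each bounded quantifier stays short. -/
lemma checkCollapse_all : ∀ a < 64, ∀ b < 64, checkCollapse (64 * a + b) = true := by
  decide +kernel

end Combinatorics

end BAAComplex

/-! ### Translation between masks and finite sets of intervals. -/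

namespace BAAComplex

section Combinatorics

/-- The set of binary digits. -/
def bits (n f : ℕ) : Finset (Fin n) := Finset.univ.filter fun i => f.testBit i = true

lemma mem_bits {n f : ℕ} {i : Fin n} : i ∈ bits n f ↔ f.testBit i = true := by
  simp [bits]

lemma bits_lor (n f : ℕ) (u : Fin n) : bits n (Nat.lor f (2 ^ u.1)) = insert u (bits n f) := by
  ext i
  rw [mem_bits, Finset.mem_insert, mem_bits]
  change (f ||| 2 ^ u.1).testBit i = true ↔ _
  rw [Nat.testBit_or, Nat.testBit_two_pow]
  simp only [Bool.or_eq_true, decide_eq_true_eq, Fin.ext_iff]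
  tauto

lemma exists_bits {n : ℕ} (σ : Finset (Fin n)) : ∃ f < 2 ^ n, bits n f = σ := by
  induction σ using Finset.induction_on with
  | empty => exact ⟨0, Nat.two_pow_pos n, by ext i; simp [mem_bits]⟩
  | insert u σ _ ih =>
    obtain ⟨f, hf, rfl⟩ := ih
    exact ⟨Nat.lor f (2 ^ u.1), Nat.or_lt_two_pow hf (Nat.pow_lt_pow_right one_lt_two u.2),
      bits_lor n f u⟩

lemma bits_subset_iff {n s t : ℕ} (hs : s < 2 ^ n) :
    bits n s ⊆ bits n t ↔ subMask s t = true := by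
  have h1 : subMask s t = true ↔ s &&& t = s := by
    rw [subMask, Nat.beq_eq]
    rfl
  rw [h1]
  constructor
  · intro h
    refine Nat.eq_of_testBit_eq fun i => ?_
    rw [Nat.testBit_and]
    by_cases hi : i < n
    · have h2 := @h ⟨i, hi⟩
      rw [mem_bits, mem_bits] at h2
      cases h3 : s.testBit i <;> simp_all
    · have : s.testBit i = false :=
        Nat.testBit_lt_two_pow (hs.trans_le (Nat.pow_le_pow_right two_pos (not_lt.1 hi)))
      simp [this]
  · intro h i hi
    rw [mem_bits] at hi ⊢
    rw [← h, Nat.testBit_and, Bool.and_eq_true] at hi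
    exact hi.2

lemma bits_injOn {n s t : ℕ} (hs : s < 2 ^ n) (ht : t < 2 ^ n) (h : bits n s = bits n t) :
    s = t := by
  refine Nat.eq_of_testBit_eq fun i => ?_
  by_cases hi : i < n
  · have := Finset.ext_iff.1 h ⟨i, hi⟩
    rw [mem_bits, mem_bits] at this
    exact Bool.eq_iff_iff.2 this
  · rw [Nat.testBit_lt_two_pow (hs.trans_le (Nat.pow_le_pow_right two_pos (not_lt.1 hi))),
      Nat.testBit_lt_two_pow (ht.trans_le (Nat.pow_le_pow_right two_pos (not_lt.1 hi)))]

lemma card_bits (f : ℕ) : (bits 12 f).card = cardMask f := by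
  have h : ∀ i, (if f.testBit i = true then 1 else 0) = f / 2 ^ i % 2 := by
    intro i
    rw [Nat.testBit_eq_decide_div_mod_eq]
    rcases Nat.mod_two_eq_zero_or_one (f / 2 ^ i) with h | h <;> simp [h]
  rw [bits, Finset.card_filter]
  simp only [Fin.sum_univ_succ, h]
  simp [cardMask]
  ring

/-- The vertices of a simplex together with the vertex `12`. -/
def withTop (τ : Finset (Fin 12)) : Finset (Fin 13) := insert 12 (τ.map Fin.castSuccEmb)

lemma bits_add_top {f : ℕ} (hf : f < 2 ^ 12) : bits 13 (f + 4096) = withTop (bits 12 f) := by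
  ext i
  rw [mem_bits, show f + 4096 = 2 ^ 12 ||| f by
    have := Nat.two_pow_add_eq_or_of_lt hf 1
    rw [mul_one] at this
    omega, Nat.testBit_or, Nat.testBit_two_pow, withTop,
    Finset.mem_insert, Finset.mem_map]
  simp only [Bool.or_eq_true, decide_eq_true_eq, mem_bits]
  induction i using Fin.lastCases with
  | last => simp [Fin.ext_iff]
  | cast j =>
    have h1 : ¬ (12 = j.1) := by omega
    have h2 : Fin.castSucc j ≠ 12 := fun h => h1 (Fin.ext_iff.1 h).symm
    simp [h1, h2]

/-- The endpoints of the intervals. -/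
def src : Fin 12 → Fin 4 := ![0, 1, 2, 0, 1, 0, 0, 1, 2, 0, 1, 0]

def tgt : Fin 12 → Fin 4 := ![1, 2, 3, 2, 3, 3, 1, 2, 3, 2, 3, 3]

/-- Two points that are equal or joined by an interval in `τ`. -/
def Joined (τ : Finset (Fin 12)) (i j : Fin 4) : Prop :=
  i = j ∨ ∃ a ∈ τ, (src a = i ∧ tgt a = j) ∨ (src a = j ∧ tgt a = i)

def joinedMask (t : ℕ) (i j : Fin 4) : Prop :=
  i = j ∨ ∃ e : Fin 6, t.testBit e = true ∧
    ((src (Fin.castAdd 6 e) = i ∧ tgt (Fin.castAdd 6 e) = j) ∨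
      (src (Fin.castAdd 6 e) = j ∧ tgt (Fin.castAdd 6 e) = i))

instance (t : ℕ) (i j : Fin 4) : Decidable (joinedMask t i j) := by
  unfold joinedMask; infer_instance

/-- The fifteen partitions of four points, each as the map to the least element of the block. -/
def partitions : List (Fin 4 → Fin 4) :=
  [![0, 1, 2, 3], ![0, 0, 2, 3], ![0, 1, 0, 3], ![0, 1, 2, 0], ![0, 1, 1, 3], ![0, 1, 2, 1],
    ![0, 1, 2, 2], ![0, 0, 2, 2], ![0, 1, 0, 1], ![0, 1, 1, 0], ![0, 0, 0, 3], ![0, 0, 2, 0],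
    ![0, 1, 0, 0], ![0, 1, 1, 1], ![0, 0, 0, 0]]

/-- The witness is the partition into connected components, and the graph rank counts the points
that do not represent their component. On four points a path needs at most three edges, hence the
two intermediate points `k` and `l`. -/
lemma rankMask_spec : ∀ t < 64, ∃ rep ∈ partitions,
    (∀ e : Fin 6, t.testBit e = true →
      rep (src (Fin.castAdd 6 e)) = rep (tgt (Fin.castAdd 6 e))) ∧
    (Finset.univ.filter fun i => rep i ≠ i).card = rankMask t ∧ (∀ i, rep (rep i) = rep i) ∧
    ∀ i, ∃ k l, joinedMask t i k ∧ joinedMask t k l ∧ joinedMask t l (rep i) := by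
  decide +kernel

lemma testBit_edgeMask (f : ℕ) (e : Fin 6) : (edgeMask f).testBit e =
    (f.testBit e || f.testBit (e + 6)) := by
  have h : (63 : ℕ).testBit e = true := by revert e; decide
  change ((f ||| (f >>> 6)) &&& 63).testBit e = _
  rw [Nat.testBit_and, Nat.testBit_or, Nat.testBit_shiftRight, h, Bool.and_true, add_comm]

lemma src_tgt_eq : ∀ a : Fin 12, ∃ e : Fin 6, (a.1 = e.1 ∨ a.1 = e.1 + 6) ∧
    src a = src (Fin.castAdd 6 e) ∧ tgt a = tgt (Fin.castAdd 6 e) := by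
  decide

lemma src_tgt_natAdd : ∀ e : Fin 6, src (Fin.natAdd 6 e) = src (Fin.castAdd 6 e) ∧
    tgt (Fin.natAdd 6 e) = tgt (Fin.castAdd 6 e) := by
  decide

lemma joined_of_joinedMask {f : ℕ} {i j : Fin 4} (h : joinedMask (edgeMask f) i j) :
    Joined (bits 12 f) i j := by
  refine h.imp id ?_
  rintro ⟨e, he, h⟩
  rw [testBit_edgeMask, Bool.or_eq_true] at he
  rcases he with he | he
  · exact ⟨Fin.castAdd 6 e, mem_bits.2 he, h⟩
  · refine ⟨Fin.natAdd 6 e, mem_bits.2 (by simpa [add_comm] using he), ?_⟩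
    rwa [(src_tgt_natAdd e).1, (src_tgt_natAdd e).2]

lemma edgeMask_lt (f : ℕ) : edgeMask f < 64 :=
  Nat.and_lt_two_pow (n := 6) _ (by norm_num)

lemma exists_partition (f : ℕ) : ∃ rep : Fin 4 → Fin 4,
    (∀ a ∈ bits 12 f, rep (src a) = rep (tgt a)) ∧
    (Finset.univ.filter fun i => rep i ≠ i).card = rankMask (edgeMask f) ∧
    (∀ i, rep (rep i) = rep i) ∧
    ∀ i, ∃ k l, Joined (bits 12 f) i k ∧ Joined (bits 12 f) k l ∧
      Joined (bits 12 f) l (rep i) := by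
  obtain ⟨rep, -, h1, h2, h3, h4⟩ := rankMask_spec _ (edgeMask_lt f)
  refine ⟨rep, fun a ha => ?_, h2, h3, fun i => ?_⟩
  · obtain ⟨e, he, h5, h6⟩ := src_tgt_eq a
    rw [h5, h6]
    refine h1 e ?_
    rw [testBit_edgeMask, Bool.or_eq_true]
    rw [mem_bits] at ha
    rcases he with he | he
    · exact Or.inl (he ▸ ha)
    · exact Or.inr (he ▸ ha)
  · obtain ⟨k, l, h5, h6, h7⟩ := h4 i
    exact ⟨k, l, joined_of_joinedMask h5, joined_of_joinedMask h6, joined_of_joinedMask h7⟩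

lemma relsTwo_nodup : ∀ r ∈ relsTwo, [r.1, r.2.1, r.2.2].Nodup := by
  have h : (relsTwo.all fun r => decide [r.1, r.2.1, r.2.2].Nodup) = true := by decide +kernel
  exact fun r hr => of_decide_eq_true (List.all_eq_true.1 h r hr)

lemma relsThree_nodup : ∀ r ∈ relsThree, [r.1, r.2.1, r.2.2.1, r.2.2.2].Nodup := by
  have h : (relsThree.all fun r => decide [r.1, r.2.1, r.2.2.1, r.2.2.2].Nodup) = true := by
    decide +kernel
  exact fun r hr => of_decide_eq_true (List.all_eq_true.1 h r hr)

lemma bits_triMask (r : Fin 13 × Fin 13 × Fin 13) :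
    bits 13 (triMask r) = {r.1, r.2.1, r.2.2} := by
  ext i
  change i ∈ bits 13 (2 ^ r.1.1 ||| (2 ^ r.2.1.1 ||| 2 ^ r.2.2.1)) ↔ _
  simp only [mem_bits, Nat.testBit_or, Nat.testBit_two_pow, Bool.or_eq_true, decide_eq_true_eq,
    Finset.mem_insert, Finset.mem_singleton, Fin.ext_iff, eq_comm (a := i.1)]

lemma bits_quadMask (r : Fin 13 × Fin 13 × Fin 13 × Fin 13) :
    bits 13 (quadMask r) = {r.1, r.2.1, r.2.2.1, r.2.2.2} := by
  ext i
  change i ∈ bits 13 (2 ^ r.1.1 ||| (2 ^ r.2.1.1 ||| (2 ^ r.2.2.1.1 ||| 2 ^ r.2.2.2.1))) ↔ _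
  simp only [mem_bits, Nat.testBit_or, Nat.testBit_two_pow, Bool.or_eq_true, decide_eq_true_eq,
    Finset.mem_insert, Finset.mem_singleton, Fin.ext_iff, eq_comm (a := i.1)]

lemma triMask_lt (r : Fin 13 × Fin 13 × Fin 13) : triMask r < 2 ^ 13 :=
  Nat.or_lt_two_pow (Nat.pow_lt_pow_right one_lt_two r.1.2)
    (Nat.or_lt_two_pow (Nat.pow_lt_pow_right one_lt_two r.2.1.2)
      (Nat.pow_lt_pow_right one_lt_two r.2.2.2))

lemma quadMask_lt (r : Fin 13 × Fin 13 × Fin 13 × Fin 13) : quadMask r < 2 ^ 13 :=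
  Nat.or_lt_two_pow (Nat.pow_lt_pow_right one_lt_two r.1.2)
    (Nat.or_lt_two_pow (Nat.pow_lt_pow_right one_lt_two r.2.1.2)
      (Nat.or_lt_two_pow (Nat.pow_lt_pow_right one_lt_two r.2.2.1.2)
        (Nat.pow_lt_pow_right one_lt_two r.2.2.2.2)))

def ContainsTwo (τ : Finset (Fin 12)) (r : Fin 13 × Fin 13 × Fin 13) : Prop :=
  {r.1, r.2.1, r.2.2} ⊆ withTop τ

def ContainsThree (τ : Finset (Fin 12)) (r : Fin 13 × Fin 13 × Fin 13 × Fin 13) : Prop :=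
  {r.1, r.2.1, r.2.2.1, r.2.2.2} ⊆ withTop τ

lemma subMask_triMask {f : ℕ} (hf : f < 2 ^ 12) (r : Fin 13 × Fin 13 × Fin 13) :
    subMask (triMask r) (f + 4096) = true ↔ ContainsTwo (bits 12 f) r := by
  rw [← bits_subset_iff (triMask_lt r), bits_triMask, bits_add_top hf, ContainsTwo]

lemma subMask_quadMask {f : ℕ} (hf : f < 2 ^ 12) (r : Fin 13 × Fin 13 × Fin 13 × Fin 13) :
    subMask (quadMask r) (f + 4096) = true ↔ ContainsThree (bits 12 f) r := by
  rw [← bits_subset_iff (quadMask_lt r), bits_quadMask, bits_add_top hf, ContainsThree]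

/-- This lets `containsTwoRels` compare masks in place of relations. -/
lemma triMask_injOn : ∀ r ∈ relsTwo, ∀ r' ∈ relsTwo, triMask r = triMask r' → r = r' := by
  have h : (relsTwo.map triMask).Nodup := by rw [← triMasks_eq]; decide
  exact fun r hr r' hr' => List.inj_on_of_nodup_map h hr hr'

lemma containsRel_iff {f : ℕ} (hf : f < 2 ^ 12) : containsRel (f + 4096) = true ↔
    (∃ r ∈ relsTwo, ContainsTwo (bits 12 f) r) ∨ ∃ r ∈ relsThree, ContainsThree (bits 12 f) r := by
  simp only [containsRel, triMasks_eq, quadMasks_eq, Bool.or_eq_true, List.any_eq_true,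
    List.mem_map, exists_exists_and_eq_and]
  refine or_congr (exists_congr fun r => and_congr_right fun hr => subMask_triMask hf r)
    (exists_congr fun r => and_congr_right fun hr => subMask_quadMask hf r)

lemma containsTwoRels_iff {f : ℕ} (hf : f < 2 ^ 12) : containsTwoRels (f + 4096) = true ↔
    ∃ r ∈ relsTwo, ContainsTwo (bits 12 f) r ∧ ∃ r' ∈ relsTwo, ContainsTwo (bits 12 f) r' ∧
      r ≠ r' := by
  simp only [containsTwoRels, triMasks_eq, Bool.and_eq_true, List.any_eq_true,
    List.mem_map, exists_exists_and_eq_and]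
  refine exists_congr fun r => and_congr_right fun hr => and_congr (subMask_triMask hf r)
    (exists_congr fun r' => and_congr_right fun hr' => and_congr (subMask_triMask hf r') ?_)
  rw [Bool.not_eq_true', ← Bool.not_eq_true, Nat.beq_eq, ← not_iff_not, not_not, ne_eq,
    not_not]
  exact ⟨triMask_injOn r hr r' hr', fun h => h ▸ rfl⟩

lemma isFaceMask_iff {f : ℕ} (hf : f < 2 ^ 12) : isFaceMask f = true ↔
    (bits 12 f).card = rankMask (edgeMask f) ∨
    ((bits 12 f).card = rankMask (edgeMask f) + 1 ∧
      ((∃ r ∈ relsTwo, ContainsTwo (bits 12 f) r) ∨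
        ∃ r ∈ relsThree, ContainsThree (bits 12 f) r)) ∨
    ((bits 12 f).card = rankMask (edgeMask f) + 2 ∧
      ∃ r ∈ relsTwo, ContainsTwo (bits 12 f) r ∧ ∃ r' ∈ relsTwo, ContainsTwo (bits 12 f) r' ∧
        r ≠ r') := by
  simp only [isFaceMask, Bool.or_eq_true, Bool.and_eq_true, Nat.beq_eq, card_bits,
    containsRel_iff hf, containsTwoRels_iff hf, or_assoc]

end Combinatorics

end BAAComplex

/-! ### Running the collapses on the subcomplex of the intervals in a down-closed set. -/

namespace BAAComplex

section Combinatorics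

lemma checkCollapse_spec {f : ℕ} (hf : f < 2 ^ 12) (hface : isFaceMask f = true) :
    cardMask f ≤ 5 ∧
    (collapses.find? (fun s => subMask s.1 f) = none → f ≤ 1) ∧
    ∀ s, collapses.find? (fun s => subMask s.1 f) = some s → f ≠ 1 ∧ (cardMask f ≤ 4 →
      isFaceMask (Nat.lor f (2 ^ s.2)) = true ∧ ∃ s',
        collapses.find? (fun s' => subMask s'.1 (Nat.lor f (2 ^ s.2))) = some s' ∧ s.1 = s'.1) := by
  have h := checkCollapse_all (f / 64) (by omega) (f % 64) (Nat.mod_lt _ (by norm_num))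
  rw [Nat.div_add_mod, checkCollapse, hface, Bool.not_true, Bool.false_or, Bool.and_eq_true,
    Nat.ble_eq] at h
  refine ⟨h.1, fun hn => ?_, fun s hs => ?_⟩
  · have h2 := h.2
    rw [hn] at h2
    exact Nat.le_of_ble_eq_true h2
  · have h2 := h.2
    rw [hs] at h2
    simp only [Bool.and_eq_true, Bool.or_eq_true, Bool.not_eq_true', ← Bool.not_eq_true,
      Nat.beq_eq, Nat.ble_eq, Option.any_eq_true] at h2
    exact ⟨h2.1, fun hc => h2.2.resolve_left (by omega)⟩

/-- The last clause makes the list work for every admissible set of intervals: the apex lies below a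
member of the removed simplex or below interval `5`, the union of the first three arcs, and is
therefore available whenever that simplex is. -/
lemma collapses_spec : ∀ s ∈ collapses, s.1 ≠ 0 ∧ s.1 < 2 ^ 12 ∧ s.2 < 12 ∧
    s.1.testBit s.2 = false ∧ ∃ b : Fin 12, (b = 5 ∨ s.1.testBit b = true) ∧
      ∀ k, arcCoeff (Fin.ofNat 12 s.2).castSucc k ≤ arcCoeff b.castSucc k := by
  have h : (collapses.all fun s => decide (s.1 ≠ 0) && Nat.blt s.1 4096 && Nat.blt s.2 12 &&
      !s.1.testBit s.2 && decide (∃ b : Fin 12, (b = 5 ∨ s.1.testBit b = true) ∧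
      ∀ k, arcCoeff (Fin.ofNat 12 s.2).castSucc k ≤ arcCoeff b.castSucc k)) = true := by
    decide +kernel
  intro s hs
  have h1 := List.all_eq_true.1 h s hs
  simp only [Bool.and_eq_true, decide_eq_true_eq, Bool.not_eq_true', Nat.blt_eq] at h1
  exact ⟨h1.1.1.1.1, h1.1.1.1.2, h1.1.1.2, h1.1.2, h1.2⟩

/-- A pair is determined by its simplex, so `checkCollapse` may compare first components only. -/
lemma collapses_nodup : (collapses.map Prod.fst).Nodup := by
  decide +kernel

lemma bits_one : bits 12 1 = {0} := by decide

lemma isFaceMask_one : isFaceMask 1 = true := by decide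

lemma find_collapses_one : collapses.find? (fun s => subMask s.1 1) = none := by decide

def collapseSteps : List (Finset (Fin 12) × Fin 12) :=
  collapses.map fun s => (bits 12 s.1, Fin.ofNat 12 s.2)

lemma find_collapseSteps (f : ℕ) : collapseSteps.find? (fun s => s.1 ⊆ bits 12 f) =
    (collapses.find? (fun s => subMask s.1 f)).map fun s => (bits 12 s.1, Fin.ofNat 12 s.2) := by
  rw [collapseSteps, List.find?_map]
  congr 1
  refine List.find?_congr fun s hs => ?_
  rw [Function.comp_apply, Bool.eq_iff_iff, decide_eq_true_eq]
  exact bits_subset_iff (collapses_spec s hs).2.1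

/-- The complex of the intervals in `S` is `3`-connected. -/
theorem isNConnected_of_isFaceMask (S : Set (Fin 12)) (h5 : 5 ∈ S)
    (hS : ∀ a b : Fin 12, (∀ k, arcCoeff a.castSucc k ≤ arcCoeff b.castSucc k) → b ∈ S → a ∈ S)
    {K : PreAbstractSimplicialComplex (Fin 12)}
    (hK : ∀ f < 2 ^ 12, bits 12 f ∈ K.faces ↔
      (bits 12 f).Nonempty ∧ isFaceMask f = true ∧ ∀ a ∈ bits 12 f, a ∈ S) :
    IsNConnected 3 (Realization K) := by
  have h0 : (0 : Fin 12) ∈ S := hS 0 5 (by decide) h5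
  refine IsNConnected.of_steps 0 collapseSteps ?_ ?_ (Set.toFinite _) ?_ ?_ ?_ ?_
  · refine List.Nodup.map_on ?_ (List.Nodup.of_map _ collapses_nodup)
    intro s hs s' hs' h
    refine List.inj_on_of_nodup_map collapses_nodup hs hs' ?_
    exact bits_injOn (collapses_spec s hs).2.1 (collapses_spec s' hs').2.1 (congrArg Prod.fst h)
  · intro s hs
    obtain ⟨s', hs', rfl⟩ := List.mem_map.1 hs
    obtain ⟨h1, h2, h3, h4, -⟩ := collapses_spec s' hs'
    refine ⟨Finset.nonempty_iff_ne_empty.2 fun h => h1 ?_, fun h => ?_⟩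
    · refine bits_injOn h2 (by norm_num) (h.trans ?_)
      ext i
      simp [mem_bits]
    · rw [mem_bits] at h
      simp only [Fin.val_ofNat, Nat.mod_eq_of_lt h3, h4] at h
      cases h
  · intro σ hσ
    obtain ⟨f, hf, rfl⟩ := exists_bits σ
    rw [card_bits]
    exact (checkCollapse_spec hf ((hK f hf).1 hσ).2.1).1
  · intro σ hσ hcard s hs
    obtain ⟨f, hf, rfl⟩ := exists_bits σ
    rw [find_collapseSteps, Option.map_eq_some_iff] at hs
    obtain ⟨t, ht, rfl⟩ := hs
    obtain ⟨hne, hface, hfS⟩ := (hK f hf).1 hσ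
    rw [card_bits] at hcard
    obtain ⟨h1, t', h2, h3⟩ := ((checkCollapse_spec hf hface).2.2 t ht).2 hcard
    have htm := List.mem_of_find?_eq_some ht
    obtain ⟨g1, g2, g3, g4, b, hb, hbk⟩ := collapses_spec t htm
    have htt' : t' = t := List.inj_on_of_nodup_map collapses_nodup (List.mem_of_find?_eq_some h2)
      htm h3.symm
    have hu : ((Fin.ofNat 12 t.2 : Fin 12) : ℕ) = t.2 := by
      simp [Nat.mod_eq_of_lt g3]
    have hins : insert (Fin.ofNat 12 t.2) (bits 12 f) = bits 12 (Nat.lor f (2 ^ t.2)) := by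
      have := bits_lor 12 f (Fin.ofNat 12 t.2)
      rw [hu] at this
      exact this.symm
    have hlt : Nat.lor f (2 ^ t.2) < 2 ^ 12 :=
      Nat.or_lt_two_pow hf (Nat.pow_lt_pow_right one_lt_two g3)
    have hsub : bits 12 t.1 ⊆ bits 12 f :=
      (bits_subset_iff g2).2 (by simpa using List.find?_some ht)
    simp only [hins]
    refine ⟨(hK _ hlt).2 ⟨?_, h1, ?_⟩, ?_⟩
    · rw [← hins]
      exact Finset.insert_nonempty _ _
    · rw [← hins]
      intro a ha
      -- The apex belongs to `S` because `S` is closed under subintervals and contains `5` and all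
      -- of `f`.
      rcases Finset.mem_insert.1 ha with rfl | ha
      · refine hS _ b hbk ?_
        rcases hb with rfl | hb
        · exact h5
        · exact hfS b (hsub (mem_bits.2 hb))
      · exact hfS a ha
    · rw [find_collapseSteps, h2, htt']
      rfl
  · intro σ hσ
    obtain ⟨f, hf, rfl⟩ := exists_bits σ
    obtain ⟨hne, hface, -⟩ := (hK f hf).1 hσ
    rw [find_collapseSteps, Option.map_eq_none_iff, ← bits_one]
    constructor
    · intro h
      have h1 := (checkCollapse_spec hf hface).2.1 h
      have h2 : f ≠ 0 := by
        rintro rfl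
        obtain ⟨i, hi⟩ := hne
        simp [mem_bits] at hi
      rw [show f = 1 by omega]
    · intro h
      rw [bits_injOn hf (by norm_num) h]
      exact find_collapses_one
  · rw [← bits_one, hK 1 (by norm_num), bits_one]
    refine ⟨Finset.singleton_nonempty _, isFaceMask_one, fun a ha => ?_⟩
    rw [Finset.mem_singleton.1 ha]
    exact h0

end Combinatorics

end BAAComplex

/-! ### Direct summands via dual families; frames and the rank of a simplex. -/

namespace BAAComplex

section Lattice

/-- A family with a dual family spans a direct summand. -/
lemma isComplemented_of_dual {ι M : Type*} [Fintype ι] [DecidableEq ι] [AddCommGroup M]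
    (b : ι → M) (D : ι → M →ₗ[ℤ] ℤ) (hD : ∀ i j, D i (b j) = if i = j then 1 else 0) :
    IsComplemented (Submodule.span ℤ (Set.range b)) ∧
      Module.finrank ℤ (Submodule.span ℤ (Set.range b)) = Fintype.card ι := by
  have hmem : ∀ i, b i ∈ Submodule.span ℤ (Set.range b) := fun i =>
    Submodule.subset_span ⟨i, rfl⟩
  constructor
  -- The map `∑ i, D i (·) • b i` is a projection onto the span, so its kernel is a complement.
  · let p : M →ₗ[ℤ] Submodule.span ℤ (Set.range b) :=
      ∑ i, (D i).smulRight (⟨b i, hmem i⟩ : Submodule.span ℤ (Set.range b))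
    refine ⟨LinearMap.ker p, LinearMap.isCompl_of_proj (f := p) fun x => ?_⟩
    obtain ⟨x, hx⟩ := x
    apply Subtype.ext
    have hp : ∀ y, (p y : M) = ∑ i, D i y • b i := fun y => by
      simp [p, LinearMap.sum_apply]
    rw [hp]
    induction hx using Submodule.span_induction with
    | mem x hx =>
      obtain ⟨j, rfl⟩ := hx
      simp [hD]
    | zero => simp
    | add x y _ _ hx hy =>
      simp only [map_add, add_smul, Finset.sum_add_distrib] at hx hy ⊢
      rw [hx, hy]
    | smul a x _ hx =>
      simp only [map_smul, smul_assoc, ← Finset.smul_sum] at hx ⊢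
      rw [hx]
  · refine finrank_span_eq_card ?_
    rw [Fintype.linearIndependent_iff]
    intro g hg i
    have := congrArg (D i) hg
    simpa [hD] using this

/-- A dual family of a family that spans a direct summand of maximal rank. -/
lemma exists_dual.{u} {ι M : Type u} [Fintype ι] [DecidableEq ι] [AddCommGroup M]
    [Module.Free ℤ M] [Module.Finite ℤ M] (b : ι → M)
    (hc : IsComplemented (Submodule.span ℤ (Set.range b)))
    (hr : Module.finrank ℤ (Submodule.span ℤ (Set.range b)) = Fintype.card ι) :
    ∃ D : ι → M →ₗ[ℤ] ℤ, ∀ i j, D i (b j) = if i = j then 1 else 0 := by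
  -- By rank-nullity the relations among the `b i` form a submodule of rank `0` of a free module,
  -- hence they vanish.
  have hli : LinearIndependent ℤ b := by
    have h1 : Module.finrank ℤ (LinearMap.range (Fintype.linearCombination ℤ b)) +
        Module.finrank ℤ (LinearMap.ker (Fintype.linearCombination ℤ b)) =
          Module.finrank ℤ (ι → ℤ) := by
      have h := LinearMap.rank_range_add_rank_ker (Fintype.linearCombination ℤ b)
      simp only [← Module.finrank_eq_rank] at h
      exact_mod_cast h
    rw [Fintype.range_linearCombination, hr, Module.finrank_fintype_fun_eq_card] at h1
    have h2 : LinearMap.ker (Fintype.linearCombination ℤ b) = ⊥ :=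
      Submodule.finrank_eq_zero.1 (by omega)
    rw [Fintype.linearIndependent_iff]
    intro g hg
    have : g ∈ LinearMap.ker (Fintype.linearCombination ℤ b) := by
      rw [LinearMap.mem_ker, Fintype.linearCombination_apply, hg]
    rw [h2, Submodule.mem_bot] at this
    exact fun i => congrFun this i
  obtain ⟨q, hq⟩ := hc
  let B := Module.Basis.span hli
  refine ⟨fun i => B.coord i ∘ₗ Submodule.projectionOnto _ q hq, fun i j => ?_⟩
  have h1 : (B j : M) = b j := by
    rw [Module.Basis.span_apply]
  have h2 : Submodule.projectionOnto _ q hq (b j) = B j := by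
    rw [← h1]
    exact Submodule.projectionOnto_apply_left hq (B j)
  rw [LinearMap.comp_apply, h2, Module.Basis.coord_apply, Module.Basis.repr_self,
    Finsupp.single_apply]
  simp only [eq_comm]

lemma mem_lines_of_dual {N : ℕ} {x : Fin N → ℤ} (φ : (Fin N → ℤ) →ₗ[ℤ] ℤ) (h : φ x = 1) :
    Submodule.span ℤ {x} ∈ lines N := by
  refine ⟨x, ⟨fun h0 => ?_, ?_⟩, rfl⟩
  · rw [h0, map_zero] at h
    exact zero_ne_one h
  · have := (isComplemented_of_dual (fun _ : Unit => x) (fun _ => φ) (by simp [h])).1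
    rwa [Set.range_const] at this

end Lattice

section Frame

variable {N m : ℕ}

/-- A family of vectors together with a dual family. The first four vectors are the arcs of the
combinatorial model, the others span the simplex of which the link is taken. -/
structure Frame (N m : ℕ) where
  arc : Fin 4 → Fin N → ℤ
  base : Fin m → Fin N → ℤ
  dualArc : Fin 4 → (Fin N → ℤ) →ₗ[ℤ] ℤ
  dualBase : Fin m → (Fin N → ℤ) →ₗ[ℤ] ℤ
  dualArc_arc : ∀ i j, dualArc i (arc j) = if i = j then 1 else 0
  dualArc_base : ∀ i j, dualArc i (base j) = 0
  dualBase_arc : ∀ i j, dualBase i (arc j) = 0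
  dualBase_base : ∀ i j, dualBase i (base j) = if i = j then 1 else 0

namespace Frame

variable (F : Frame N m)

/-- The vector of an interval. -/
def vec (a : Fin 13) : Fin N → ℤ := ∑ k, arcCoeff a k • F.arc k

def line (a : Fin 13) : Submodule ℤ (Fin N → ℤ) := Submodule.span ℤ {F.vec a}

noncomputable def baseLines : Finset (Submodule ℤ (Fin N → ℤ)) :=
  Finset.univ.image fun i => Submodule.span ℤ {F.base i}

/-- The lines of a set of intervals, of the whole circle and of the base. -/
noncomputable def simplex (τ : Finset (Fin 12)) : Finset (Submodule ℤ (Fin N → ℤ)) :=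
  (withTop τ).image F.line ∪ F.baseLines

/-- The vectors of all lines under consideration. -/
def gen : Fin 13 ⊕ Fin m → Fin N → ℤ := Sum.elim F.vec F.base

lemma dualArc_vec (k : Fin 4) (a : Fin 13) : F.dualArc k (F.vec a) = arcCoeff a k := by
  simp only [vec, map_sum, map_smul, smul_eq_mul, F.dualArc_arc, mul_ite, mul_one, mul_zero,
    Finset.sum_ite_eq, Finset.mem_univ, if_true]

lemma dualBase_vec (i : Fin m) (a : Fin 13) : F.dualBase i (F.vec a) = 0 := by
  simp only [vec, map_sum, map_smul, smul_eq_mul, F.dualBase_arc, mul_zero, Finset.sum_const_zero]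

lemma dualBase_gen (i : Fin m) (t : Fin 13 ⊕ Fin m) :
    F.dualBase i (F.gen t) = if t = Sum.inr i then 1 else 0 := by
  cases t with
  | inl a => simp [gen, F.dualBase_vec]
  | inr j => simp [gen, F.dualBase_base, eq_comm]

/-- A line forgets the sign of its generator, so distinct intervals must differ up to sign to give
distinct lines. -/
lemma arcCoeff_injective_up_to_sign : ∀ a b : Fin 13,
    (∀ k, arcCoeff a k = arcCoeff b k) ∨ (∀ k, -arcCoeff a k = arcCoeff b k) → a = b := by
  decide

lemma exists_arcCoeff_eq_one : ∀ a : Fin 13, ∃ k, arcCoeff a k = 1 := by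
  decide

lemma span_eq_iff_sign {x y : Fin N → ℤ} (h : Submodule.span ℤ {x} = Submodule.span ℤ {y}) :
    y = x ∨ y = -x := by
  rw [Submodule.span_singleton_eq_span_singleton] at h
  obtain ⟨u, rfl⟩ := h
  rcases Int.units_eq_one_or u with rfl | rfl
  · left; simp
  · right; simp

lemma gen_injective : Function.Injective fun t => Submodule.span ℤ {F.gen t} := by
  intro s t h
  have h1 := span_eq_iff_sign h
  rcases s with a | i
  · rcases t with b | j
    · congr 1
      refine arcCoeff_injective_up_to_sign a b (h1.imp (fun h k => ?_) fun h k => ?_)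
      · have := congrArg (F.dualArc k) h
        simpa [gen, F.dualArc_vec] using this.symm
      · have := congrArg (F.dualArc k) h
        simpa [gen, F.dualArc_vec] using this.symm
    · exfalso
      rcases h1 with h1 | h1 <;> have := congrArg (F.dualBase j) h1 <;>
        simp [F.dualBase_gen] at this
  · by_contra hne
    rcases h1 with h1 | h1 <;> have := congrArg (F.dualBase i) h1 <;>
        simp [F.dualBase_gen, Ne.symm hne] at this

lemma line_injective : Function.Injective F.line := fun a b h =>
  Sum.inl_injective (F.gen_injective (a₁ := Sum.inl a) (a₂ := Sum.inl b) h)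

lemma gen_mem_lines (t : Fin 13 ⊕ Fin m) : Submodule.span ℤ {F.gen t} ∈ lines N := by
  cases t with
  | inl a =>
    obtain ⟨k, hk⟩ := exists_arcCoeff_eq_one a
    exact mem_lines_of_dual (F.dualArc k) ((F.dualArc_vec k a).trans hk)
  | inr i => exact mem_lines_of_dual (F.dualBase i) (by simp [F.dualBase_gen])

lemma mem_simplex {τ : Finset (Fin 12)} {L : Submodule ℤ (Fin N → ℤ)} :
    L ∈ F.simplex τ ↔ (∃ a ∈ withTop τ, L = F.line a) ∨
      ∃ i, L = Submodule.span ℤ {F.base i} := by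
  simp [simplex, baseLines, eq_comm]

lemma exists_gen_of_mem_simplex {τ : Finset (Fin 12)} {L : Submodule ℤ (Fin N → ℤ)}
    (h : L ∈ F.simplex τ) : ∃ t : Fin 13 ⊕ Fin m, L = Submodule.span ℤ {F.gen t} ∧
      ∀ a, t = Sum.inl a → a ∈ withTop τ := by
  rcases F.mem_simplex.1 h with ⟨a, ha, rfl⟩ | ⟨i, rfl⟩
  · exact ⟨Sum.inl a, rfl, fun b hb => Sum.inl_injective hb ▸ ha⟩
  · exact ⟨Sum.inr i, rfl, fun b hb => by cases hb⟩

lemma simplex_subset_lines (τ : Finset (Fin 12)) :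
    (F.simplex τ : Set (Submodule ℤ (Fin N → ℤ))) ⊆ lines N := by
  intro L hL
  obtain ⟨t, rfl, -⟩ := F.exists_gen_of_mem_simplex hL
  exact F.gen_mem_lines t

lemma disjoint_baseLines (s : Finset (Fin 13)) : Disjoint (s.image F.line) F.baseLines := by
  rw [Finset.disjoint_left]
  intro L hL hL'
  obtain ⟨a, -, rfl⟩ := Finset.mem_image.1 hL
  obtain ⟨i, -, hi⟩ := Finset.mem_image.1 hL'
  have := F.gen_injective (a₁ := Sum.inr i) (a₂ := Sum.inl a) hi
  cases this

lemma card_withTop (τ : Finset (Fin 12)) : (withTop τ).card = τ.card + 1 := by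
  rw [withTop, Finset.card_insert_of_notMem, Finset.card_map]
  simp only [Finset.mem_map, not_exists, not_and]
  rintro a - h
  have := congrArg Fin.val h
  simp at this
  omega

lemma card_simplex (τ : Finset (Fin 12)) : (F.simplex τ).card = τ.card + 1 + m := by
  rw [simplex, Finset.card_union_of_disjoint (F.disjoint_baseLines _),
    Finset.card_image_of_injective _ F.line_injective, card_withTop, baseLines,
    Finset.card_image_of_injective, Finset.card_univ, Fintype.card_fin]
  intro i j h
  exact Sum.inr_injective (F.gen_injective (a₁ := Sum.inr i) (a₂ := Sum.inr j) h)

/-- The division points of the circle, as partial sums of the arcs. -/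
def point (i : Fin 4) : Fin N → ℤ := ∑ k, if k < i then F.arc k else 0

/-- Two points bound two complementary intervals, so modulo the whole circle an interval is an edge
between its endpoints. This brings in the rank of a graph. -/
lemma vec_eq_point (a : Fin 12) : F.vec a.castSucc = F.point (tgt a) - F.point (src a) ∨
    F.vec a.castSucc = F.vec 12 - (F.point (tgt a) - F.point (src a)) := by
  have key : (∀ k, arcCoeff a.castSucc k = (if k < tgt a then 1 else 0) - if k < src a then 1 else 0)
      ∨ ∀ k, arcCoeff a.castSucc k =
        arcCoeff 12 k - ((if k < tgt a then 1 else 0) - if k < src a then 1 else 0) := by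
    revert a; decide
  have hp : ∀ i, F.point i = ∑ k, (if k < i then (1 : ℤ) else 0) • F.arc k := by
    intro i
    refine Finset.sum_congr rfl fun k _ => ?_
    split_ifs <;> simp
  refine key.imp (fun h => ?_) fun h => ?_
  · rw [hp, hp, ← Finset.sum_sub_distrib, vec]
    refine Finset.sum_congr rfl fun k _ => ?_
    rw [h k, sub_smul]
  · rw [hp, hp, ← Finset.sum_sub_distrib, vec, vec, ← Finset.sum_sub_distrib]
    refine Finset.sum_congr rfl fun k _ => ?_
    rw [h k, sub_smul, sub_smul]

lemma dualArc_point (k i : Fin 4) : F.dualArc k (F.point i) = if k < i then 1 else 0 := by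
  rw [point, map_sum, Finset.sum_eq_single k]
  · split_ifs <;> simp [F.dualArc_arc]
  · intro l _ hl
    split_ifs
    · rw [F.dualArc_arc, if_neg hl.symm]
    · simp
  · simp

lemma dualBase_point (j : Fin m) (i : Fin 4) : F.dualBase j (F.point i) = 0 := by
  rw [point, map_sum]
  refine Finset.sum_eq_zero fun k _ => ?_
  split_ifs
  · exact F.dualBase_arc j k
  · simp

/-- The functional that measures the coefficient of a division point. -/
noncomputable def dualPoint (i : Fin 4) : (Fin N → ℤ) →ₗ[ℤ] ℤ := F.dualArc (i - 1) - F.dualArc i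

/-- For `i = 0` the index `i - 1` wraps around to `3`, and the functional takes the value `-1` on
all other points instead of `0`. The constant `-1` cancels in differences. -/
lemma dualPoint_sub (i j l : Fin 4) : F.dualPoint i (F.point j - F.point l) =
    (if i = j then 1 else 0) - if i = l then 1 else 0 := by
  simp only [dualPoint, LinearMap.sub_apply, map_sub, F.dualArc_point]
  revert i j l
  decide

lemma dualPoint_top (i : Fin 4) : F.dualPoint i (F.vec 12) = 0 := by
  simp only [dualPoint, LinearMap.sub_apply, F.dualArc_vec]
  revert i
  decide

/-- The rank of the span of a simplex, in terms of the connected components. -/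
lemma simplex_sup (τ : Finset (Fin 12)) (rep : Fin 4 → Fin 4)
    (h₁ : ∀ a ∈ τ, rep (src a) = rep (tgt a)) (h₂ : ∀ i, rep (rep i) = rep i)
    (h₃ : ∀ i, ∃ k l, Joined τ i k ∧ Joined τ k l ∧ Joined τ l (rep i)) :
    IsComplemented ((F.simplex τ).sup id) ∧
      Module.finrank ℤ ((F.simplex τ).sup id : Submodule ℤ (Fin N → ℤ)) =
        (Finset.univ.filter fun i => rep i ≠ i).card + 1 + m := by
  -- A basis of the span: a spanning star in each component of the graph, the whole circle, and the
  -- base. The functional `F.dualArc 3` is dual to the circle because it kills all division points.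
  let b : {i : Fin 4 // rep i ≠ i} ⊕ (Unit ⊕ Fin m) → Fin N → ℤ :=
    Sum.elim (fun i => F.point i - F.point (rep i)) (Sum.elim (fun _ => F.vec 12) F.base)
  let D : {i : Fin 4 // rep i ≠ i} ⊕ (Unit ⊕ Fin m) → (Fin N → ℤ) →ₗ[ℤ] ℤ :=
    Sum.elim (fun i => F.dualPoint i) (Sum.elim (fun _ => F.dualArc 3) F.dualBase)
  have hlast : ∀ i : Fin 4, ¬ 3 < i := by decide
  have hD : ∀ s t, D s (b t) = if s = t then 1 else 0 := by
    rintro (⟨i, hi⟩ | s | s) (⟨j, hj⟩ | t | t)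
    · have h : i ≠ rep j := fun h => hi (by rw [h, h₂])
      simp [D, b, F.dualPoint_sub, h]
    · simp [D, b, F.dualPoint_top]
    · simp [D, b, dualPoint, F.dualArc_base]
    · simp [D, b, F.dualArc_point, hlast]
    · simp [D, b, F.dualArc_vec, arcCoeff]
    · simp [D, b, F.dualArc_base]
    · simp [D, b, F.dualBase_point]
    · simp [D, b, F.dualBase_vec]
    · simp [D, b, F.dualBase_base]
  have hspan : (F.simplex τ).sup id = Submodule.span ℤ (Set.range b) := by
    have hP : ∀ t, b t ∈ Submodule.span ℤ (Set.range b) := fun t => Submodule.subset_span ⟨t, rfl⟩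
    refine le_antisymm (Finset.sup_le fun L hL => ?_) (Submodule.span_le.2 ?_)
    · have hpt : ∀ i, F.point i - F.point (rep i) ∈ Submodule.span ℤ (Set.range b) := by
        intro i
        by_cases hi : rep i = i
        · rw [hi, sub_self]
          exact zero_mem _
        · exact hP (Sum.inl ⟨i, hi⟩)
      have htop : F.vec 12 ∈ Submodule.span ℤ (Set.range b) := hP (Sum.inr (Sum.inl ()))
      rcases F.mem_simplex.1 hL with ⟨a, ha, rfl⟩ | ⟨i, rfl⟩
      · rw [id, line, Submodule.span_singleton_le_iff_mem]
        rcases Finset.mem_insert.1 ha with rfl | ha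
        · exact htop
        obtain ⟨a, haτ, rfl⟩ := Finset.mem_map.1 ha
        -- Both endpoints of an edge have the same representative, which cancels in the difference.
        have h4 : F.point (tgt a) - F.point (src a) ∈ Submodule.span ℤ (Set.range b) := by
          have := sub_mem (hpt (tgt a)) (hpt (src a))
          rwa [h₁ a haτ, sub_sub_sub_cancel_right] at this
        rcases F.vec_eq_point a with h | h
        · exact (congrArg (· ∈ Submodule.span ℤ (Set.range b)) h).mpr h4
        · exact (congrArg (· ∈ Submodule.span ℤ (Set.range b)) h).mpr (sub_mem htop h4)
      · rw [id, Submodule.span_singleton_le_iff_mem]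
        exact hP (Sum.inr (Sum.inr i))
    · have hline : ∀ a ∈ withTop τ, F.vec a ∈ (F.simplex τ).sup id := fun a ha =>
        (Submodule.span_singleton_le_iff_mem _ _).1
          (Finset.le_sup (f := id) (F.mem_simplex.2 (Or.inl ⟨a, ha, rfl⟩)))
      have htop : F.vec 12 ∈ (F.simplex τ).sup id := hline 12 (Finset.mem_insert_self _ _)
      have hJ : ∀ i j, Joined τ i j → F.point i - F.point j ∈ (F.simplex τ).sup id := by
        have h4 : ∀ a ∈ τ, F.point (tgt a) - F.point (src a) ∈ (F.simplex τ).sup id := by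
          intro a ha
          have h5 := hline a.castSucc (Finset.mem_insert_of_mem
            (Finset.mem_map.2 ⟨a, ha, rfl⟩))
          rcases F.vec_eq_point a with h | h
          · rwa [h] at h5
          · have := sub_mem htop h5
            rwa [h, sub_sub_cancel] at this
        rintro i j (rfl | ⟨a, ha, ⟨rfl, rfl⟩ | ⟨rfl, rfl⟩⟩)
        · rw [sub_self]
          exact zero_mem _
        · rw [← neg_sub]
          exact neg_mem (h4 a ha)
        · exact h4 a ha
      rintro _ ⟨⟨i, hi⟩ | t | t, rfl⟩
      -- The difference to the representative telescopes along a path of at most three edges.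
      · obtain ⟨k, l, hk, hl, hr⟩ := h₃ i
        have := add_mem (add_mem (hJ _ _ hk) (hJ _ _ hl)) (hJ _ _ hr)
        rwa [sub_add_sub_cancel, sub_add_sub_cancel] at this
      · exact htop
      · exact (Submodule.span_singleton_le_iff_mem _ _).1
          (Finset.le_sup (f := id) (F.mem_simplex.2 (Or.inr ⟨t, rfl⟩)))
  obtain ⟨h4, h5⟩ := isComplemented_of_dual b D hD
  rw [hspan]
  refine ⟨h4, h5.trans ?_⟩
  rw [Fintype.card_sum, Fintype.card_sum, Fintype.card_subtype, Fintype.card_unit,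
    Fintype.card_fin, add_assoc]

end Frame

end Frame

end BAAComplex

/-! ### Completeness of the lists of additive relations. -/

namespace BAAComplex

section Relations

/-- The pairs of the mask and of the decimal code of the coefficients of the intervals. -/
def arcCodes : List (ℕ × ℕ) :=
  [(1, 1), (2, 10), (4, 100), (8, 11), (16, 110), (32, 111), (64, 1110), (128, 1101), (256, 1011),
    (512, 1100), (1024, 1001), (2048, 1000), (4096, 1111)]

/-- The coefficients are `0` or `1` and at most three intervals are added, so no carries occur and
an equation of codes amounts to one of vectors. -/
def arcCode (a : Fin 13) : ℕ :=
  (arcCoeff a 0 + 10 * arcCoeff a 1 + 100 * arcCoeff a 2 + 1000 * arcCoeff a 3).toNat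

lemma mem_arcCodes : ∀ a : Fin 13, (2 ^ a.1, arcCode a) ∈ arcCodes ∧
    (arcCode a : ℤ) =
      arcCoeff a 0 + 10 * arcCoeff a 1 + 100 * arcCoeff a 2 + 1000 * arcCoeff a 3 := by
  decide

lemma triMasks_complete : (arcCodes.all fun p => arcCodes.all fun q => arcCodes.all fun r =>
    !(Nat.beq p.2 (q.2 + r.2)) || triMasks.any (Nat.beq (Nat.lor p.1 (Nat.lor q.1 r.1)))) =
      true := by
  decide +kernel

lemma quadMasks_complete_one_three : (arcCodes.all fun p => arcCodes.all fun q =>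
    arcCodes.all fun r => !(Nat.ble (q.2 + r.2) p.2) || arcCodes.all fun s =>
      !(Nat.beq p.2 (q.2 + r.2 + s.2)) ||
        quadMasks.any (Nat.beq (Nat.lor p.1 (Nat.lor q.1 (Nat.lor r.1 s.1))))) = true := by
  decide +kernel

/-- By symmetry only `p < q` is tested, and the trivial solutions `{p, q} = {r, s}` are left out. -/
lemma quadMasks_complete_two_two : (arcCodes.all fun p => arcCodes.all fun q =>
    Nat.ble q.2 p.2 || arcCodes.all fun r => !(Nat.ble r.2 (p.2 + q.2)) ||
      Nat.beq r.2 p.2 || Nat.beq r.2 q.2 || arcCodes.all fun s =>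
        !(Nat.beq (p.2 + q.2) (r.2 + s.2)) ||
          quadMasks.any (Nat.beq (Nat.lor p.1 (Nat.lor q.1 (Nat.lor r.1 s.1))))) = true := by
  decide +kernel

lemma arcCode_injective : ∀ a b : Fin 13, arcCode a = arcCode b → a = b := by
  decide

lemma exists_relsTwo_of_arcCode {a b c : Fin 13} (h : arcCode a = arcCode b + arcCode c) :
    ∃ r ∈ relsTwo, ({r.1, r.2.1, r.2.2} : Finset (Fin 13)) = {a, b, c} := by
  have h1 := triMasks_complete
  simp only [List.all_eq_true] at h1
  have h2 := h1 _ (mem_arcCodes a).1 _ (mem_arcCodes b).1 _ (mem_arcCodes c).1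
  simp only [Bool.or_eq_true, Bool.not_eq_true', ← Bool.not_eq_true, Nat.beq_eq, h,
    not_true_eq_false, false_or, List.any_eq_true, triMasks_eq, List.mem_map] at h2
  obtain ⟨_, ⟨r, hr, rfl⟩, h3⟩ := h2
  refine ⟨r, hr, ?_⟩
  rw [← bits_triMask, ← h3]
  exact bits_triMask (a, b, c)

lemma exists_relsThree_of_arcCode {a b c d : Fin 13}
    (h : arcCode a = arcCode b + arcCode c + arcCode d) :
    ∃ r ∈ relsThree, ({r.1, r.2.1, r.2.2.1, r.2.2.2} : Finset (Fin 13)) = {a, b, c, d} := by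
  have h1 := quadMasks_complete_one_three
  simp only [List.all_eq_true, Bool.or_eq_true, Bool.not_eq_true', ← Bool.not_eq_true, Nat.beq_eq,
    Nat.ble_eq] at h1
  have h2 := (h1 _ (mem_arcCodes a).1 _ (mem_arcCodes b).1 _ (mem_arcCodes c).1).resolve_left
    (not_not.2 (by simp only; omega)) _ (mem_arcCodes d).1
  simp only [Nat.beq_eq, h, not_true_eq_false, false_or, List.any_eq_true, quadMasks_eq,
    List.mem_map] at h2
  obtain ⟨_, ⟨r, hr, rfl⟩, h3⟩ := h2
  refine ⟨r, hr, ?_⟩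
  rw [← bits_quadMask, ← h3]
  exact bits_quadMask (a, b, c, d)

lemma exists_relsThree_of_arcCode' {a b c d : Fin 13} (hab : a ≠ b) (hca : c ≠ a) (hcb : c ≠ b)
    (h : arcCode a + arcCode b = arcCode c + arcCode d) :
    ∃ r ∈ relsThree, ({r.1, r.2.1, r.2.2.1, r.2.2.2} : Finset (Fin 13)) = {a, b, c, d} := by
  wlog hlt : arcCode a < arcCode b generalizing a b
  · obtain ⟨r, hr, h1⟩ := this hab.symm hcb hca (by omega) (lt_of_le_of_ne (not_lt.1 hlt)
      fun h => hab (arcCode_injective _ _ h.symm))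
    exact ⟨r, hr, h1.trans (Finset.insert_comm _ _ _)⟩
  have h1 := quadMasks_complete_two_two
  simp only [List.all_eq_true, Bool.or_eq_true, Bool.not_eq_true', ← Bool.not_eq_true, Nat.beq_eq,
    Nat.ble_eq] at h1
  have h2 := (((h1 _ (mem_arcCodes a).1 _ (mem_arcCodes b).1).resolve_left
    (by simp only; omega) _ (mem_arcCodes c).1).resolve_left (by
      have e1 : arcCode c ≠ arcCode a := fun h => hca (arcCode_injective _ _ h)
      have e2 : arcCode c ≠ arcCode b := fun h => hcb (arcCode_injective _ _ h)
      simp only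
      omega)) _ (mem_arcCodes d).1
  simp only [h, not_true_eq_false, false_or, List.any_eq_true, quadMasks_eq, Nat.beq_eq,
    List.mem_map] at h2
  obtain ⟨_, ⟨r, hr, rfl⟩, h3⟩ := h2
  refine ⟨r, hr, ?_⟩
  rw [← bits_quadMask, ← h3]
  exact bits_quadMask (a, b, c, d)

lemma relsTwo_arcCoeff : ∀ r ∈ relsTwo, ∀ k,
    arcCoeff r.1 k = arcCoeff r.2.1 k + arcCoeff r.2.2 k := by
  have h : (relsTwo.all fun r => decide (∀ k,
    arcCoeff r.1 k = arcCoeff r.2.1 k + arcCoeff r.2.2 k)) = true := by decide +kernel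
  exact fun r hr => of_decide_eq_true (List.all_eq_true.1 h r hr)

lemma relsThree_arcCoeff : ∀ r ∈ relsThree,
    (∀ k, arcCoeff r.1 k = arcCoeff r.2.1 k + arcCoeff r.2.2.1 k + arcCoeff r.2.2.2 k) ∨
    ∀ k, arcCoeff r.1 k = -arcCoeff r.2.1 k + arcCoeff r.2.2.1 k + arcCoeff r.2.2.2 k := by
  have h : (relsThree.all fun r => decide (
    (∀ k, arcCoeff r.1 k = arcCoeff r.2.1 k + arcCoeff r.2.2.1 k + arcCoeff r.2.2.2 k) ∨
    ∀ k, arcCoeff r.1 k = -arcCoeff r.2.1 k + arcCoeff r.2.2.1 k + arcCoeff r.2.2.2 k)) = true := by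
    decide +kernel
  exact fun r hr => of_decide_eq_true (List.all_eq_true.1 h r hr)

/-- The arrangements of a triple, by the element in the second position. -/
def arrangements {α : Type*} (r : α × α × α) : List (α × α × α) :=
  [(r.1, r.2.1, r.2.2), (r.1, r.2.2, r.2.1), (r.2.1, r.1, r.2.2)]

/-- Two different relations are disjoint or share exactly one interval. The first case gives a
double-double simplex. In the second the relations are rearranged to have the shared interval as a
summand, which is the shape of a double-triple simplex. -/
lemma relsTwo_pair : ∀ r ∈ relsTwo, ∀ r' ∈ relsTwo, r ≠ r' →
    [r.1, r'.1, r.2.1, r.2.2, r'.2.1, r'.2.2].Nodup ∨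
    ∃ p ∈ arrangements r, ∃ p' ∈ arrangements r', p.2.1 = p'.2.1 ∧
      [p.1, p'.1, p.2.1, p.2.2, p'.2.2].Nodup := by
  have h : (relsTwo.all fun r => relsTwo.all fun r' => decide (r = r') ||
    (decide [r.1, r'.1, r.2.1, r.2.2, r'.2.1, r'.2.2].Nodup ||
    (arrangements r).any fun p => (arrangements r').any fun p' => decide (p.2.1 = p'.2.1) &&
      decide [p.1, p'.1, p.2.1, p.2.2, p'.2.2].Nodup)) = true := by decide +kernel
  intro r hr r' hr' hne
  have h1 := List.all_eq_true.1 (List.all_eq_true.1 h r hr) r' hr'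
  simpa only [Bool.or_eq_true, decide_eq_true_eq, hne, false_or, List.any_eq_true,
    Bool.and_eq_true] using h1

end Relations

end BAAComplex

/-! ### The five types of simplices in terms of intervals. -/

namespace BAAComplex

section Frame

variable {N m : ℕ}

namespace Frame

variable (F : Frame N m)

lemma arcCode_pos : ∀ a : Fin 13, 0 < arcCode a := by decide

/-- A line of a simplex is spanned by exactly one vector of the frame, up to sign. -/
lemma eq_sign_gen {x : Fin N → ℤ} {t : Fin 13 ⊕ Fin m}
    (h : Submodule.span ℤ {x} = Submodule.span ℤ {F.gen t}) :
    ∃ s : ℤ, (s = 1 ∨ s = -1) ∧ x = s • F.gen t := by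
  rcases span_eq_iff_sign h.symm with h | h
  · exact ⟨1, Or.inl rfl, by simp [h]⟩
  · exact ⟨-1, Or.inr rfl, by simp [h]⟩

/-- The functional whose values on the intervals are their decimal codes. -/
noncomputable def code : (Fin N → ℤ) →ₗ[ℤ] ℤ :=
  F.dualArc 0 + (10 : ℤ) • F.dualArc 1 + (100 : ℤ) • F.dualArc 2 + (1000 : ℤ) • F.dualArc 3

lemma code_vec (a : Fin 13) : F.code (F.vec a) = arcCode a := by
  rw [(mem_arcCodes a).2]
  simp [code, F.dualArc_vec]

/-- No base line takes part, since its dual functional sees a single coefficient `±1` and nothing to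
cancel it. For the intervals the code turns the relation into a signed equation of positive
integers. -/
lemma exists_relsTwo {τ : Finset (Fin 12)} {L₀ L₁ L₂ : Submodule ℤ (Fin N → ℤ)}
    (hd : [L₀, L₁, L₂].Nodup) (hm : {L₀, L₁, L₂} ⊆ F.simplex τ) (h : IsSumTwo L₀ L₁ L₂) :
    ∃ r ∈ relsTwo, ContainsTwo τ r ∧
      Finset.image F.line {r.1, r.2.1, r.2.2} = {L₀, L₁, L₂} := by
  obtain ⟨x₁, x₂, h₁, h₂, h₀⟩ := h
  simp only [Finset.insert_subset_iff, Finset.singleton_subset_iff] at hm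
  obtain ⟨t₀, e₀, m₀⟩ := F.exists_gen_of_mem_simplex hm.1
  obtain ⟨t₁, e₁, m₁⟩ := F.exists_gen_of_mem_simplex hm.2.1
  obtain ⟨t₂, e₂, m₂⟩ := F.exists_gen_of_mem_simplex hm.2.2
  obtain ⟨s₁, hs₁, rfl⟩ := F.eq_sign_gen (h₁.symm.trans e₁)
  obtain ⟨s₂, hs₂, rfl⟩ := F.eq_sign_gen (h₂.symm.trans e₂)
  obtain ⟨s₀, hs₀, hx⟩ := F.eq_sign_gen (h₀.symm.trans e₀)
  simp only [List.nodup_cons, List.mem_cons, List.not_mem_nil, or_false, not_or] at hd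
  have n₀₁ : t₀ ≠ t₁ := fun h => hd.1.1 (by rw [e₀, e₁, h])
  have n₀₂ : t₀ ≠ t₂ := fun h => hd.1.2 (by rw [e₀, e₂, h])
  have n₁₂ : t₁ ≠ t₂ := fun h => hd.2.1 (by rw [e₁, e₂, h])
  have hb : ∀ i, s₁ * (if t₁ = Sum.inr i then 1 else 0) + s₂ * (if t₂ = Sum.inr i then 1 else 0) =
      s₀ * if t₀ = Sum.inr i then 1 else 0 := by
    intro i
    simpa only [map_add, map_smul, smul_eq_mul, F.dualBase_gen] using congrArg (F.dualBase i) hx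
  rcases t₀ with a₀ | i
  swap
  · have := hb i
    simp only [n₀₁.symm, n₀₂.symm, if_true, if_false] at this
    omega
  rcases t₁ with a₁ | i
  swap
  · have := hb i
    simp only [n₁₂.symm, if_true, if_false, reduceCtorEq] at this
    omega
  rcases t₂ with a₂ | i
  swap
  · have := hb i
    simp only [if_true, if_false, reduceCtorEq] at this
    omega
  have hc : s₁ * arcCode a₁ + s₂ * arcCode a₂ = s₀ * arcCode a₀ := by
    have := congrArg F.code hx
    simpa only [map_add, map_smul, smul_eq_mul, gen, Sum.elim_inl, F.code_vec] using this
  have hr : ∃ r ∈ relsTwo, ({r.1, r.2.1, r.2.2} : Finset (Fin 13)) = {a₀, a₁, a₂} := by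
    -- Positivity rules out equal signs on one side, so one code is the sum of the other two.
    have key : arcCode a₀ = arcCode a₁ + arcCode a₂ ∨ arcCode a₁ = arcCode a₀ + arcCode a₂ ∨
        arcCode a₂ = arcCode a₀ + arcCode a₁ := by
      have p₀ := arcCode_pos a₀
      rcases hs₀ with rfl | rfl <;> rcases hs₁ with rfl | rfl <;> rcases hs₂ with rfl | rfl <;>
        omega
    rcases key with key | key | key
    · exact exists_relsTwo_of_arcCode key
    · obtain ⟨r, hr, h⟩ := exists_relsTwo_of_arcCode key
      exact ⟨r, hr, h.trans (by grind)⟩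
    · obtain ⟨r, hr, h⟩ := exists_relsTwo_of_arcCode key
      exact ⟨r, hr, h.trans (by grind)⟩
  obtain ⟨r, hr, h⟩ := hr
  refine ⟨r, hr, ?_, ?_⟩
  · rw [ContainsTwo, h]
    simp only [Finset.insert_subset_iff, Finset.singleton_subset_iff]
    exact ⟨m₀ _ rfl, m₁ _ rfl, m₂ _ rfl⟩
  · rw [h, e₀, e₁, e₂]
    simp [Finset.image_insert, line, gen]

lemma exists_relsThree {τ : Finset (Fin 12)} {L₀ L₁ L₂ L₃ : Submodule ℤ (Fin N → ℤ)}
    (hd : [L₀, L₁, L₂, L₃].Nodup) (hm : {L₀, L₁, L₂, L₃} ⊆ F.simplex τ)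
    (h : IsSumThree L₀ L₁ L₂ L₃) : ∃ r ∈ relsThree, ContainsThree τ r := by
  obtain ⟨x₁, x₂, x₃, h₁, h₂, h₃, h₀⟩ := h
  simp only [Finset.insert_subset_iff, Finset.singleton_subset_iff] at hm
  obtain ⟨t₀, e₀, m₀⟩ := F.exists_gen_of_mem_simplex hm.1
  obtain ⟨t₁, e₁, m₁⟩ := F.exists_gen_of_mem_simplex hm.2.1
  obtain ⟨t₂, e₂, m₂⟩ := F.exists_gen_of_mem_simplex hm.2.2.1
  obtain ⟨t₃, e₃, m₃⟩ := F.exists_gen_of_mem_simplex hm.2.2.2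
  obtain ⟨s₁, hs₁, rfl⟩ := F.eq_sign_gen (h₁.symm.trans e₁)
  obtain ⟨s₂, hs₂, rfl⟩ := F.eq_sign_gen (h₂.symm.trans e₂)
  obtain ⟨s₃, hs₃, rfl⟩ := F.eq_sign_gen (h₃.symm.trans e₃)
  obtain ⟨s₀, hs₀, hx⟩ := F.eq_sign_gen (h₀.symm.trans e₀)
  simp only [List.nodup_cons, List.mem_cons, List.not_mem_nil, or_false, not_or] at hd
  have n₀₁ : t₀ ≠ t₁ := fun h => hd.1.1 (by rw [e₀, e₁, h])
  have n₀₂ : t₀ ≠ t₂ := fun h => hd.1.2.1 (by rw [e₀, e₂, h])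
  have n₀₃ : t₀ ≠ t₃ := fun h => hd.1.2.2 (by rw [e₀, e₃, h])
  have n₁₂ : t₁ ≠ t₂ := fun h => hd.2.1.1 (by rw [e₁, e₂, h])
  have n₁₃ : t₁ ≠ t₃ := fun h => hd.2.1.2 (by rw [e₁, e₃, h])
  have n₂₃ : t₂ ≠ t₃ := fun h => hd.2.2.1 (by rw [e₂, e₃, h])
  have hb : ∀ i, s₁ * (if t₁ = Sum.inr i then 1 else 0) + s₂ * (if t₂ = Sum.inr i then 1 else 0) +
      s₃ * (if t₃ = Sum.inr i then 1 else 0) = s₀ * if t₀ = Sum.inr i then 1 else 0 := by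
    intro i
    simpa only [map_add, map_smul, smul_eq_mul, F.dualBase_gen] using congrArg (F.dualBase i) hx
  rcases t₀ with a₀ | i
  swap
  · have := hb i
    simp only [n₀₁.symm, n₀₂.symm, n₀₃.symm, if_true, if_false] at this
    omega
  rcases t₁ with a₁ | i
  swap
  · have := hb i
    simp only [n₁₂.symm, n₁₃.symm, if_true, if_false, reduceCtorEq] at this
    omega
  rcases t₂ with a₂ | i
  swap
  · have := hb i
    simp only [n₂₃.symm, if_true, if_false, reduceCtorEq] at this
    omega
  rcases t₃ with a₃ | i
  swap
  · have := hb i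
    simp only [if_true, if_false, reduceCtorEq] at this
    omega
  have hc : s₁ * arcCode a₁ + s₂ * arcCode a₂ + s₃ * arcCode a₃ = s₀ * arcCode a₀ := by
    have := congrArg F.code hx
    simpa only [map_add, map_smul, smul_eq_mul, gen, Sum.elim_inl, F.code_vec] using this
  simp only [ne_eq, Sum.inl.injEq] at n₀₁ n₀₂ n₀₃ n₁₂ n₁₃ n₂₃
  have hr : ∃ r ∈ relsThree, ({r.1, r.2.1, r.2.2.1, r.2.2.2} : Finset (Fin 13)) =
      {a₀, a₁, a₂, a₃} := by
    -- By positivity the four codes split as one against three or as two against two.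
    have key : (arcCode a₀ = arcCode a₁ + arcCode a₂ + arcCode a₃ ∨
        arcCode a₁ = arcCode a₀ + arcCode a₂ + arcCode a₃ ∨
        arcCode a₂ = arcCode a₀ + arcCode a₁ + arcCode a₃ ∨
        arcCode a₃ = arcCode a₀ + arcCode a₁ + arcCode a₂) ∨
        arcCode a₀ + arcCode a₁ = arcCode a₂ + arcCode a₃ ∨
        arcCode a₀ + arcCode a₂ = arcCode a₁ + arcCode a₃ ∨
        arcCode a₀ + arcCode a₃ = arcCode a₁ + arcCode a₂ := by
      have p₀ := arcCode_pos a₀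
      rcases hs₀ with rfl | rfl <;> rcases hs₁ with rfl | rfl <;> rcases hs₂ with rfl | rfl <;>
        rcases hs₃ with rfl | rfl <;> omega
    rcases key with (key | key | key | key) | key | key | key
    · exact exists_relsThree_of_arcCode key
    · obtain ⟨r, hr, h⟩ := exists_relsThree_of_arcCode key
      exact ⟨r, hr, h.trans (by grind)⟩
    · obtain ⟨r, hr, h⟩ := exists_relsThree_of_arcCode key
      exact ⟨r, hr, h.trans (by grind)⟩
    · obtain ⟨r, hr, h⟩ := exists_relsThree_of_arcCode key
      exact ⟨r, hr, h.trans (by grind)⟩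
    · exact exists_relsThree_of_arcCode' n₀₁ (Ne.symm n₀₂) (Ne.symm n₁₂) key
    · obtain ⟨r, hr, h⟩ := exists_relsThree_of_arcCode' n₀₂ (Ne.symm n₀₁) n₁₂ key
      exact ⟨r, hr, h.trans (by grind)⟩
    · obtain ⟨r, hr, h⟩ := exists_relsThree_of_arcCode' n₀₃ (Ne.symm n₀₁) n₁₃ key
      exact ⟨r, hr, h.trans (by grind)⟩
  obtain ⟨r, hr, h⟩ := hr
  refine ⟨r, hr, ?_⟩
  rw [ContainsThree, h]
  simp only [Finset.insert_subset_iff, Finset.singleton_subset_iff]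
  exact ⟨m₀ _ rfl, m₁ _ rfl, m₂ _ rfl, m₃ _ rfl⟩

lemma isSumTwo_of_mem {r : Fin 13 × Fin 13 × Fin 13} (hr : r ∈ relsTwo) :
    IsSumTwo (F.line r.1) (F.line r.2.1) (F.line r.2.2) := by
  refine ⟨F.vec r.2.1, F.vec r.2.2, rfl, rfl, ?_⟩
  have : F.vec r.1 = F.vec r.2.1 + F.vec r.2.2 := by
    simp only [vec, ← Finset.sum_add_distrib, ← add_smul, ← relsTwo_arcCoeff r hr]
  rw [line, this]

lemma isSumTwo_of_mem_arrangements {r p : Fin 13 × Fin 13 × Fin 13} (hr : r ∈ relsTwo)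
    (hp : p ∈ arrangements r) : IsSumTwo (F.line p.1) (F.line p.2.1) (F.line p.2.2) := by
  have h := F.isSumTwo_of_mem hr
  simp only [arrangements, List.mem_cons, List.not_mem_nil, or_false] at hp
  rcases hp with rfl | rfl | rfl
  · exact h
  · exact h.symm
  · exact h.rotate

lemma isSumThree_of_mem {r : Fin 13 × Fin 13 × Fin 13 × Fin 13} (hr : r ∈ relsThree) :
    IsSumThree (F.line r.1) (F.line r.2.1) (F.line r.2.2.1) (F.line r.2.2.2) := by
  rcases relsThree_arcCoeff r hr with h | h
  · refine ⟨F.vec r.2.1, F.vec r.2.2.1, F.vec r.2.2.2, rfl, rfl, rfl, ?_⟩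
    have : F.vec r.1 = F.vec r.2.1 + F.vec r.2.2.1 + F.vec r.2.2.2 := by
      simp only [vec, ← Finset.sum_add_distrib, ← add_smul, ← h]
    rw [line, this]
  · refine ⟨-F.vec r.2.1, F.vec r.2.2.1, F.vec r.2.2.2, ?_, rfl, rfl, ?_⟩
    · rw [line, ← Set.neg_singleton, Submodule.span_neg]
    have : F.vec r.1 = -F.vec r.2.1 + F.vec r.2.2.1 + F.vec r.2.2.2 := by
      simp only [vec, ← Finset.sum_neg_distrib, ← neg_smul, ← Finset.sum_add_distrib, ← add_smul,
        ← h]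
    rw [line, this]

lemma nodup_map_line {l : List (Fin 13)} (h : l.Nodup) : (l.map F.line).Nodup :=
  h.map F.line_injective

/-- If the lines in `D` are redundant, then the span does not change when they are removed. -/
lemma sup_sdiff {σ D : Finset (Submodule ℤ (Fin N → ℤ))}
    (h : ∀ v ∈ D, v ≤ (σ \ D).sup id) : (σ \ D).sup id = σ.sup id := by
  refine le_antisymm (Finset.sup_mono Finset.sdiff_subset) (Finset.sup_le fun v hv => ?_)
  by_cases hvD : v ∈ D
  · exact h v hvD
  · exact Finset.le_sup (f := id) (Finset.mem_sdiff.2 ⟨hv, hvD⟩)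

/-- Deleting redundant lines keeps the span, which is a summand of rank `k + 1 + m`. What remains is
standard exactly if the number of lines, `τ.card + 1 + m - D.card`, equals this rank. -/
lemma isStandard_sdiff_iff {τ : Finset (Fin 12)} {k : ℕ}
    (hcomp : IsComplemented ((F.simplex τ).sup id))
    (hrank : Module.finrank ℤ ((F.simplex τ).sup id : Submodule ℤ (Fin N → ℤ)) = k + 1 + m)
    {D : Finset (Submodule ℤ (Fin N → ℤ))} (hD : D ⊆ F.simplex τ)
    (hv : ∀ v ∈ D, v ≤ (F.simplex τ \ D).sup id) :
    IsStandard (F.simplex τ \ D) ↔ τ.card = k + D.card := by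
  have hcard := F.card_simplex τ
  have h1 := Finset.card_sdiff_add_card_eq_card hD
  constructor
  · rintro ⟨-, h2, -⟩
    rw [sup_sdiff hv, hrank] at h2
    omega
  · intro h2
    refine ⟨fun y hy => F.simplex_subset_lines τ (Finset.sdiff_subset hy), ?_, ?_⟩
    · rw [sup_sdiff hv, hrank]
      omega
    · rw [sup_sdiff hv]
      exact hcomp

/-- Each type deletes zero, one or two redundant lines to reach a standard simplex, which fixes the
cardinality; its relations are among the listed ones. -/
lemma card_of_isBAASimplex {τ : Finset (Fin 12)} {k : ℕ}
    (hcomp : IsComplemented ((F.simplex τ).sup id))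
    (hrank : Module.finrank ℤ ((F.simplex τ).sup id : Submodule ℤ (Fin N → ℤ)) = k + 1 + m)
    (hσ : IsBAASimplex (F.simplex τ)) : τ.card = k ∨
      (τ.card = k + 1 ∧ ((∃ r ∈ relsTwo, ContainsTwo τ r) ∨ ∃ r ∈ relsThree, ContainsThree τ r)) ∨
      (τ.card = k + 2 ∧ ∃ r ∈ relsTwo, ContainsTwo τ r ∧ ∃ r' ∈ relsTwo, ContainsTwo τ r' ∧
        r ≠ r') := by
  have hrem := fun D => F.isStandard_sdiff_iff hcomp hrank (D := D)
  revert hσ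
  rintro (h | h | h | h | h)
  · left
    have := (hrem ∅ (Finset.empty_subset _) (by simp)).1 (by simpa using h)
    simpa using this
  · obtain ⟨-, v₀, v₁, v₂, hd, hm, hs, hst⟩ := h
    obtain ⟨r, hr, hr', -⟩ := F.exists_relsTwo hd hm hs
    refine Or.inr (Or.inl ⟨?_, Or.inl ⟨r, hr, hr'⟩⟩)
    have := (hrem {v₀} (by grind) fun v hv => ?_).1 hst
    · simpa using this
    · rw [Finset.mem_singleton] at hv
      subst hv
      exact hs.le_sup (by grind) (by grind)
  · obtain ⟨-, v₀, v₁, v₂, v₃, hd, hm, hs, hst⟩ := h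
    obtain ⟨r, hr, hr'⟩ := F.exists_relsThree hd hm hs
    refine Or.inr (Or.inl ⟨?_, Or.inr ⟨r, hr, hr'⟩⟩)
    have := (hrem {v₀} (by grind) fun v hv => ?_).1 hst
    · simpa using this
    · rw [Finset.mem_singleton] at hv
      subst hv
      exact hs.le_sup (by grind) (by grind) (by grind)
  · obtain ⟨-, v₀, v₁, v₂, v₃, v₄, hd, hm, hs, hs', hst⟩ := h
    obtain ⟨r, hr, hr1, hr2⟩ := F.exists_relsTwo (τ := τ) (by grind) (by grind) hs
    obtain ⟨r', hr', hr1', hr2'⟩ := F.exists_relsTwo (τ := τ) (by grind) (by grind) hs'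
    refine Or.inr (Or.inr ⟨?_, r, hr, hr1, r', hr', hr1', ?_⟩)
    · have := (hrem {v₀, v₁} (by grind) fun v hv => ?_).1 hst
      · rwa [Finset.card_pair (by grind)] at this
      · rw [Finset.mem_insert, Finset.mem_singleton] at hv
        rcases hv with rfl | rfl
        · exact hs.le_sup (by grind) (by grind)
        · exact hs'.le_sup (by grind) (by grind)
    -- The relations differ because `v₀` occurs in the first only.
    · rintro rfl
      rw [hr2] at hr2'
      have : v₀ ∈ ({v₁, v₂, v₄} : Finset (Submodule ℤ (Fin N → ℤ))) :=
        hr2' ▸ Finset.mem_insert_self _ _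
      grind
  · obtain ⟨-, v₀, v₁, v₂, v₃, v₄, v₅, hd, hm, hs, hs', hst⟩ := h
    obtain ⟨r, hr, hr1, hr2⟩ := F.exists_relsTwo (τ := τ) (by grind) (by grind) hs
    obtain ⟨r', hr', hr1', hr2'⟩ := F.exists_relsTwo (τ := τ) (by grind) (by grind) hs'
    refine Or.inr (Or.inr ⟨?_, r, hr, hr1, r', hr', hr1', ?_⟩)
    · have := (hrem {v₀, v₁} (by grind) fun v hv => ?_).1 hst
      · rwa [Finset.card_pair (by grind)] at this
      · rw [Finset.mem_insert, Finset.mem_singleton] at hv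
        rcases hv with rfl | rfl
        · exact hs.le_sup (by grind) (by grind)
        · exact hs'.le_sup (by grind) (by grind)
    · rintro rfl
      rw [hr2] at hr2'
      have : v₀ ∈ ({v₁, v₄, v₅} : Finset (Submodule ℤ (Fin N → ℤ))) :=
        hr2' ▸ Finset.mem_insert_self _ _
      grind

lemma isDoubleTriple_of_card {τ : Finset (Fin 12)} {k : ℕ}
    (hcomp : IsComplemented ((F.simplex τ).sup id))
    (hrank : Module.finrank ℤ ((F.simplex τ).sup id : Submodule ℤ (Fin N → ℤ)) = k + 1 + m)
    (h : τ.card = k + 2) {v₀ v₁ v₂ v₃ v₄ : Submodule ℤ (Fin N → ℤ)}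
    (hd : [v₀, v₁, v₂, v₃, v₄].Nodup) (m₀ : v₀ ∈ F.simplex τ) (m₁ : v₁ ∈ F.simplex τ)
    (m₂ : v₂ ∈ F.simplex τ) (m₃ : v₃ ∈ F.simplex τ) (m₄ : v₄ ∈ F.simplex τ)
    (hs : IsSumTwo v₀ v₂ v₃) (hs' : IsSumTwo v₁ v₂ v₄) : IsDoubleTriple (F.simplex τ) := by
  refine ⟨F.simplex_subset_lines τ, v₀, v₁, v₂, v₃, v₄, hd, by grind, hs, hs',
    (F.isStandard_sdiff_iff hcomp hrank (by grind) fun v hv => ?_).2 ?_⟩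
  · rw [Finset.mem_insert, Finset.mem_singleton] at hv
    rcases hv with rfl | rfl
    · exact hs.le_sup (by grind) (by grind)
    · exact hs'.le_sup (by grind) (by grind)
  · rw [Finset.card_pair (by grind)]
    exact h

lemma isDoubleDouble_of_card {τ : Finset (Fin 12)} {k : ℕ}
    (hcomp : IsComplemented ((F.simplex τ).sup id))
    (hrank : Module.finrank ℤ ((F.simplex τ).sup id : Submodule ℤ (Fin N → ℤ)) = k + 1 + m)
    (h : τ.card = k + 2) {v₀ v₁ v₂ v₃ v₄ v₅ : Submodule ℤ (Fin N → ℤ)}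
    (hd : [v₀, v₁, v₂, v₃, v₄, v₅].Nodup) (m₀ : v₀ ∈ F.simplex τ) (m₁ : v₁ ∈ F.simplex τ)
    (m₂ : v₂ ∈ F.simplex τ) (m₃ : v₃ ∈ F.simplex τ) (m₄ : v₄ ∈ F.simplex τ)
    (m₅ : v₅ ∈ F.simplex τ) (hs : IsSumTwo v₀ v₂ v₃) (hs' : IsSumTwo v₁ v₄ v₅) :
    IsDoubleDouble (F.simplex τ) := by
  refine ⟨F.simplex_subset_lines τ, v₀, v₁, v₂, v₃, v₄, v₅, hd, by grind, hs, hs',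
    (F.isStandard_sdiff_iff hcomp hrank (by grind) fun v hv => ?_).2 ?_⟩
  · rw [Finset.mem_insert, Finset.mem_singleton] at hv
    rcases hv with rfl | rfl
    · exact hs.le_sup (by grind) (by grind)
    · exact hs'.le_sup (by grind) (by grind)
  · rw [Finset.card_pair (by grind)]
    exact h

lemma isBAASimplex_of_two_relations {τ : Finset (Fin 12)} {k : ℕ}
    (hcomp : IsComplemented ((F.simplex τ).sup id))
    (hrank : Module.finrank ℤ ((F.simplex τ).sup id : Submodule ℤ (Fin N → ℤ)) = k + 1 + m)
    (h : τ.card = k + 2) {r r' : Fin 13 × Fin 13 × Fin 13} (hr : r ∈ relsTwo)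
    (hr1 : ContainsTwo τ r) (hr' : r' ∈ relsTwo) (hr1' : ContainsTwo τ r') (hne : r ≠ r') :
    IsBAASimplex (F.simplex τ) := by
  have hmem : ∀ a ∈ withTop τ, F.line a ∈ F.simplex τ := fun a ha =>
    F.mem_simplex.2 (Or.inl ⟨a, ha, rfl⟩)
  simp only [ContainsTwo, Finset.insert_subset_iff, Finset.singleton_subset_iff] at hr1 hr1'
  rcases relsTwo_pair r hr r' hr' hne with hnd | ⟨p, hp, p', hp', hpp, hnd⟩
  · right; right; right; right
    have hd := F.nodup_map_line hnd
    simp only [List.map_cons, List.map_nil] at hd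
    have m₀ := hmem _ hr1.1
    have m₁ := hmem _ hr1.2.1
    have m₂ := hmem _ hr1.2.2
    have m₀' := hmem _ hr1'.1
    have m₁' := hmem _ hr1'.2.1
    have m₂' := hmem _ hr1'.2.2
    have hs := F.isSumTwo_of_mem hr
    have hs' := F.isSumTwo_of_mem hr'
    exact F.isDoubleDouble_of_card hcomp hrank h hd m₀ m₀' m₁ m₂ m₁' m₂' hs hs'
  · right; right; right; left
    have hd := F.nodup_map_line hnd
    simp only [List.map_cons, List.map_nil] at hd
    have hs := F.isSumTwo_of_mem_arrangements hr hp
    have hs' := F.isSumTwo_of_mem_arrangements hr' hp'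
    rw [← hpp] at hs'
    have hm : ∀ q : Fin 13 × Fin 13 × Fin 13,
        (q.1 ∈ withTop τ ∧ q.2.1 ∈ withTop τ ∧ q.2.2 ∈ withTop τ) → ∀ p ∈ arrangements q,
        F.line p.1 ∈ F.simplex τ ∧ F.line p.2.1 ∈ F.simplex τ ∧ F.line p.2.2 ∈ F.simplex τ := by
      intro q hq p hp
      simp only [arrangements, List.mem_cons, List.not_mem_nil, or_false] at hp
      rcases hp with rfl | rfl | rfl
      · exact ⟨hmem _ hq.1, hmem _ hq.2.1, hmem _ hq.2.2⟩
      · exact ⟨hmem _ hq.1, hmem _ hq.2.2, hmem _ hq.2.1⟩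
      · exact ⟨hmem _ hq.2.1, hmem _ hq.1, hmem _ hq.2.2⟩
    obtain ⟨m₀, m₁, m₂⟩ := hm r hr1 p hp
    obtain ⟨m₀', -, m₂'⟩ := hm r' hr1' p' hp'
    exact F.isDoubleTriple_of_card hcomp hrank h hd m₀ m₀' m₁ m₂ m₂' hs hs'

lemma isBAASimplex_of_card {τ : Finset (Fin 12)} {k : ℕ}
    (hcomp : IsComplemented ((F.simplex τ).sup id))
    (hrank : Module.finrank ℤ ((F.simplex τ).sup id : Submodule ℤ (Fin N → ℤ)) = k + 1 + m)
    (hτ : τ.card = k ∨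
      (τ.card = k + 1 ∧ ((∃ r ∈ relsTwo, ContainsTwo τ r) ∨ ∃ r ∈ relsThree, ContainsThree τ r)) ∨
      (τ.card = k + 2 ∧ ∃ r ∈ relsTwo, ContainsTwo τ r ∧ ∃ r' ∈ relsTwo, ContainsTwo τ r' ∧
        r ≠ r')) :
    IsBAASimplex (F.simplex τ) := by
  have hl := F.simplex_subset_lines τ
  have hrem := fun D => F.isStandard_sdiff_iff hcomp hrank (D := D)
  have hmem : ∀ a ∈ withTop τ, F.line a ∈ F.simplex τ := fun a ha =>
    F.mem_simplex.2 (Or.inl ⟨a, ha, rfl⟩)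
  revert hτ
  rintro (h | ⟨h, ⟨r, hr, hr'⟩ | ⟨r, hr, hr'⟩⟩ | ⟨h, r, hr, hr1, r', hr', hr1', hne⟩)
  · left
    have := (hrem ∅ (Finset.empty_subset _) (by simp)).2 (by simpa using h)
    simpa using this
  · right; left
    have hd := F.nodup_map_line (relsTwo_nodup r hr)
    simp only [List.map_cons, List.map_nil] at hd
    simp only [ContainsTwo, Finset.insert_subset_iff, Finset.singleton_subset_iff] at hr'
    have m₀ := hmem _ hr'.1
    have m₁ := hmem _ hr'.2.1
    have m₂ := hmem _ hr'.2.2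
    have hs := F.isSumTwo_of_mem hr
    refine ⟨hl, _, _, _, hd, by grind, hs, (hrem _ (by grind) fun v hv => ?_).2 (by simpa using h)⟩
    rw [Finset.mem_singleton] at hv
    subst hv
    exact hs.le_sup (by grind) (by grind)
  · right; right; left
    have hd := F.nodup_map_line (relsThree_nodup r hr)
    simp only [List.map_cons, List.map_nil] at hd
    simp only [ContainsThree, Finset.insert_subset_iff, Finset.singleton_subset_iff] at hr'
    have m₀ := hmem _ hr'.1
    have m₁ := hmem _ hr'.2.1
    have m₂ := hmem _ hr'.2.2.1
    have m₃ := hmem _ hr'.2.2.2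
    have hs := F.isSumThree_of_mem hr
    refine ⟨hl, _, _, _, _, hd, by grind, hs,
      (hrem _ (by grind) fun v hv => ?_).2 (by simpa using h)⟩
    rw [Finset.mem_singleton] at hv
    subst hv
    exact hs.le_sup (by grind) (by grind) (by grind)
  · exact F.isBAASimplex_of_two_relations hcomp hrank h hr hr1 hr' hr1' hne

/-- The combinatorial description of the simplices. -/
theorem isBAASimplex_iff {f : ℕ} (hf : f < 2 ^ 12) :
    IsBAASimplex (F.simplex (bits 12 f)) ↔ isFaceMask f = true := by
  obtain ⟨rep, h1, h2, h3, h4⟩ := exists_partition f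
  obtain ⟨h5, h6⟩ := F.simplex_sup (bits 12 f) rep h1 h3 h4
  rw [isFaceMask_iff hf, ← h2]
  exact ⟨F.card_of_isBAASimplex h5 h6, F.isBAASimplex_of_card h5 h6⟩

end Frame

end Frame

end BAAComplex

/-! ### Last coordinates, and the frame of four points on a circle. -/

namespace BAAComplex

section LastCoord

variable {N : ℕ}

/-- The last coordinate as a linear map. -/
noncomputable def lastCoordLinear (N : ℕ) : (Fin N → ℤ) →ₗ[ℤ] ℤ :=
  if h : 0 < N then LinearMap.proj ⟨N - 1, Nat.sub_lt h Nat.one_pos⟩ else 0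

lemma lastCoordLinear_apply (x : Fin N → ℤ) : lastCoordLinear N x = lastCoord x := by
  unfold lastCoordLinear lastCoord
  split_ifs <;> rfl

lemma lastCoord_add (x y : Fin N → ℤ) : lastCoord (x + y) = lastCoord x + lastCoord y := by
  simp only [← lastCoordLinear_apply, map_add]

lemma lastCoord_sub (x y : Fin N → ℤ) : lastCoord (x - y) = lastCoord x - lastCoord y := by
  simp only [← lastCoordLinear_apply, map_sub]

lemma lastCoord_smul (c : ℤ) (x : Fin N → ℤ) : lastCoord (c • x) = c * lastCoord x := by
  simp only [← lastCoordLinear_apply, map_smul, smul_eq_mul]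

lemma lastCoord_neg (x : Fin N → ℤ) : lastCoord (-x) = -lastCoord x := by
  simp only [← lastCoordLinear_apply, map_neg]

end LastCoord

namespace Frame

section OfPoints

variable {N m : ℕ}

/-- The frame of four points of a circle. -/
noncomputable def ofPoints (x : Fin 4 → Fin N → ℤ) (w : Fin N → ℤ) (e : Fin m → Fin N → ℤ)
    (X : Fin 4 → (Fin N → ℤ) →ₗ[ℤ] ℤ) (W : (Fin N → ℤ) →ₗ[ℤ] ℤ)
    (B : Fin m → (Fin N → ℤ) →ₗ[ℤ] ℤ)
    (hX : ∀ i j l, X i (x j - x l) = (if i = j then 1 else 0) - if i = l then 1 else 0)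
    (hXw : ∀ i, X i w = 0) (hXe : ∀ i j, X i (e j) = 0)
    (hW : ∀ j l, W (x j - x l) = 0) (hWw : W w = 1) (hWe : ∀ j, W (e j) = 0)
    (hB : ∀ i j l, B i (x j - x l) = 0) (hBw : ∀ i, B i w = 0)
    (hBe : ∀ i j, B i (e j) = if i = j then 1 else 0) : Frame N m where
  arc := ![x 1 - x 0, x 2 - x 1, x 3 - x 2, w - (x 3 - x 0)]
  base := e
  -- Up to a constant, the sum of the `X i` with `i > k` is `1` on the points after arc `k` and `0`
  -- on the others, so among the first three arcs it detects arc `k`. On the last arc its value `-1`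
  -- is cancelled by `W`.
  dualArc := ![X 1 + X 2 + X 3 + W, X 2 + X 3 + W, X 3 + W, W]
  dualBase := B
  dualArc_arc := by
    have h : ∀ φ : (Fin N → ℤ) →ₗ[ℤ] ℤ, φ (w - (x 3 - x 0)) = φ w - φ (x 3 - x 0) :=
      fun φ => φ.map_sub _ _
    intro i j
    fin_cases i <;> fin_cases j <;> simp [-map_sub, hX, hXw, hW, hWw, h]
  dualArc_base := by
    intro i j
    fin_cases i <;> simp [hXe, hWe]
  dualBase_arc := by
    have h : ∀ φ : (Fin N → ℤ) →ₗ[ℤ] ℤ, φ (w - (x 3 - x 0)) = φ w - φ (x 3 - x 0) :=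
      fun φ => φ.map_sub _ _
    intro i j
    fin_cases j <;> simp [-map_sub, hB, hBw, h]
  dualBase_base := hBe

end OfPoints

section LastCoord

variable {N m : ℕ} (F : Frame N m)

lemma lastCoord_vec (a : Fin 13) :
    lastCoord (F.vec a) = ∑ k, arcCoeff a k * lastCoord (F.arc k) := by
  simp only [vec, ← lastCoordLinear_apply, map_sum, map_smul, smul_eq_mul]

lemma exists_vec_eq {i j : Fin 4} (h : i < j) :
    (∃ a : Fin 12, F.vec a.castSucc = F.point j - F.point i) ∧
      ∃ a : Fin 12, F.vec a.castSucc = F.vec 12 - (F.point j - F.point i) := by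
  have key : (∃ a : Fin 12, ∀ k, arcCoeff a.castSucc k =
        (if k < j then 1 else 0) - if k < i then 1 else 0) ∧
      ∃ a : Fin 12, ∀ k, arcCoeff a.castSucc k =
        arcCoeff 12 k - ((if k < j then 1 else 0) - if k < i then 1 else 0) := by
    revert i j; decide
  have hp : ∀ i, F.point i = ∑ k, (if k < i then (1 : ℤ) else 0) • F.arc k := by
    intro i
    refine Finset.sum_congr rfl fun k _ => ?_
    split_ifs <;> simp
  refine key.imp (fun ⟨a, h⟩ => ⟨a, ?_⟩) fun ⟨a, h⟩ => ⟨a, ?_⟩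
  · rw [hp, hp, ← Finset.sum_sub_distrib, vec]
    refine Finset.sum_congr rfl fun k _ => ?_
    rw [h k, sub_smul]
  · rw [hp, hp, ← Finset.sum_sub_distrib, vec, vec, ← Finset.sum_sub_distrib]
    refine Finset.sum_congr rfl fun k _ => ?_
    rw [h k, sub_smul, sub_smul]

lemma src_lt_tgt : ∀ a, src a < tgt a := by decide

/-- The difference is a sum of arcs among the first three, and the last arc makes up a positive part
of the circle. -/
lemma lastCoord_point_sub (h₀ : ∀ k, 0 ≤ lastCoord (F.arc k)) (h₁ : 0 < lastCoord (F.arc 3))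
    {i j : Fin 4} (h : i < j) :
    0 ≤ lastCoord (F.point j - F.point i) ∧
      lastCoord (F.point j - F.point i) < lastCoord (F.vec 12) := by
  have hp : ∀ i, lastCoord (F.point i) = ∑ k, if k < i then lastCoord (F.arc k) else 0 := by
    intro i
    simp only [point, ← lastCoordLinear_apply, map_sum]
    refine Finset.sum_congr rfl fun k _ => ?_
    split_ifs <;> simp
  have a0 := h₀ 0
  have a1 := h₀ 1
  have a2 := h₀ 2
  rw [lastCoord_sub, hp, hp, lastCoord_vec]
  simp only [Fin.sum_univ_four]
  generalize lastCoord (F.arc 0) = q0 at *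
  generalize lastCoord (F.arc 1) = q1 at *
  generalize lastCoord (F.arc 2) = q2 at *
  generalize lastCoord (F.arc 3) = q3 at *
  fin_cases i <;> fin_cases j <;> simp [arcCoeff] at h ⊢ <;> omega

end LastCoord

end Frame

end BAAComplex

/-! ### The vertices and simplices of `Q` in a frame. -/

namespace BAAComplex

namespace Frame

section Vertices

variable {N m : ℕ} (F : Frame N m)

lemma abs_lastCoord_eq_of_span_eq {x y : Fin N → ℤ}
    (h : Submodule.span ℤ {x} = Submodule.span ℤ {y}) : |lastCoord x| = |lastCoord y| := by
  rcases span_eq_iff_sign h with rfl | rfl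
  · rfl
  · rw [lastCoord_neg, abs_neg]

lemma span_neg_singleton (x : Fin N → ℤ) : Submodule.span ℤ {-x} = Submodule.span ℤ {x} := by
  rw [← Set.neg_singleton, Submodule.span_neg]

/-- The lines of the intervals are the lines of differences of division points, modulo the top
vector, whose last coordinate is small. -/
lemma exists_line_iff (h₀ : ∀ k, 0 ≤ lastCoord (F.arc k)) (h₁ : 0 < lastCoord (F.arc 3))
    (L : Submodule ℤ (Fin N → ℤ)) :
    ((∃ (c : ℤ) (i j : Fin 4), i < j ∧
        L = Submodule.span ℤ {F.point j - F.point i + c • F.vec 12}) ∧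
      ∃ x, L = Submodule.span ℤ {x} ∧ |lastCoord x| < lastCoord (F.vec 12)) ↔
    ∃ a : Fin 12, lastCoord (F.vec a.castSucc) < lastCoord (F.vec 12) ∧
      L = F.line a.castSucc := by
  constructor
  · rintro ⟨⟨c, i, j, hij, rfl⟩, x, hx, hlt⟩
    rw [← abs_lastCoord_eq_of_span_eq hx, lastCoord_add, lastCoord_smul] at hlt
    obtain ⟨hp, hpR⟩ := F.lastCoord_point_sub h₀ h₁ hij
    obtain ⟨⟨a, ha⟩, ⟨b, hb⟩⟩ := F.exists_vec_eq hij
    rw [abs_lt] at hlt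
    -- With `p` in `[0, R)`, the condition `|p + c * R| < R` excludes `c ≥ 1` and `c ≤ -2`.
    have hc : c < 1 := by
      by_contra hc
      nlinarith
    have hc' : -2 < c := by
      by_contra hc
      nlinarith
    obtain rfl | rfl : c = 0 ∨ c = -1 := by omega
    · exact ⟨a, by rw [ha]; exact hpR, by rw [line, ha, zero_smul, add_zero]⟩
    -- For `c = -1` the line is that of the complementary interval, with the opposite sign. The
    -- bound excludes `p = 0`, for which the complement has full length `R`.
    · refine ⟨b, by rw [hb, lastCoord_sub]; linarith [hlt.1], ?_⟩
      rw [line, hb, ← span_neg_singleton]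
      congr 2
      rw [neg_smul, one_smul]
      abel
  · rintro ⟨a, ha, rfl⟩
    obtain ⟨hp, hpR⟩ := F.lastCoord_point_sub h₀ h₁ (src_lt_tgt a)
    refine ⟨?_, F.vec a.castSucc, rfl, ?_⟩
    · rcases F.vec_eq_point a with h | h
      · exact ⟨0, src a, tgt a, src_lt_tgt a, by rw [line, h, zero_smul, add_zero]⟩
      · refine ⟨-1, src a, tgt a, src_lt_tgt a, ?_⟩
        rw [line, h, ← span_neg_singleton]
        congr 2
        rw [neg_smul, one_smul]
        abel
    · rw [abs_lt]
      refine ⟨?_, ha⟩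
      rcases F.vec_eq_point a with h | h
      · rw [h]
        linarith
      · rw [h, lastCoord_sub]
        linarith

lemma lastCoord_vec_mono (h₀ : ∀ k, 0 ≤ lastCoord (F.arc k)) {a b : Fin 13}
    (h : ∀ k, arcCoeff a k ≤ arcCoeff b k) : lastCoord (F.vec a) ≤ lastCoord (F.vec b) := by
  rw [lastCoord_vec, lastCoord_vec]
  exact Finset.sum_le_sum fun k _ => mul_le_mul_of_nonneg_right (h k) (h₀ k)

end Vertices

section Faces

variable {N m : ℕ} (F : Frame N m)

/-- The complex of those sets of intervals in `S` whose lines form a simplex together with the top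
line and the base. -/
noncomputable def model (S : Set (Fin 12)) : PreAbstractSimplicialComplex (Fin 12) where
  faces := {τ | τ.Nonempty ∧ IsBAASimplex (F.simplex τ) ∧ ∀ a ∈ τ, a ∈ S}
  isRelLowerSet_faces := fun {_} h => ⟨h.1, fun _ hts ht => ⟨ht,
    h.2.1.mono (Finset.union_subset_union_left (Finset.image_subset_image
      (Finset.insert_subset_insert _ (Finset.map_subset_map.2 hts)))),
    fun a ha => h.2.2 a (hts ha)⟩⟩

lemma simplex_eq (τ : Finset (Fin 12)) : F.simplex τ =
    τ.image (fun a => F.line a.castSucc) ∪ {F.line 12} ∪ F.baseLines := by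
  rw [simplex, withTop, Finset.image_insert, Finset.map_eq_image, Finset.image_image,
    Finset.insert_eq, Finset.union_comm {F.line 12}]
  rfl

/-- A functional that vanishes on the lines of a set vanishes on their span. -/
lemma not_span_le_sup {σ : Finset (Submodule ℤ (Fin N → ℤ))} {x : Fin N → ℤ}
    (φ : (Fin N → ℤ) →ₗ[ℤ] ℤ) (hσ : ∀ L ∈ σ, L ≤ LinearMap.ker φ) (hx : φ x ≠ 0) :
    ¬ Submodule.span ℤ {x} ≤ σ.sup id := fun h =>
  hx ((Submodule.span_singleton_le_iff_mem _ _).1 (h.trans (Finset.sup_le hσ)))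

/-- The dual of an endpoint vanishes on the base and on the whole circle but not on the interval.
Hence the non-containment conditions in the links hold automatically. -/
lemma line_not_le (a : Fin 12) :
    ¬ F.line a.castSucc ≤ (F.baseLines ∪ {F.line 12}).sup id := by
  refine not_span_le_sup (F.dualPoint (tgt a)) ?_ ?_
  · intro L hL
    rcases Finset.mem_union.1 hL with hL | hL
    · obtain ⟨i, -, rfl⟩ := Finset.mem_image.1 hL
      rw [Submodule.span_singleton_le_iff_mem, LinearMap.mem_ker, dualPoint,
        LinearMap.sub_apply, F.dualArc_base, F.dualArc_base, sub_zero]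
    · rw [Finset.mem_singleton.1 hL, line, Submodule.span_singleton_le_iff_mem,
        LinearMap.mem_ker, F.dualPoint_top]
  · have h := F.dualPoint_sub (tgt a) (tgt a) (src a)
    rw [if_pos rfl, if_neg (src_lt_tgt a).ne', sub_zero] at h
    rcases F.vec_eq_point a with h' | h'
    · rw [h', h]
      exact one_ne_zero
    · rw [h', map_sub, F.dualPoint_top, h]
      norm_num

lemma top_not_le : ¬ F.line 12 ≤ F.baseLines.sup id := by
  refine not_span_le_sup (F.dualArc 3) ?_ ?_
  · intro L hL
    obtain ⟨i, -, rfl⟩ := Finset.mem_image.1 hL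
    rw [Submodule.span_singleton_le_iff_mem, LinearMap.mem_ker, F.dualArc_base]
  · rw [F.dualArc_vec]
    decide

end Faces

/-- The simplices of the complex `Q` in terms of a frame. -/
lemma faces_Q {m n : ℕ} (F : Frame (m + n) m) (hE : F.baseLines = stdSimplexLines m n)
    {v₁ v₂ v₃ w : Fin (m + n) → ℤ} (hw : F.vec 12 = w) (S : Set (Fin 12))
    (hV : ∀ L, ((∃ a : ℤ,
      L = Submodule.span ℤ {v₁ + a • w} ∨
      L = Submodule.span ℤ {v₂ + a • w} ∨
      L = Submodule.span ℤ {v₃ + a • w} ∨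
      L = Submodule.span ℤ {v₁ + v₂ + a • w} ∨
      L = Submodule.span ℤ {v₁ + v₂ + v₃ + a • w} ∨
      L = Submodule.span ℤ {v₁ + v₃ + a • w}) ∧
        ∃ x, L = Submodule.span ℤ {x} ∧ |lastCoord x| < |lastCoord w|) ↔
      ∃ a ∈ S, L = F.line a.castSucc) :
    (Q m n v₁ v₂ v₃ w).faces =
      (fun τ : Finset (Fin 12) => τ.image fun a => F.line a.castSucc) '' (F.model S).faces := by
  have hline : F.line 12 = Submodule.span ℤ {w} := by rw [line, hw]
  ext σ
  constructor
  · rintro ⟨⟨⟨⟨hne, -, ⟨-, -, -, hσ⟩, -⟩, -⟩, hlt⟩, hfam⟩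
    have hσS : ∀ L ∈ σ, ∃ a ∈ S, L = F.line a.castSucc := fun L hL =>
      (hV L).1 ⟨hfam L hL, hlt L hL⟩
    have hinj : Function.Injective fun a : Fin 12 => F.line a.castSucc := fun a b h =>
      Fin.castSucc_injective _ (F.line_injective h)
    classical
    let τ : Finset (Fin 12) := Finset.univ.filter fun a => F.line a.castSucc ∈ σ
    have hτ : τ.image (fun a => F.line a.castSucc) = σ := by
      ext L
      simp only [τ, Finset.mem_image, Finset.mem_filter, Finset.mem_univ, true_and]
      constructor
      · rintro ⟨a, ha, rfl⟩
        exact ha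
      · intro hL
        obtain ⟨a, -, rfl⟩ := hσS L hL
        exact ⟨a, hL, rfl⟩
    refine ⟨τ, ⟨?_, ?_, fun a ha => ?_⟩, hτ⟩
    · rw [← hτ] at hne
      exact Finset.image_nonempty.1 hne
    · rw [simplex_eq, hτ, hline, hE]
      exact hσ
    · obtain ⟨b, hb, hab⟩ := hσS _ (Finset.mem_filter.1 ha).2
      rwa [hinj hab]
  · rintro ⟨τ, ⟨hne, hτ, hS⟩, rfl⟩
    have hv : ∀ L ∈ τ.image (fun a => F.line a.castSucc), ∃ a ∈ S, L = F.line a.castSucc := by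
      intro L hL
      obtain ⟨a, ha, rfl⟩ := Finset.mem_image.1 hL
      exact ⟨a, hS a ha, rfl⟩
    have hn := hne.image fun a => F.line a.castSucc
    -- Non-containment in the spans also yields the disjointness conditions of both links.
    have hnot : ∀ L ∈ τ.image (fun a => F.line a.castSucc),
        ¬ L ≤ (stdSimplexLines m n ∪ {Submodule.span ℤ {w}}).sup id := by
      intro L hL
      obtain ⟨a, -, rfl⟩ := hv L hL
      rw [← hline, ← hE]
      exact F.line_not_le a
    have hnotE : ∀ L ∈ τ.image (fun a => F.line a.castSucc) ∪ {Submodule.span ℤ {w}},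
        ¬ L ≤ (stdSimplexLines m n).sup id := by
      intro L hL hle
      rcases Finset.mem_union.1 hL with hL | hL
      · exact hnot L hL (hle.trans (Finset.sup_mono Finset.subset_union_left))
      · rw [Finset.mem_singleton.1 hL, ← hline, ← hE] at hle
        exact F.top_not_le hle
    refine ⟨⟨⟨⟨hn, ?_, ⟨hn.mono Finset.subset_union_left, ?_,
      hn.mono (Finset.subset_union_left.trans Finset.subset_union_left), ?_⟩, hnotE⟩, hnot⟩,
      fun L hL => ((hV L).2 (hv L hL)).2⟩, fun L hL => ((hV L).2 (hv L hL)).1⟩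
    · rw [Finset.disjoint_singleton_right]
      intro h
      exact hnot _ h (Finset.le_sup (f := id)
        (Finset.mem_union_right _ (Finset.mem_singleton_self _)))
    · rw [Finset.disjoint_left]
      intro L hL hE'
      exact hnotE L hL (Finset.le_sup (f := id) hE')
    · rw [simplex_eq, hline, hE] at hτ
      exact hτ

end Frame

end BAAComplex

/-! ### Construction of the frame of `Q`, and the conclusion. -/

namespace BAAComplex

/-- A dual family for a partial basis and the standard basis vectors that are linked to it. -/
lemma exists_dual_of_mem_Brel {m n : ℕ} {v₁ v₂ v₃ w : Fin (m + n) → ℤ}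
    (hbasis : IsPartialBasis ![v₁, v₂, v₃, w])
    (hsimplex : {Submodule.span ℤ {v₁}, Submodule.span ℤ {v₂}, Submodule.span ℤ {v₃},
      Submodule.span ℤ {w}} ∈ (Brel m n).faces) :
    ∃ D : Fin 4 ⊕ Fin m → (Fin (m + n) → ℤ) →ₗ[ℤ] ℤ, ∀ i j, D i (Sum.elim ![v₁, v₂, v₃, w]
      (fun i => Pi.single (Fin.castAdd n i) (1 : ℤ)) j) = if i = j then 1 else 0 := by
  set b : Fin 4 ⊕ Fin m → Fin (m + n) → ℤ := Sum.elim ![v₁, v₂, v₃, w]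
      (fun i => Pi.single (Fin.castAdd n i) (1 : ℤ)) with hb
  obtain ⟨⟨-, hdisj, -, hlines, hrank, hcompl⟩, -⟩ := hsimplex
  set σ : Finset (Submodule ℤ (Fin (m + n) → ℤ)) := {Submodule.span ℤ {v₁},
    Submodule.span ℤ {v₂}, Submodule.span ℤ {v₃}, Submodule.span ℤ {w}} with hσ
  have hσ' : σ = Finset.univ.image fun i : Fin 4 => Submodule.span ℤ {b (Sum.inl i)} := by
    ext L
    simp only [hσ, hb, Finset.mem_insert, Finset.mem_singleton, Finset.mem_image,
      Finset.mem_univ, true_and, Sum.elim_inl, Fin.exists_fin_succ]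
    simp [eq_comm]
  -- The four lines are distinct by independence, so the standard simplex has exactly `4 + m` lines
  -- and its rank matches the size of the family `b`.
  have hinj : ∀ i j : Fin 4, Submodule.span ℤ {b (Sum.inl i)} =
      Submodule.span ℤ {b (Sum.inl j)} → i = j := by
    intro i j h
    have hli := hbasis.1
    by_contra hne
    rcases Frame.span_eq_iff_sign h with h | h
    · exact hne (hli.injective h.symm)
    · have h' : ![v₁, v₂, v₃, w] j = -![v₁, v₂, v₃, w] i := h
      have := Fintype.linearIndependent_iff.1 hli (fun k => (if k = i then 1 else 0) +
        if k = j then 1 else 0) (by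
          simp only [add_smul, ite_smul, one_smul, zero_smul, Finset.sum_add_distrib,
            Finset.sum_ite_eq', Finset.mem_univ, if_true, h', add_neg_cancel]) i
      simp [hne] at this
  have hcard : (σ ∪ stdSimplexLines m n).card = Fintype.card (Fin 4 ⊕ Fin m) := by
    rw [Finset.card_union_of_disjoint hdisj, hσ', Finset.card_image_of_injective _ hinj,
      stdSimplexLines, Finset.card_image_of_injective]
    · simp
    · intro i j h
      by_contra hne
      rcases Frame.span_eq_iff_sign h with h | h <;>
        have := congrFun h (Fin.castAdd n j) <;> simp [Ne.symm hne] at this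
  have hsup : (σ ∪ stdSimplexLines m n).sup id = Submodule.span ℤ (Set.range b) := by
    rw [Submodule.span_range_eq_iSup, iSup_sum, Finset.sup_union, hσ', stdSimplexLines,
      Finset.sup_image, Finset.sup_image, Finset.sup_univ_eq_iSup, Finset.sup_univ_eq_iSup]
    rfl
  rw [hsup] at hrank hcompl
  exact exists_dual b hcompl (hrank.trans hcard)

/-- The free multiple of `w` absorbs the shifts `c`, and the sign ambiguity of a line makes the
order within each pair irrelevant. -/
lemma eq_sub_iff_exists_permuted {N : ℕ} (y : Fin 4 → Fin N → ℤ) (w : Fin N → ℤ) (c : Fin 4 → ℤ)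
    (π : Equiv.Perm (Fin 4)) (x : Fin 4 → Fin N → ℤ) (hx : ∀ i, x i = y (π i) + c (π i) • w)
    (L : Submodule ℤ (Fin N → ℤ)) :
    (∃ (a : ℤ) (i j : Fin 4), i < j ∧ L = Submodule.span ℤ {y i - y j + a • w}) ↔
      ∃ (a : ℤ) (i j : Fin 4), i < j ∧ L = Submodule.span ℤ {x j - x i + a • w} := by
  have key : ∀ u : Fin 4 → Fin N → ℤ,
      (∃ (a : ℤ) (i j : Fin 4), i < j ∧ L = Submodule.span ℤ {u j - u i + a • w}) ↔
        ∃ (a : ℤ) (i j : Fin 4), i ≠ j ∧ L = Submodule.span ℤ {u i - u j + a • w} := by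
    intro u
    constructor
    · rintro ⟨a, i, j, hij, h⟩
      exact ⟨a, j, i, hij.ne', h⟩
    · rintro ⟨a, i, j, hij, h⟩
      rcases lt_or_gt_of_ne hij with hij | hij
      · refine ⟨-a, i, j, hij, ?_⟩
        rw [h, ← Frame.span_neg_singleton]
        congr 2
        rw [neg_smul]
        abel
      · exact ⟨a, j, i, hij, h⟩
  have key' : (∃ (a : ℤ) (i j : Fin 4), i < j ∧ L = Submodule.span ℤ {y i - y j + a • w}) ↔
        ∃ (a : ℤ) (i j : Fin 4), i ≠ j ∧ L = Submodule.span ℤ {y i - y j + a • w} := by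
    rw [← key]
    constructor <;>
    · rintro ⟨a, i, j, hij, h⟩
      refine ⟨-a, i, j, hij, ?_⟩
      rw [h, ← Frame.span_neg_singleton]
      congr 2
      rw [neg_smul]
      abel
  rw [key, key']
  constructor
  · rintro ⟨a, i, j, hij, h⟩
    refine ⟨a + c j - c i, π.symm i, π.symm j, π.symm.injective.ne hij, ?_⟩
    rw [h, hx, hx, Equiv.apply_symm_apply, Equiv.apply_symm_apply, sub_smul, add_smul]
    congr 2
    abel
  · rintro ⟨a, i, j, hij, h⟩
    refine ⟨a + c (π i) - c (π j), π i, π j, π.injective.ne hij, ?_⟩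
    rw [h, hx, hx, sub_smul, add_smul]
    congr 2
    abel

/-- The six families of lines in the definition of `Q` as differences of four points. -/
lemma exists_family_iff {N : ℕ} (v₁ v₂ v₃ w : Fin N → ℤ) (L : Submodule ℤ (Fin N → ℤ)) :
    (∃ a : ℤ,
      L = Submodule.span ℤ {v₁ + a • w} ∨
      L = Submodule.span ℤ {v₂ + a • w} ∨
      L = Submodule.span ℤ {v₃ + a • w} ∨
      L = Submodule.span ℤ {v₁ + v₂ + a • w} ∨
      L = Submodule.span ℤ {v₁ + v₂ + v₃ + a • w} ∨
      L = Submodule.span ℤ {v₁ + v₃ + a • w}) ↔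
    ∃ (a : ℤ) (i j : Fin 4), i < j ∧
      L = Submodule.span ℤ {(![v₁ + v₂ + v₃, v₁ + v₃, v₃, 0] : Fin 4 → Fin N → ℤ) i -
        (![v₁ + v₂ + v₃, v₁ + v₃, v₃, 0] : Fin 4 → Fin N → ℤ) j + a • w} := by
  have e₁ : v₁ + v₃ - v₃ = v₁ := by abel
  have e₂ : v₁ + v₂ + v₃ - (v₁ + v₃) = v₂ := by abel
  have e₃ : v₃ - 0 = v₃ := by abel
  have e₄ : v₁ + v₂ + v₃ - v₃ = v₁ + v₂ := by abel
  have e₅ : v₁ + v₂ + v₃ - 0 = v₁ + v₂ + v₃ := by abel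
  have e₆ : v₁ + v₃ - 0 = v₁ + v₃ := by abel
  refine exists_congr fun a => ⟨?_, ?_⟩
  · have hcongr : ∀ {x y : Fin N → ℤ}, x = y →
        Submodule.span ℤ {x + a • w} = Submodule.span ℤ {y + a • w} := fun h => by rw [h]
    rintro (h | h | h | h | h | h)
    · exact ⟨1, 2, by decide, h.trans (hcongr e₁.symm)⟩
    · exact ⟨0, 1, by decide, h.trans (hcongr e₂.symm)⟩
    · exact ⟨2, 3, by decide, h.trans (hcongr e₃.symm)⟩
    · exact ⟨0, 2, by decide, h.trans (hcongr e₄.symm)⟩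
    · exact ⟨0, 3, by decide, h.trans (hcongr e₅.symm)⟩
    · exact ⟨1, 3, by decide, h.trans (hcongr e₆.symm)⟩
  · rintro ⟨i, j, hij, rfl⟩
    fin_cases i <;> fin_cases j <;> simp at hij <;> simp [-zsmul_eq_mul, e₁, e₂, e₄]

/-- The frame of the complex `Q`: the four points `v₁ + v₂ + v₃`, `v₁ + v₃`, `v₃` and `0` on the
circle `ℝ w / ℤ w`, sorted by their last coordinates. -/
lemma exists_frame {m n : ℕ} {v₁ v₂ v₃ w : Fin (m + n) → ℤ}
    (hbasis : IsPartialBasis ![v₁, v₂, v₃, w])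
    (hsimplex : {Submodule.span ℤ {v₁}, Submodule.span ℤ {v₂}, Submodule.span ℤ {v₃},
      Submodule.span ℤ {w}} ∈ (Brel m n).faces)
    (hw : 0 < lastCoord w) :
    ∃ F : Frame (m + n) m, F.baseLines = stdSimplexLines m n ∧ F.vec 12 = w ∧
      (∀ k, 0 ≤ lastCoord (F.arc k)) ∧ 0 < lastCoord (F.arc 3) ∧
      ∀ L, (∃ a : ℤ,
        L = Submodule.span ℤ {v₁ + a • w} ∨
        L = Submodule.span ℤ {v₂ + a • w} ∨
        L = Submodule.span ℤ {v₃ + a • w} ∨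
        L = Submodule.span ℤ {v₁ + v₂ + a • w} ∨
        L = Submodule.span ℤ {v₁ + v₂ + v₃ + a • w} ∨
        L = Submodule.span ℤ {v₁ + v₃ + a • w}) ↔
      ∃ (c : ℤ) (i j : Fin 4), i < j ∧
        L = Submodule.span ℤ {F.point j - F.point i + c • w} := by
  obtain ⟨D, hD⟩ := exists_dual_of_mem_Brel hbasis hsimplex
  have hD' : ∀ i, D i v₁ = (if i = Sum.inl 0 then 1 else 0) ∧
      D i v₂ = (if i = Sum.inl 1 then 1 else 0) ∧ D i v₃ = (if i = Sum.inl 2 then 1 else 0) ∧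
      D i w = (if i = Sum.inl 3 then 1 else 0) :=
    fun i => ⟨hD i (Sum.inl 0), hD i (Sum.inl 1), hD i (Sum.inl 2), hD i (Sum.inl 3)⟩
  have hDe : ∀ i j, D i (Pi.single (Fin.castAdd n j) (1 : ℤ)) = if i = Sum.inr j then 1 else 0 :=
    fun i j => hD i (Sum.inr j)
  let y : Fin 4 → Fin (m + n) → ℤ := ![v₁ + v₂ + v₃, v₁ + v₃, v₃, 0]
  -- Dual to the points `y`, except that the last functional is off by the constant `-1` on them.
  -- Only differences of points matter.
  let Y : Fin 4 → (Fin (m + n) → ℤ) →ₗ[ℤ] ℤ := ![D (Sum.inl 1), D (Sum.inl 0) - D (Sum.inl 1),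
    D (Sum.inl 2) - D (Sum.inl 0), -D (Sum.inl 2)]
  -- Subtracting the integer quotient reduces the last coordinate to its remainder in `[0, R)`.
  let c : Fin 4 → ℤ := fun i => -(lastCoord (y i) / lastCoord w)
  let z : Fin 4 → Fin (m + n) → ℤ := fun i => y i + c i • w
  -- The coefficient of `w`, corrected for the shifts so that it vanishes on differences of the `z
  -- i`.
  let W : (Fin (m + n) → ℤ) →ₗ[ℤ] ℤ := D (Sum.inl 3) - ∑ i, c i • Y i
  let π : Equiv.Perm (Fin 4) := Tuple.sort fun i => lastCoord (z i)
  have hYw : ∀ i, Y i w = 0 := by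
    intro i
    fin_cases i <;> simp [Y, hD']
  have hYe : ∀ i j, Y i (Pi.single (Fin.castAdd n j) (1 : ℤ)) = 0 := by
    intro i j
    fin_cases i <;> simp [Y, hDe]
  have hYy : ∀ i j l, Y i (y j - y l) = (if i = j then 1 else 0) - if i = l then 1 else 0 := by
    intro i j l
    fin_cases i <;> fin_cases j <;> fin_cases l <;> simp [Y, y, hD']
  have hYz : ∀ i j l, Y i (z j - z l) = (if i = j then 1 else 0) - if i = l then 1 else 0 := by
    intro i j l
    have h : z j - z l = (y j - y l) + (c j - c l) • w := by
      simp only [z, sub_smul]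
      abel
    rw [h, map_add, map_smul, hYw, smul_zero, add_zero, hYy]
  have hWy : ∀ j l, D (Sum.inl 3) (y j - y l) = 0 := by
    intro j l
    fin_cases j <;> fin_cases l <;> simp [y, hD']
  have hWz : ∀ j l, W (z j - z l) = 0 := by
    intro j l
    have h : z j - z l = (y j - y l) + (c j - c l) • w := by
      simp only [z, sub_smul]
      abel
    have h1 : D (Sum.inl 3) (z j - z l) = c j - c l := by
      rw [h, map_add, map_smul, hWy, (hD' _).2.2.2, if_pos rfl, smul_eq_mul, mul_one, zero_add]
    have h2 : (∑ i, c i • Y i) (z j - z l) = c j - c l := by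
      simp only [LinearMap.sum_apply, LinearMap.smul_apply, hYz, smul_eq_mul, mul_sub, mul_ite,
        mul_one, mul_zero, Finset.sum_sub_distrib, Finset.sum_ite_eq', Finset.mem_univ, if_true]
    rw [show W = D (Sum.inl 3) - ∑ i, c i • Y i from rfl, LinearMap.sub_apply, h1, h2, sub_self]
  have hBz : ∀ (i : Fin m) j l, D (Sum.inr i) (z j - z l) = 0 := by
    intro i j l
    have hy : ∀ j, D (Sum.inr i) (y j) = 0 := by
      intro j
      fin_cases j <;> simp [y, hD']
    simp only [z, map_sub, map_add, map_smul, hy, (hD' _).2.2.2]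
    simp
  have hz : ∀ i, lastCoord (z i) = lastCoord (y i) % lastCoord w := by
    intro i
    simp only [z, c, lastCoord_add, lastCoord_smul]
    rw [Int.emod_def]
    ring
  have hz0 : ∀ i, 0 ≤ lastCoord (z i) := fun i => by
    rw [hz]
    exact Int.emod_nonneg _ hw.ne'
  have hz1 : ∀ i, lastCoord (z i) < lastCoord w := fun i => by
    rw [hz]
    exact Int.emod_lt_of_pos _ hw
  have hmono : ∀ i j, i ≤ j → lastCoord (z (π i)) ≤ lastCoord (z (π j)) := fun i j h =>
    Tuple.monotone_sort (fun i => lastCoord (z i)) h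
  let F : Frame (m + n) m := Frame.ofPoints (fun i => z (π i)) w
    (fun i => Pi.single (Fin.castAdd n i) (1 : ℤ)) (fun i => Y (π i)) W (fun i => D (Sum.inr i))
    (fun i j l => by rw [hYz]; simp only [EmbeddingLike.apply_eq_iff_eq])
    (fun i => hYw _) (fun i j => hYe _ _) (fun j l => hWz _ _)
    (by
      simp only [W, LinearMap.sub_apply, LinearMap.sum_apply, LinearMap.smul_apply, hYw,
        smul_zero, Finset.sum_const_zero, sub_zero, (hD' _).2.2.2]
      simp)
    (fun j => by
      simp only [W, LinearMap.sub_apply, LinearMap.sum_apply, LinearMap.smul_apply, hYe,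
        smul_zero, Finset.sum_const_zero, sub_zero, hDe]
      simp)
    (fun i j l => hBz _ _ _) (fun i => by rw [(hD' _).2.2.2]; simp)
    (fun i j => by rw [hDe]; simp)
  have ha : F.arc = ![z (π 1) - z (π 0), z (π 2) - z (π 1), z (π 3) - z (π 2),
    w - (z (π 3) - z (π 0))] := rfl
  refine ⟨F, rfl, ?_, ?_, ?_, fun L => ?_⟩
  · have h : ∀ k, arcCoeff 12 k = 1 := by decide
    simp only [Frame.vec, h, one_smul, Fin.sum_univ_four, ha]
    simp
  -- Sorting makes the first three arcs nonnegative. The last is positive because all remainders lie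
  -- in `[0, R)`.
  · intro k
    have h1 := hmono 0 1 (by decide)
    have h2 := hmono 1 2 (by decide)
    have h3 := hmono 2 3 (by decide)
    have h4 := hz1 (π 3)
    have h5 := hz0 (π 0)
    rw [ha]
    fin_cases k <;> simp [lastCoord_sub] <;> omega
  · have h4 := hz1 (π 3)
    have h5 := hz0 (π 0)
    rw [ha]
    simp [lastCoord_sub]
    omega
  · have hpt : ∀ i, F.point i = z (π i) - z (π 0) := by
      intro i
      rw [Frame.point, Fin.sum_univ_four, ha]
      fin_cases i <;> simp
    rw [exists_family_iff]
    refine (eq_sub_iff_exists_permuted y w c π (fun i => z (π i)) (fun i => rfl) L).trans ?_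
    simp only [hpt, sub_sub_sub_cancel_right]

theorem finite_faces_Q_and_isNConnected {m n : ℕ} {v₁ v₂ v₃ w : Fin (m + n) → ℤ}
    (hbasis : IsPartialBasis ![v₁, v₂, v₃, w])
    (hsimplex : {Submodule.span ℤ {v₁}, Submodule.span ℤ {v₂}, Submodule.span ℤ {v₃},
      Submodule.span ℤ {w}} ∈ (Brel m n).faces)
    (hw : 0 < lastCoord w) :
    (Q m n v₁ v₂ v₃ w).faces.Finite ∧ IsNConnected 3 (Realization (Q m n v₁ v₂ v₃ w)) := by
  obtain ⟨F, hE, htop, h₀, h₁, hfam⟩ := exists_frame hbasis hsimplex hw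
  let S : Set (Fin 12) := {a | lastCoord (F.vec a.castSucc) < lastCoord (F.vec 12)}
  have hQ := F.faces_Q hE (v₁ := v₁) (v₂ := v₂) (v₃ := v₃) htop S (fun L => by
    rw [hfam, abs_of_pos hw, ← htop]
    exact F.exists_line_iff h₀ h₁ L)
  have hfin : (F.model S).faces.Finite := Set.toFinite _
  refine ⟨hQ ▸ hfin.image _, IsNConnected.of_map (fun a : Fin 12 => F.line a.castSucc)
    (fun a b h => Fin.castSucc_injective _ (F.line_injective h)) hfin hQ ?_⟩
  refine isNConnected_of_isFaceMask S ?_ (fun a b hab hb => ?_) fun f hf => ?_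
  -- Interval `5` is the complement of the last arc, whose length is positive.
  · have h : F.vec (Fin.castSucc 5) = F.point 3 - F.point 0 := by
      simp [Frame.vec, Frame.point, Fin.sum_univ_four, arcCoeff]
    change lastCoord _ < _
    rw [h]
    exact (F.lastCoord_point_sub h₀ h₁ (by decide)).2
  · exact (F.lastCoord_vec_mono h₀ hab).trans_lt hb
  · rw [← F.isBAASimplex_iff hf]
    rfl

end BAAComplex

theorem mainTheorem8 (m n : ℕ) (hn : 4 ≤ n) (v₁ v₂ v₃ w : Fin (m + n) → ℤ)
    (hbasis : BAAComplex.IsPartialBasis ![v₁, v₂, v₃, w])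
    (hsimplex : {Submodule.span ℤ {v₁}, Submodule.span ℤ {v₂}, Submodule.span ℤ {v₃},
      Submodule.span ℤ {w}} ∈ (BAAComplex.Brel m n).faces)
    (hw : 0 < BAAComplex.lastCoord w)
    (h₁ : |BAAComplex.lastCoord v₁| < BAAComplex.lastCoord w)
    (h₂ : |BAAComplex.lastCoord v₂| < BAAComplex.lastCoord w)
    (h₃ : |BAAComplex.lastCoord v₃| < BAAComplex.lastCoord w) :
    (BAAComplex.Q m n v₁ v₂ v₃ w).faces.Finite ∧
      BAAComplex.IsNConnected 3 (BAAComplex.Realization (BAAComplex.Q m n v₁ v₂ v₃ w)) := by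
  exact BAAComplex.finite_faces_Q_and_isNConnected hbasis hsimplex hw
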